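/- Let $Agt=\{1,\dots,n\}$ be a finite set of agents. The formulas of the compass logic of positions $\mathcal L_{\mathsf{CL\text{-}P}^*}(Agt)$ are given by $$\varphi ::= h_i \mid \neg\varphi \mid \varphi\wedge\psi \mid [\alpha]\varphi ,\qquad i\in Agt,\quad \alpha\in\{\Uparrow,\Downarrow,\Rightarrow,\Leftarrow,\Uparrow^*,\Downarrow^*,\Rightarrow^*,\Leftarrow^*\}.$$ A position model is a function $P\colon Agt\to\mathbb Z\times\mathbb Z$. The relations $R_\alpha$ on $\mathbb Z\times\mathbb Z$ are: $(x,y)R_{\Uparrow}(x,y+1)$, $(x,y)R_{\Downarrow}(x,y-1)$, $(x,y)R_{\Rightarrow}(x+1,y)$, $(x,y)R_{\Leftarrow}(x-1,y)$ (and no other pairs), and $R_{\alpha^*}$ is the reflexive transitive closure of $R_\alpha$. Truth at a point $v\in\mathbb Z\times\mathbb Z$ is defined by: $P,v\models h_i$ iff $P(i)=v$; $P,v\models\neg\varphi$ iff $P,v\not\models\varphi$; $P,v\models\varphi\wedge\psi$ iff $P,v\models\varphi$ and $P,v\models\psi$; and $P,v\models[\alpha]\varphi$ iff $P,v'\models\varphi$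 for all $v'$ with $v R_\alpha v'$. A formula $\varphi$ is satisfiable if $P,v\models\varphi$ for some position model $P$ and some point $v$ (equivalently, $\neg\varphi$ is not valid). Formulas are written as words over a fixed finite alphabet in prefix notation, with agents' indices in binary. Theorem. For every finite set $Agt$ of agents, the satisfiability problem for $\mathcal L_{\mathsf{CL\text{-}P}^*}(Agt)$-formulas is in NP. Moreover, the satisfiability problem is in NP also when the number of agents is not fixed in advance, that is, for formulas over an arbitrary finite set of agents $\{1,\dots,n\}$, with $n$ depending on the input formula. Here a language $L$ is in NP if there are a polynomial $p$ and a polynomial-time (deterministic Turing machine) verifier $V$ such that $w\in L$ if and only if there is a binary word $c$ with $|c|\le p(|w|)$ such that $V$ accepts $(w,c)$. -/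

import Mathlib

namespace CompassLogic

/-- The four compass directions. -/
inductive Direction where
  | up
  | down
  | right
  | left

/-- The compass programs: a single move `d`, or its iteration `d*`. -/
inductive Program where
  | move (d : Direction)
  | iter (d : Direction)

/-- Formulas of the compass logic of positions over a set `Agt` of agents:
`φ ::= hᵢ | ¬φ | φ ∧ ψ | [α]φ`, with `i` an agent and `α` a compass program. -/
inductive Formula (Agt : Type) where
  | here (i : Agt)
  | neg (φ : Formula Agt)
  | and (φ ψ : Formula Agt)
  | box (α : Program) (φ : Formula Agt)

/-- A position model assigns to every agent a point of the discrete plane. -/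
abbrev PositionModel (Agt : Type) : Type := Agt → ℤ × ℤ

/-- The accessibility relation of a single move. -/
def Direction.Rel : Direction → ℤ × ℤ → ℤ × ℤ → Prop
  | .up, (x, y), (x', y') => x' = x ∧ y' = y + 1
  | .down, (x, y), (x', y') => x' = x ∧ y' = y - 1
  | .right, (x, y), (x', y') => x' = x + 1 ∧ y' = y
  | .left, (x, y), (x', y') => x' = x - 1 ∧ y' = y

/-- The accessibility relation of a program; iteration is interpreted by the
reflexive transitive closure. -/
def Program.Rel : Program → ℤ × ℤ → ℤ × ℤ → Prop
  | .move d => d.Rel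
  | .iter d => Relation.ReflTransGen d.Rel

/-- `φ.Holds P v`: the formula `φ` is true at the point `v` of the position model `P`. -/
def Formula.Holds {Agt : Type} (P : PositionModel Agt) : Formula Agt → ℤ × ℤ → Prop
  | .here i, v => P i = v
  | .neg φ, v => ¬ φ.Holds P v
  | .and φ ψ, v => φ.Holds P v ∧ ψ.Holds P v
  | .box α φ, v => ∀ v', α.Rel v v' → φ.Holds P v'

/-- Validity: truth at every point of every position model. -/
def Formula.Valid {Agt : Type} (φ : Formula Agt) : Prop :=
  ∀ (P : PositionModel Agt) (v : ℤ × ℤ), φ.Holds P v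

/-- A formula is satisfiable if its negation is not valid. -/
def Formula.Satisfiable {Agt : Type} (φ : Formula Agt) : Prop :=
  ¬ (Formula.neg φ).Valid

/-- The finite alphabet in which formulas are written. -/
inductive Symbol where
  | here
  | bit (b : Bool)
  | neg
  | and
  | box (α : Program)

/-- Formulas over the agents `0, …, n - 1` as words, in prefix (Polish) notation; an agent is
written as the symbol `here` followed by the binary digits of its index (least significant first,
no leading zeros), so that the alphabet does not depend on `n`. -/
def Formula.encode {n : ℕ} : Formula (Fin n) → List Symbol
  | .here i => Symbol.here :: (Nat.bits i).map Symbol.bit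
  | .neg φ => Symbol.neg :: φ.encode
  | .and φ ψ => Symbol.and :: (φ.encode ++ ψ.encode)
  | .box α φ => Symbol.box α :: φ.encode

/-- The satisfiability problem for a fixed set of `n` agents, as a language. -/
def satProblem (n : ℕ) : Language Symbol :=
  {w | ∃ φ : Formula (Fin n), φ.Satisfiable ∧ φ.encode = w}

/-- The satisfiability problem for formulas over an arbitrary finite number of agents, which is
not bounded in advance, as a language. -/
def satProblemUniform : Language Symbol :=
  {w | ∃ (n : ℕ) (φ : Formula (Fin n)), φ.Satisfiable ∧ φ.encode = w}

/-- The word given to a verifier: an instance `w` followed by a certificate `c`, the two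
written with disjoint sets of letters. -/
def verifierInput {Γ : Type} (x : List Γ × List Bool) : List (Γ ⊕ Bool) :=
  x.1.map Sum.inl ++ x.2.map Sum.inr

/-- The class NP: `L` has a verifier `V`, computed by a deterministic (multi-stack) Turing machine
in time polynomial in the length of its input, such that the words of `L` are those that have
a certificate of polynomially bounded length which `V` accepts. -/
def InNP {Γ : Type} (L : Language Γ) : Prop :=
  ∃ (V : List Γ × List Bool → Bool) (p : Polynomial ℕ),
    Nonempty (Turing.TM2ComputableInPolyTime verifierInput Computability.encodeBool V) ∧
    ∀ w : List Γ, w ∈ L ↔ ∃ c : List Bool, c.length ≤ p.eval w.length ∧ V (w, c) = true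

end CompassLogic

/-! Small models. Let m be the length of the word of φ. Truth of φ at a point depends only on the
signed distances between the agents and the point, coordinate by coordinate, truncated at a
precision linear in m. This is an Ehrenfeucht–Fraïssé argument: each box costs one unit of
precision, and an iterated move in one structure can be answered in the other
(`SamePlace.exists_ge`, `Formula.holds_iff_of_samePlace`). Hence each axis may be compressed by
keeping only the integers close to some agent. The result is a model in a square of side O(m²) whose
agents stay away from the border (`Formula.exists_small_model`), so truth values are constant from
the outermost two rows and columns outwards (`Formula.holds_iff_of_inside`).

Certificates. The certificate is the table of truth values of all subformulas at all points of such
a square, row by row from the bottom. Each cell is a block: a copy of the word of φ with one truth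
value per position, closed by an end letter. Being a correct table is a local condition. Boolean
connectives are checked inside a block. A single move relates neighbouring cells. An iterated box
obeys `□*ψ = ψ ∧ next □*ψ`, with a base case at the border. A position holding `here` must be true
in exactly one cell, off the border, and positions naming the same agent must agree. A table passing
these tests, extended constantly to the plane, yields a model (`holds_iff_bit`,
`Accepted.mem_satWords`).

Annotations. To make the tests local, a letter also stores the truth value at the following position
(`child`, the body of a box), whether its own position was true in an earlier cell (`seen`), the
parity of its block (`par`), and the borders its cell lies on. The instance with its delimiter
serves as block 0 (`hdr`), so copying symbols from block to block ties the certificate to the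
instance.

The machine. Prefix notation read from right to left is evaluated with a stack of truth values, so
one pushdown pass parses every block and checks the Boolean clauses. All other tests compare letters
at a fixed distance D: less than a block (same agent), one block (horizontal neighbours), one row
(vertical neighbours). The machine makes a finite-state pass for every D, in quadratic time overall;
the letters at D - 1 and D reveal which test is due (`Scanner.Ok`). A bound on agents is handled by
truncating the binary index while reading, so both claims are instances of `inNP_satWords`. -/

namespace CompassLogic

/-- The data of a verifier that makes one pushdown pass over a word of letters, and then, for every
shift `D`, one finite-state pass over the pairs of letters at distance `D`.  The word consists of
the letters of the instance, a delimiter, and the letters decoded from the certificate; all passes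
run from right to left. -/
structure ShiftVerifier (Γ : Type) where
  Letter : Type
  Q : Type
  R : Type
  [finLetter : Fintype Letter]
  [finQ : Fintype Q]
  [finR : Fintype R]
  header : Γ → Letter
  delim : Letter
  code₀ : Letter
  next : Letter → Letter
  body : Letter → Letter
  q₀ : Q
  pops : Letter → Fin 3
  pdaStep : Q → Letter → Option Bool → Option Bool → Q
  pushed : Letter → Option Bool
  pdaOk : Q → Bool
  r₀ : R
  scanStep : R → Letter → Letter → R
  scanOk : R → Option Letter → Bool

/-! ### The passes as functions on words -/

namespace ShiftVerifier

variable {Γ : Type} (S : ShiftVerifier Γ)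

/-- The letters written by a certificate: each is given by its number in unary. -/
def decode : S.Letter → List Bool → List S.Letter
  | _, [] => []
  | a, true :: c => decode (S.next a) c
  | a, false :: c => S.body a :: decode S.code₀ c

/-- The word on which the passes are made. -/
def word (w : List Γ) (c : List Bool) : List S.Letter :=
  w.map S.header ++ S.delim :: S.decode S.code₀ c

/-- The effect on the evaluation stack of reading a letter. -/
def pushOnto (a : S.Letter) (E : List Bool) : List Bool :=
  (S.pushed a).toList ++ E

/-- One step of the pushdown pass. -/
def pda (x : S.Q × List Bool) (a : S.Letter) : S.Q × List Bool :=
  match S.pops a with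
  | 0 => (S.pdaStep x.1 a none none, S.pushOnto a x.2)
  | 1 => (S.pdaStep x.1 a x.2.head? none, S.pushOnto a x.2.tail)
  | 2 => (S.pdaStep x.1 a x.2.head? x.2.tail.head?, S.pushOnto a x.2.tail.tail)

/-- One step of a pass over pairs of letters. -/
def scan (r : S.R) (p : S.Letter × S.Letter) : S.R := S.scanStep r p.1 p.2

/-- The outcome of the pass with shift `D` over a reversed word. -/
def shiftOk (z : List S.Letter) (D : ℕ) : Bool :=
  S.scanOk (((z.drop D).zip z).foldl S.scan S.r₀) (z.drop (z.length - D)).head?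

/-- The outcome of all passes over a reversed word. -/
def accepts (z : List S.Letter) : Bool :=
  S.pdaOk (z.foldl S.pda (S.q₀, [])).1 && (List.range (z.length + 1)).all (S.shiftOk z)

/-- The verifier. -/
def verify (x : List Γ × List Bool) : Bool := S.accepts (S.word x.1 x.2).reverse

theorem length_decode_le (a : S.Letter) (c : List Bool) : (S.decode a c).length ≤ c.length := by
  induction c generalizing a with
  | nil => simp [decode]
  | cons b c ih =>
    cases b
    · simpa [decode] using ih _
    · exact (ih _).trans (by simp)

theorem length_pda_le (x : S.Q × List Bool) (a : S.Letter) :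
    (S.pda x a).2.length ≤ x.2.length + 1 := by
  have h (E : List Bool) : (S.pushOnto a E).length ≤ E.length + 1 := by
    unfold pushOnto; cases S.pushed a <;> simp
  unfold pda
  split
  · exact h _
  · exact (h _).trans (by simp)
  · exact (h _).trans (by simp; omega)

theorem length_foldl_pda_le (z : List S.Letter) (x : S.Q × List Bool) :
    (z.foldl S.pda x).2.length ≤ x.2.length + z.length := by
  induction z generalizing x with
  | nil => simp
  | cons a z ih =>
    have := S.length_pda_le x a
    have := ih (S.pda x a)
    simp only [List.foldl_cons, List.length_cons]
    omega

/-! ### The machine -/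

/-- The stacks of the machine. -/
inductive Stack where
  | input | output | a | a' | b | b' | c | e
  deriving DecidableEq

instance : Fintype Stack where
  elems := {.input, .output, .a, .a', .b, .b', .c, .e}
  complete k := by cases k <;> decide

/-- The labels of the machine. -/
inductive Label where
  | readInstance | readCertificate | pda | scan | restoreB | restoreA | clean
  deriving DecidableEq

instance : Fintype Label where
  elems := {.readInstance, .readCertificate, .pda, .scan, .restoreB, .restoreA, .clean}
  complete k := by cases k <;> decide

/-- The alphabets of the stacks. -/
abbrev Alphabet : Stack → Type
  | .input => Γ ⊕ Bool
  | .output => Bool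
  | .e => Bool
  | _ => S.Letter

/-- The internal states of the machine. -/
structure Control where
  buf : Option (Γ ⊕ Bool)
  cur : Option S.Letter
  cur' : Option S.Letter
  code : S.Letter
  top : Option Bool
  top' : Option Bool
  q : S.Q
  r : S.R
  ok : Bool

theorem finite_control [Finite Γ] : Finite S.Control := by
  have := S.finLetter
  have := S.finQ
  have := S.finR
  refine Finite.of_injective (fun x : S.Control =>
    (x.buf, x.cur, x.cur', x.code, x.top, x.top', x.q, x.r, x.ok)) ?_
  rintro ⟨⟩ ⟨⟩ h
  simpa using h

/-- The initial internal state. -/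
def control₀ : S.Control := ⟨none, none, none, S.code₀, none, none, S.q₀, S.r₀, false⟩

/-- Statements of the machine. -/
abbrev Statement := Turing.TM2.Stmt S.Alphabet Label S.Control

open Turing.TM2.Stmt in
/-- Write a letter on the three working stacks and continue with a label. -/
def store (f : S.Control → S.Letter) (q : S.Statement) : S.Statement :=
  push Stack.a f (push Stack.b f (push Stack.c f q))

open Turing.TM2.Stmt in
/-- The end of a step of the pushdown pass. -/
def pdaEnd : S.Statement :=
  load (fun v => { v with q := S.pdaStep v.q (v.cur.getD S.delim) v.top v.top' })
    (branch (fun v => (S.pushed (v.cur.getD S.delim)).isSome)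
      (push Stack.e (fun v => (S.pushed (v.cur.getD S.delim)).getD false) (goto fun _ => Label.pda))
      (goto fun _ => Label.pda))

open Turing.TM2.Stmt in
/-- The program of the machine. -/
def program : Label → S.Statement
  | .readInstance =>
    peek Stack.input (fun v x => { v with buf := x })
      (branch (fun v => v.buf.elim false Sum.isLeft)
        (S.store (fun v => v.buf.elim S.delim (Sum.elim S.header fun _ => S.delim))
          (pop Stack.input (fun v _ => v) (goto fun _ => Label.readInstance)))
        (S.store (fun _ => S.delim) (goto fun _ => Label.readCertificate)))
  | .readCertificate =>
    pop Stack.input (fun v x => { v with buf := x })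
      (branch (fun v => v.buf.isNone) (goto fun _ => Label.pda)
        (branch (fun v => v.buf.elim false (Sum.elim (fun _ => false) id))
          (load (fun v => { v with code := S.next v.code }) (goto fun _ => Label.readCertificate))
          (S.store (fun v => S.body v.code)
            (load (fun v => { v with code := S.code₀ }) (goto fun _ => Label.readCertificate)))))
  | .pda =>
    pop Stack.c (fun v x => { v with cur := x, top := none, top' := none })
      (branch (fun v => v.cur.isNone)
        (load (fun v => { v with ok := S.pdaOk v.q }) (goto fun _ => Label.scan))
        (branch (fun v => S.pops (v.cur.getD S.delim) = 0) S.pdaEnd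
          (pop Stack.e (fun v x => { v with top := x })
            (branch (fun v => S.pops (v.cur.getD S.delim) = 1) S.pdaEnd
              (pop Stack.e (fun v x => { v with top' := x }) S.pdaEnd)))))
  | .scan =>
    pop Stack.a (fun v x => { v with cur := x })
      (branch (fun v => v.cur.isNone)
        (peek Stack.b (fun v x => { v with ok := v.ok && S.scanOk v.r x })
          (goto fun _ => Label.restoreB))
        (pop Stack.b (fun v x => { v with cur' := x })
          (push Stack.a' (fun v => v.cur.getD S.delim)
            (push Stack.b' (fun v => v.cur'.getD S.delim)
              (load
                (fun v =>
                  { v with r := S.scanStep v.r (v.cur.getD S.delim) (v.cur'.getD S.delim) })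
                (goto fun _ => Label.scan))))))
  | .restoreB =>
    pop Stack.b' (fun v x => { v with cur := x })
      (branch (fun v => v.cur.isNone) (goto fun _ => Label.restoreA)
        (push Stack.b (fun v => v.cur.getD S.delim) (goto fun _ => Label.restoreB)))
  | .restoreA =>
    pop Stack.a' (fun v x => { v with cur := x })
      (branch (fun v => v.cur.isNone)
        (pop Stack.a (fun v x => { v with cur := x, r := S.r₀ })
          (goto fun v => if v.cur.isNone then .clean else .scan))
        (push Stack.a (fun v => v.cur.getD S.delim) (goto fun _ => Label.restoreA)))
  | .clean =>
    pop Stack.b (fun v x => { v with cur := x })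
      (pop Stack.e (fun v x => { v with top := x })
        (branch (fun v => v.cur.isNone && v.top.isNone)
          (push Stack.output (fun v => v.ok) (load (fun _ => S.control₀) halt))
          (goto fun _ => Label.clean)))

/-- The contents of the stacks. -/
def contents (i : List (Γ ⊕ Bool)) (o : List Bool) (a a' b b' c : List S.Letter) (e : List Bool) :
    ∀ k, List (S.Alphabet k)
  | .input => i
  | .output => o
  | .a => a
  | .a' => a'
  | .b => b
  | .b' => b'
  | .c => c
  | .e => e

section contents

variable (i : List (Γ ⊕ Bool)) (o : List Bool) (a a' b b' c : List S.Letter) (e : List Bool)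

@[simp] theorem contents_input : S.contents i o a a' b b' c e .input = i := rfl
@[simp] theorem contents_output : S.contents i o a a' b b' c e .output = o := rfl
@[simp] theorem contents_a : S.contents i o a a' b b' c e .a = a := rfl
@[simp] theorem contents_a' : S.contents i o a a' b b' c e .a' = a' := rfl
@[simp] theorem contents_b : S.contents i o a a' b b' c e .b = b := rfl
@[simp] theorem contents_b' : S.contents i o a a' b b' c e .b' = b' := rfl
@[simp] theorem contents_c : S.contents i o a a' b b' c e .c = c := rfl
@[simp] theorem contents_e : S.contents i o a a' b b' c e .e = e := rfl

@[simp] theorem update_input (x : List (Γ ⊕ Bool)) :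
    Function.update (S.contents i o a a' b b' c e) .input x = S.contents x o a a' b b' c e := by
  funext k; cases k <;> rfl
@[simp] theorem update_output (x : List Bool) :
    Function.update (S.contents i o a a' b b' c e) .output x = S.contents i x a a' b b' c e := by
  funext k; cases k <;> rfl
@[simp] theorem update_a (x : List S.Letter) :
    Function.update (S.contents i o a a' b b' c e) .a x = S.contents i o x a' b b' c e := by
  funext k; cases k <;> rfl
@[simp] theorem update_a' (x : List S.Letter) :
    Function.update (S.contents i o a a' b b' c e) .a' x = S.contents i o a x b b' c e := by
  funext k; cases k <;> rfl
@[simp] theorem update_b (x : List S.Letter) :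
    Function.update (S.contents i o a a' b b' c e) .b x = S.contents i o a a' x b' c e := by
  funext k; cases k <;> rfl
@[simp] theorem update_b' (x : List S.Letter) :
    Function.update (S.contents i o a a' b b' c e) .b' x = S.contents i o a a' b x c e := by
  funext k; cases k <;> rfl
@[simp] theorem update_c (x : List S.Letter) :
    Function.update (S.contents i o a a' b b' c e) .c x = S.contents i o a a' b b' x e := by
  funext k; cases k <;> rfl
@[simp] theorem update_e (x : List Bool) :
    Function.update (S.contents i o a a' b b' c e) .e x = S.contents i o a a' b b' c x := by
  funext k; cases k <;> rfl

end contents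

/-- Configurations of the machine. -/
abbrev Config := Turing.TM2.Cfg S.Alphabet Label S.Control

/-- The machine goes from one configuration to another in at most `t` steps. -/
def Runs (x y : S.Config) (t : ℕ) : Prop :=
  ∃ n ≤ t, (flip bind (Turing.TM2.step S.program))^[n] (some x) = some y

variable {S}

theorem Runs.trans {x y z : S.Config} {t u : ℕ} (h : S.Runs x y t) (h' : S.Runs y z u) :
    S.Runs x z (t + u) := by
  obtain ⟨n, hn, h⟩ := h
  obtain ⟨m, hm, h'⟩ := h'
  refine ⟨m + n, by omega, ?_⟩
  rw [Function.iterate_add_apply, h, h']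

theorem Runs.mono {x y : S.Config} {t u : ℕ} (h : S.Runs x y t) (htu : t ≤ u) : S.Runs x y u := by
  obtain ⟨n, hn, h⟩ := h
  exact ⟨n, hn.trans htu, h⟩

theorem Runs.step {x y : S.Config} (h : Turing.TM2.step S.program x = some y) : S.Runs x y 1 :=
  ⟨1, le_rfl, h⟩

theorem Runs.head {x y z : S.Config} {t : ℕ} (h : Turing.TM2.step S.program x = some y)
    (h' : S.Runs y z t) : S.Runs x z (t + 1) := by
  rw [add_comm]
  exact (Runs.step h).trans h'

/-! ### Correctness and running time of the phases of the machine -/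

variable (S)

/-- The input is only peeked at, so the letter that ends the instance is still there for the next
phase. Of the control, only the registers used later are tracked; the buffers hold leftovers, hence
the existential. -/
theorem runs_readInstance (w : List Γ) (d : List Bool) (z : List S.Letter) (v : S.Control) :
    ∃ v' : S.Control, v'.code = v.code ∧ v'.q = v.q ∧ v'.r = v.r ∧
      S.Runs ⟨some .readInstance, v, S.contents (w.map Sum.inl ++ d.map Sum.inr) [] z [] z [] z []⟩
        ⟨some .readCertificate, v',
          let z' := S.delim :: (w.map S.header).reverse ++ z
          S.contents (d.map Sum.inr) [] z' [] z' [] z' []⟩ (w.length + 1) := by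
  induction w generalizing z v with
  | nil =>
    refine ⟨{ v with buf := (d.map Sum.inr).head? }, rfl, rfl, rfl, Runs.step ?_⟩
    cases d <;> simp [program, store]
  | cons x w ih =>
    obtain ⟨v', h1, h2, h3, h⟩ := ih (S.header x :: z) { v with buf := some (.inl x) }
    refine ⟨v', h1, h2, h3, Runs.head ?_ (by simpa using h)⟩
    simp [program, store]

theorem runs_readCertificate (d : List Bool) (z : List S.Letter) (v : S.Control) :
    ∃ v' : S.Control, v'.q = v.q ∧ v'.r = v.r ∧
      S.Runs ⟨some .readCertificate, v, S.contents (d.map Sum.inr) [] z [] z [] z []⟩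
        ⟨some .pda, v',
          let z' := (S.decode v.code d).reverse ++ z
          S.contents [] [] z' [] z' [] z' []⟩ (d.length + 1) := by
  induction d generalizing z v with
  | nil =>
    refine ⟨{ v with buf := none }, rfl, rfl, Runs.step ?_⟩
    simp [program, decode]
  | cons x d ih =>
    cases x
    · obtain ⟨v', h1, h2, h⟩ :=
        ih (S.body v.code :: z) { v with buf := some (.inr false), code := S.code₀ }
      refine ⟨v', h1, h2, Runs.head ?_ (by simpa [decode] using h)⟩
      simp [program, store]
    · obtain ⟨v', h1, h2, h⟩ :=
        ih z { v with buf := some (.inr true), code := S.next v.code }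
      refine ⟨v', h1, h2, Runs.head ?_ (by simpa [decode] using h)⟩
      simp [program]

/-- The pass consumes the copy on stack `c`; the copies on `a` and `b` are kept for the shifts. The
evaluation stack is left as it is and emptied at the very end. -/
theorem runs_pda (z c : List S.Letter) (e : List Bool) (v : S.Control) :
    ∃ v' : S.Control, v'.r = v.r ∧ v'.ok = S.pdaOk (c.foldl S.pda (v.q, e)).1 ∧
      S.Runs ⟨some .pda, v, S.contents [] [] z [] z [] c e⟩
        ⟨some .scan, v', S.contents [] [] z [] z [] [] (c.foldl S.pda (v.q, e)).2⟩
        (c.length + 1) := by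
  induction c generalizing e v with
  | nil =>
    refine ⟨{ v with cur := none, top := none, top' := none, ok := S.pdaOk v.q }, rfl, rfl,
      Runs.step ?_⟩
    simp [program]
  | cons x c ih =>
    have key : ∃ v₁ : S.Control, v₁.r = v.r ∧ v₁.q = (S.pda (v.q, e) x).1 ∧
        Turing.TM2.step S.program ⟨some .pda, v, S.contents [] [] z [] z [] (x :: c) e⟩ =
          some ⟨some .pda, v₁, S.contents [] [] z [] z [] c (S.pda (v.q, e) x).2⟩ := by
      have h3 : S.pops x = 0 ∨ S.pops x = 1 ∨ S.pops x = 2 := by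
        generalize S.pops x = n
        revert n; decide
      rcases h3 with h3 | h3 | h3
      · refine ⟨{ v with cur := some x, top := none, top' := none,
                         q := (S.pda (v.q, e) x).1 }, rfl, rfl, ?_⟩
        cases hp : S.pushed x <;> simp [program, pdaEnd, pda, pushOnto, h3, hp]
      · refine ⟨{ v with cur := some x, top := e.head?, top' := none,
                         q := (S.pda (v.q, e) x).1 }, rfl, rfl, ?_⟩
        cases hp : S.pushed x <;> simp [program, pdaEnd, pda, pushOnto, h3, hp]
      · refine ⟨{ v with cur := some x, top := e.head?, top' := e.tail.head?,
                         q := (S.pda (v.q, e) x).1 }, rfl, rfl, ?_⟩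
        cases hp : S.pushed x <;> simp [program, pdaEnd, pda, pushOnto, h3, hp]
    obtain ⟨v₁, hr, hq, hs⟩ := key
    obtain ⟨v', h1, h2, h⟩ := ih (S.pda (v.q, e) x).2 v₁
    rw [hq] at h h2
    exact ⟨v', h1.trans hr, h2, Runs.head hs h⟩

/-- Stack `a`, shorter by the shift, runs out first. The top of `b` is then the letter just beyond
the last pair, which is the one handed to `scanOk`. -/
theorem runs_scan (a a' b b' : List S.Letter) (e : List Bool) (v : S.Control)
    (hab : a.length ≤ b.length) :
    ∃ v' : S.Control, v'.ok = (v.ok && S.scanOk ((a.zip b).foldl S.scan v.r)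
        (b.drop a.length).head?) ∧
      S.Runs ⟨some .scan, v, S.contents [] [] a a' b b' [] e⟩
        ⟨some .restoreB, v', S.contents [] [] [] (a.reverse ++ a') (b.drop a.length)
          ((b.take a.length).reverse ++ b') [] e⟩ (a.length + 1) := by
  induction a generalizing a' b b' v with
  | nil =>
    refine ⟨{ v with cur := none, ok := v.ok && S.scanOk v.r b.head? }, by simp, Runs.step ?_⟩
    simp [program]
  | cons x a ih =>
    cases b with
    | nil => simp at hab
    | cons y b =>
      obtain ⟨v', h1, h⟩ := ih (x :: a') b (y :: b')
        { v with cur := some x, cur' := some y, r := S.scanStep v.r x y } (by simpa using hab)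
      refine ⟨v', by simpa [scan] using h1, Runs.head ?_ (by simpa using h)⟩
      simp [program]

theorem runs_restoreB (a' b b' : List S.Letter) (e : List Bool) (v : S.Control) :
    ∃ v' : S.Control, v'.ok = v.ok ∧
      S.Runs ⟨some .restoreB, v, S.contents [] [] [] a' b b' [] e⟩
        ⟨some .restoreA, v', S.contents [] [] [] a' (b'.reverse ++ b) [] [] e⟩ (b'.length + 1) := by
  induction b' generalizing b v with
  | nil =>
    refine ⟨{ v with cur := none }, rfl, Runs.step ?_⟩
    simp [program]
  | cons x b' ih =>
    obtain ⟨v', h1, h⟩ := ih (x :: b) { v with cur := some x }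
    refine ⟨v', by simpa using h1, Runs.head ?_ (by simpa using h)⟩
    simp [program]

/-- Dropping one letter from the restored stack `a` raises the shift by one; if there is none to
drop, all shifts have been tried. -/
theorem runs_restoreA (a a' b : List S.Letter) (e : List Bool) (v : S.Control) :
    ∃ v' : S.Control, v'.ok = v.ok ∧ v'.r = S.r₀ ∧
      S.Runs ⟨some .restoreA, v, S.contents [] [] a a' b [] [] e⟩
        ⟨some (if (a'.reverse ++ a).isEmpty then .clean else .scan), v',
          S.contents [] [] (a'.reverse ++ a).tail [] b [] [] e⟩ (a'.length + 1) := by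
  induction a' generalizing a v with
  | nil =>
    refine ⟨{ v with cur := a.head?, r := S.r₀ }, rfl, rfl, Runs.step ?_⟩
    cases a <;> simp [program]
  | cons x a' ih =>
    obtain ⟨v', h1, h2, h⟩ := ih (x :: a) { v with cur := some x }
    refine ⟨v', by simpa using h1, h2, Runs.head ?_ (by simpa using h)⟩
    simp [program]

theorem runs_pass (a b : List S.Letter) (e : List Bool) (v : S.Control) (hv : v.r = S.r₀)
    (hab : a.length ≤ b.length) :
    ∃ v' : S.Control, v'.ok = (v.ok && S.scanOk ((a.zip b).foldl S.scan S.r₀)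
        (b.drop a.length).head?) ∧ v'.r = S.r₀ ∧
      S.Runs ⟨some .scan, v, S.contents [] [] a [] b [] [] e⟩
        ⟨some (if a.isEmpty then .clean else .scan), v', S.contents [] [] a.tail [] b [] [] e⟩
        (3 * (b.length + 1)) := by
  obtain ⟨v₁, h1, r1⟩ := S.runs_scan a [] b [] e v hab
  obtain ⟨v₂, h2, r2⟩ := S.runs_restoreB (a.reverse ++ []) (b.drop a.length)
    ((b.take a.length).reverse ++ []) e v₁
  obtain ⟨v₃, h3, h3', r3⟩ := S.runs_restoreA [] (a.reverse ++ [])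
    (((b.take a.length).reverse ++ []).reverse ++ b.drop a.length) e v₂
  refine ⟨v₃, by rw [h3, h2, h1, hv], h3', ?_⟩
  simp only [List.append_nil, List.reverse_reverse, List.take_append_drop] at r3 r2 r1
  refine ((r1.trans r2).trans r3).mono ?_
  simp only [List.length_reverse, List.length_take]
  omega

theorem runs_passes (z : List S.Letter) (e : List Bool) (n D : ℕ) (hD : D + n = z.length)
    (v : S.Control) (hv : v.r = S.r₀) :
    ∃ v' : S.Control, v'.ok = (v.ok && (List.range' D (n + 1)).all (S.shiftOk z)) ∧
      S.Runs ⟨some .scan, v, S.contents [] [] (z.drop D) [] z [] [] e⟩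
        ⟨some .clean, v', S.contents [] [] [] [] z [] [] e⟩
        ((n + 1) * (3 * (z.length + 1))) := by
  induction n generalizing D v with
  | zero =>
    obtain ⟨v', h1, -, h⟩ := S.runs_pass (z.drop D) z e v hv (by simp)
    have hz : z.drop D = [] := by simp; omega
    refine ⟨v', by simp [h1, shiftOk], ?_⟩
    simpa [hz] using h
  | succ n ih =>
    obtain ⟨v₁, h1, h1', r1⟩ := S.runs_pass (z.drop D) z e v hv (by simp)
    obtain ⟨v₂, h2, r2⟩ := ih (D + 1) (by omega) v₁ h1'
    refine ⟨v₂, ?_, ?_⟩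
    · rw [h2, h1, List.range'_succ (s := D) (n := n + 1), List.all_cons, ← Bool.and_assoc]
      simp [shiftOk]
    · have hz : (z.drop D).isEmpty = false := by simp; omega
      rw [hz] at r1
      simp only [List.tail_drop] at r1
      refine (r1.trans r2).mono (le_of_eq (by ring))

/-- A halting configuration with an output must have the initial control and no other non-empty
stack. -/
theorem runs_clean (b : List S.Letter) (e : List Bool) (v : S.Control) :
    S.Runs ⟨some .clean, v, S.contents [] [] [] [] b [] [] e⟩
      ⟨none, S.control₀, S.contents [] [v.ok] [] [] [] [] [] []⟩ (b.length + e.length + 1) := by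
  induction h : b.length + e.length using Nat.strong_induction_on generalizing b e v with
  | _ n ih =>
    by_cases hbe : b = [] ∧ e = []
    · obtain ⟨rfl, rfl⟩ := hbe
      refine (Runs.step ?_).mono (by omega)
      simp [program]
    · refine Runs.mono (Runs.head ?_ (ih (b.tail.length + e.tail.length) ?_ b.tail e.tail
        { v with cur := b.head?, top := e.head? } rfl)) ?_
      · cases b <;> cases e <;> simp_all [program]
      · cases b <;> cases e <;> simp_all <;> omega
      · cases b <;> cases e <;> simp_all; omega

theorem runs_verify (w : List Γ) (c : List Bool) :
    S.Runs ⟨some .readInstance, S.control₀, S.contents (verifierInput (w, c)) [] [] [] [] [] [] []⟩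
      ⟨none, S.control₀, S.contents [] [S.verify (w, c)] [] [] [] [] [] []⟩
      (10 * (w.length + c.length + 2) ^ 2) := by
  obtain ⟨v₁, hc1, hq1, hr1, r1⟩ := S.runs_readInstance w c [] S.control₀
  obtain ⟨v₂, hq2, hr2, r2⟩ :=
    S.runs_readCertificate c (S.delim :: (w.map S.header).reverse ++ []) v₁
  have hz : (S.decode v₁.code c).reverse ++ (S.delim :: (w.map S.header).reverse ++ []) =
      (S.word w c).reverse := by
    rw [hc1]; simp [word, control₀]
  simp only [hz] at r2
  have hlen : (S.word w c).reverse.length ≤ w.length + c.length + 1 := by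
    have := S.length_decode_le S.code₀ c
    simp [word]
    omega
  set z := (S.word w c).reverse with hzdef
  obtain ⟨v₃, hr3, hok3, r3⟩ := S.runs_pda z z [] v₂
  obtain ⟨v₄, hok4, r4⟩ := S.runs_passes z (z.foldl S.pda (v₂.q, [])).2 z.length 0 (by simp) v₃
    (by rw [hr3, hr2, hr1]; rfl)
  have r5 := S.runs_clean z (z.foldl S.pda (v₂.q, [])).2 v₄
  have hq : v₂.q = S.q₀ := by rw [hq2, hq1]; rfl
  have hok : v₄.ok = S.verify (w, c) := by
    rw [hok4, hok3, hq, verify, accepts, List.range_eq_range']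
  rw [hok] at r5
  refine ((((r1.trans r2).trans r3).trans r4).trans r5).mono ?_
  have := S.length_foldl_pda_le z (v₂.q, [])
  simp only [List.length_nil, zero_add] at this ⊢
  -- The dominant cost: one pass for each shift from 0 to the length of the word, each of linear
  -- length.
  have h6 : (z.length + 1) * (3 * (z.length + 1)) ≤ 3 * (w.length + c.length + 2) ^ 2 := by
    nlinarith
  nlinarith

/-- The machine. -/
noncomputable def machine [Fintype Γ] : Turing.FinTM2 :=
  letI : Fintype (S.Alphabet .input) := inferInstanceAs (Fintype (Γ ⊕ Bool))
  letI : Fintype S.Control := @Fintype.ofFinite _ S.finite_control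
  { k₀ := .input
    k₁ := .output
    Γ := S.Alphabet
    Λ := Label
    main := .readInstance
    σ := S.Control
    initialState := S.control₀
    m := S.program }

theorem initList_machine [Fintype Γ] (l : List (Γ ⊕ Bool)) :
    Turing.initList S.machine l =
      (⟨some .readInstance, S.control₀, S.contents l [] [] [] [] [] [] []⟩ : S.Config) := by
  unfold Turing.initList
  congr 1
  funext k
  cases k <;> rfl

theorem haltList_machine [Fintype Γ] (l : List Bool) :
    Turing.haltList S.machine l =
      (⟨none, S.control₀, S.contents [] l [] [] [] [] [] []⟩ : S.Config) := by
  unfold Turing.haltList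
  congr 1
  funext k
  cases k <;> rfl

open Polynomial in
/-- The verifier runs in polynomial time. -/
theorem polyTime [Fintype Γ] :
    Nonempty (Turing.TM2ComputableInPolyTime verifierInput Computability.encodeBool S.verify) := by
  -- The list `l` is a separate variable because the machine receives the input mapped along the
  -- identity of the alphabet.
  have key (x : List Γ × List Bool) (l : List (Γ ⊕ Bool)) (hl : l = verifierInput x) :
      Nonempty (Turing.TM2OutputsInTime S.machine l (some [S.verify x])
        ((10 * (X + 2) ^ 2 : ℕ[X]).eval (verifierInput x).length)) := by
    subst hl
    obtain ⟨n, hn, h⟩ := S.runs_verify x.1 x.2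
    refine ⟨⟨⟨n, ?_⟩, hn.trans (le_of_eq (by simp [verifierInput]))⟩⟩
    exact (congrArg (fun y => (flip bind S.machine.step)^[n] (some y))
      (S.initList_machine _)).trans (h.trans (congrArg some (S.haltList_machine _).symm))
  exact ⟨{ tm := S.machine, inputAlphabet := Equiv.refl _, outputAlphabet := Equiv.refl _,
           time := 10 * (X + 2) ^ 2,
           outputsFun := fun x => Classical.choice (key x _ (List.map_id _)) }⟩

end ShiftVerifier

/-! ### Formulas whose agents are natural numbers -/

/-- Renaming of agents. -/
def Formula.map {A B : Type} (f : A → B) : Formula A → Formula B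
  | .here i => .here (f i)
  | .neg φ => .neg (φ.map f)
  | .and φ ψ => .and (φ.map f) (ψ.map f)
  | .box α φ => .box α (φ.map f)

theorem Formula.holds_map {A B : Type} (f : A → B) (P : PositionModel B) (φ : Formula A)
    (v : ℤ × ℤ) : (φ.map f).Holds P v ↔ φ.Holds (P ∘ f) v := by
  induction φ generalizing v with
  | here i => rfl
  | neg φ ih => exact not_congr (ih v)
  | and φ ψ ih ih' => exact and_congr (ih v) (ih' v)
  | box α φ ih => exact forall_congr' fun v' => imp_congr_right fun _ => ih v'

/-- Every agent of a formula has a property. -/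
def Formula.All {A : Type} (B : A → Prop) : Formula A → Prop
  | .here i => B i
  | .neg φ => φ.All B
  | .and φ ψ => φ.All B ∧ ψ.All B
  | .box _ φ => φ.All B

theorem Formula.All.mono {A : Type} {B C : A → Prop} (h : ∀ i, B i → C i) {φ : Formula A}
    (hφ : φ.All B) : φ.All C := by
  induction φ with
  | here i => exact h i hφ
  | neg φ ih => exact ih hφ
  | and φ ψ ih ih' => exact ⟨ih hφ.1, ih' hφ.2⟩
  | box α φ ih => exact ih hφ

theorem Formula.all_map_val {n : ℕ} (φ : Formula (Fin n)) :
    (φ.map Fin.val).All (· < n) := by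
  induction φ with
  | here i => exact i.2
  | neg φ ih => exact ih
  | and φ ψ ih ih' => exact ⟨ih, ih'⟩
  | box α φ ih => exact ih

theorem Formula.exists_map_val {n : ℕ} {φ : Formula ℕ} (h : φ.All (· < n)) :
    ∃ ψ : Formula (Fin n), ψ.map Fin.val = φ := by
  induction φ with
  | here i => exact ⟨.here ⟨i, h⟩, rfl⟩
  | neg φ ih => obtain ⟨ψ, rfl⟩ := ih h; exact ⟨.neg ψ, rfl⟩
  | and φ φ' ih ih' =>
    obtain ⟨ψ, rfl⟩ := ih h.1
    obtain ⟨ψ', rfl⟩ := ih' h.2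
    exact ⟨.and ψ ψ', rfl⟩
  | box α φ ih => obtain ⟨ψ, rfl⟩ := ih h; exact ⟨.box α ψ, rfl⟩

theorem Formula.exists_all_lt (φ : Formula ℕ) : ∃ n, φ.All (· < n) := by
  induction φ with
  | here i => exact ⟨i + 1, Nat.lt_succ_self i⟩
  | neg φ ih => exact ih
  | and φ ψ ih ih' =>
    obtain ⟨n, hn⟩ := ih
    obtain ⟨m, hm⟩ := ih'
    exact ⟨max n m, hn.mono fun i hi => hi.trans_le (le_max_left _ _),
      hm.mono fun i hi => hi.trans_le (le_max_right _ _)⟩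
  | box α φ ih => exact ih

/-- The word of a formula. -/
def Formula.word : Formula ℕ → List Symbol
  | .here i => Symbol.here :: (Nat.bits i).map Symbol.bit
  | .neg φ => Symbol.neg :: φ.word
  | .and φ ψ => Symbol.and :: (φ.word ++ ψ.word)
  | .box α φ => Symbol.box α :: φ.word

theorem Formula.encode_eq_word {n : ℕ} (φ : Formula (Fin n)) :
    φ.encode = (φ.map Fin.val).word := by
  induction φ with
  | here i => rfl
  | neg φ ih => simp [encode, map, word, ih]
  | and φ ψ ih ih' => simp [encode, map, word, ih, ih']
  | box α φ ih => simp [encode, map, word, ih]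

theorem Formula.satisfiable_iff {A : Type} (φ : Formula A) :
    φ.Satisfiable ↔ ∃ P v, φ.Holds P v := by
  simp [Satisfiable, Valid, Holds]

/-- The agents that may occur in a formula: all agents, or those below a bound. -/
def Allowed (cap : ℕ) (free : Bool) (i : ℕ) : Prop := free = true ∨ i < cap

/-- The satisfiability problem for formulas with allowed agents. -/
def satWords (cap : ℕ) (free : Bool) : Language Symbol :=
  {w | ∃ φ : Formula ℕ, φ.All (Allowed cap free) ∧ φ.word = w ∧ ∃ P v, φ.Holds P v}

theorem satProblem_eq (n : ℕ) : satProblem n = satWords n false := by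
  ext w
  constructor
  · rintro ⟨φ, hφ, rfl⟩
    obtain ⟨P, v, h⟩ := φ.satisfiable_iff.1 hφ
    refine ⟨φ.map Fin.val, φ.all_map_val.mono fun i hi => Or.inr hi, φ.encode_eq_word.symm,
      -- Numbers from n on do not occur in the formula, so their position is arbitrary.
      fun i => if h : i < n then P ⟨i, h⟩ else 0, v, ?_⟩
    rw [Formula.holds_map]
    convert h using 1
    funext i
    simp
  · rintro ⟨φ, hφ, rfl, P, v, h⟩
    obtain ⟨ψ, rfl⟩ := Formula.exists_map_val (n := n) (hφ.mono fun i hi => by simpa [Allowed] using hi)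
    exact ⟨ψ, ψ.satisfiable_iff.2 ⟨_, v, (ψ.holds_map _ P v).1 h⟩, ψ.encode_eq_word⟩

theorem satProblemUniform_eq : satProblemUniform = satWords 0 true := by
  ext w
  constructor
  · rintro ⟨n, φ, hφ, rfl⟩
    obtain ⟨P, v, h⟩ := φ.satisfiable_iff.1 hφ
    refine ⟨φ.map Fin.val, φ.all_map_val.mono fun i hi => Or.inl rfl, φ.encode_eq_word.symm,
      fun i => if h : i < n then P ⟨i, h⟩ else 0, v, ?_⟩
    rw [Formula.holds_map]
    convert h using 1
    funext i
    simp
  · rintro ⟨φ, hφ, rfl, P, v, h⟩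
    obtain ⟨n, hn⟩ := φ.exists_all_lt
    obtain ⟨ψ, rfl⟩ := Formula.exists_map_val hn
    exact ⟨n, ψ, ψ.satisfiable_iff.2 ⟨_, v, (ψ.holds_map _ P v).1 h⟩, ψ.encode_eq_word⟩

/-! ### The letters of the certificate -/

/-- A letter: a symbol of the formula (or the end of a block) at a point of a finite grid, with the
truth value of the subformula that starts there and further annotations. -/
structure Letter where
  hdr : Bool
  sym : Option Symbol
  bit : Bool
  child : Bool
  seen : Bool
  par : Bool
  right : Bool
  left : Bool
  top : Bool
  bottom : Bool

instance : Finite Direction :=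
  Finite.of_surjective (fun x : Fin 4 => ![Direction.up, .down, .right, .left] x) fun d => by
    cases d
    exacts [⟨0, rfl⟩, ⟨1, rfl⟩, ⟨2, rfl⟩, ⟨3, rfl⟩]

instance : Finite Program :=
  Finite.of_surjective (Sum.elim Program.move Program.iter) fun α => by
    cases α with
    | move d => exact ⟨.inl d, rfl⟩
    | iter d => exact ⟨.inr d, rfl⟩

instance : Finite Symbol :=
  Finite.of_surjective
    (Sum.elim (fun x : Fin 3 => ![Symbol.here, .neg, .and] x) (Sum.elim Symbol.bit Symbol.box))
    fun s => by
      cases s with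
      | here => exact ⟨.inl 0, rfl⟩
      | neg => exact ⟨.inl 1, rfl⟩
      | and => exact ⟨.inl 2, rfl⟩
      | bit b => exact ⟨.inr (.inl b), rfl⟩
      | box α => exact ⟨.inr (.inr α), rfl⟩

instance : Finite Letter :=
  Finite.of_injective (fun x : Letter =>
    (x.hdr, x.sym, x.bit, x.child, x.seen, x.par, x.right, x.left, x.top, x.bottom)) <| by
  rintro ⟨⟩ ⟨⟩ h
  simpa using h

/-- A numbering of the letters. -/
noncomputable def Letter.number : Letter ≃ ZMod (Nat.card Letter) :=
  have : NeZero (Nat.card Letter) := ⟨by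
    have : Nonempty Letter :=
      ⟨⟨true, none, true, true, true, true, true, true, true, true⟩⟩
    exact Nat.card_pos.ne'⟩
  letI := Fintype.ofFinite Letter
  Fintype.equivOfCardEq (by rw [ZMod.card, Nat.card_eq_fintype_card])

/-- The next letter in a cyclic order of all letters. -/
noncomputable def Letter.next (a : Letter) : Letter := number.symm (number a + 1)

/-- Adding one in `ZMod` is a single cycle through all residues. This makes a unary code of bounded
length available for every letter. -/
theorem Letter.exists_iterate_next (a b : Letter) : ∃ m < Nat.card Letter, next^[m] a = b := by
  have : NeZero (Nat.card Letter) := ⟨(@Nat.card_pos _ ⟨a⟩ _).ne'⟩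
  have h (m : ℕ) : number (next^[m] a) = number a + m := by
    induction m with
    | zero => simp
    | succ m ih =>
      rw [Function.iterate_succ_apply', next, Equiv.apply_symm_apply, ih, Nat.cast_succ, add_assoc]
  refine ⟨(number b - number a).val, ZMod.val_lt _, number.injective ?_⟩
  rw [h, ZMod.natCast_zmod_val, add_sub_cancel]

/-- The letter of a symbol of the instance. -/
def headerLetter (s : Option Symbol) : Letter where
  hdr := true
  sym := s
  bit := false
  child := false
  seen := false
  par := false
  -- Block 0 counts as the right end of a row: `RelH` then marks the first cell as a left border and
  -- asks for no adjacency with it, and `RelV` carries the mark from block 0 to the end of the first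
  -- row.
  right := true
  left := false
  top := false
  bottom := false

/-- The condition on two letters that belong to the same symbol at neighbouring points, the second
point being reached from the first in the direction `d`, and the first from the second in the
direction `d'`; `edge` tells whether one of the points is on the border of the grid. -/
def Adjacent (d d' : Direction) (edge : Prop) (a b : Letter) : Prop :=
  (a.sym = some (.box (.move d)) → a.bit = b.child) ∧
  (a.sym = some (.box (.move d')) → b.bit = a.child) ∧
  (a.sym = some (.box (.iter d)) → a.bit = (a.child && b.bit)) ∧
  (a.sym = some (.box (.iter d')) → b.bit = (b.child && a.bit)) ∧
  -- The two outermost rows or columns must agree; this is what allows the constant extension of the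
  -- table beyond the grid.
  (edge → a.bit = b.bit ∧ a.child = b.child)

/-- The condition on letters at the distance of one block. -/
def RelH (a b : Letter) : Prop :=
  a.sym = b.sym ∧ b.par = !a.par ∧
  -- Since `seen` accumulates the bits of earlier blocks, the second clause excludes a second true
  -- bit.
  (a.sym = some .here → b.seen = (a.seen || a.bit) ∧ (b.seen && b.bit) = false) ∧
  (a.right = true → b.left = true) ∧ (a.hdr = true → b.bottom = true) ∧
  (a.right = false → a.top = b.top ∧ a.bottom = b.bottom ∧
    Adjacent .right .left (a.left = true ∨ b.right = true) a b)

/-- The condition on letters at the distance of one row. -/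
def RelV (a b : Letter) : Prop :=
  a.right = b.right ∧ (a.hdr = false → Adjacent .up .down (a.bottom = true ∨ b.top = true) a b)

/-- The condition on a letter at the border of the grid. -/
def Letter.Border (a : Letter) : Prop :=
  (a.right = true ∨ a.left = true ∨ a.top = true ∨ a.bottom = true →
    a.sym = some .here → a.bit = false) ∧
  (a.right = true → a.sym = some (.box (.iter .right)) → a.bit = a.child) ∧
  (a.left = true → a.sym = some (.box (.iter .left)) → a.bit = a.child) ∧
  (a.top = true → a.sym = some (.box (.iter .up)) → a.bit = a.child) ∧
  (a.bottom = true → a.sym = some (.box (.iter .down)) → a.bit = a.child) ∧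
  -- The top right corner is the last cell and its own bit is false, so `seen` there forces a true
  -- bit in some earlier cell.
  (a.right = true → a.top = true → a.sym = some .here → a.seen = true) ∧
  -- Excludes grids with a single column or a single row.
  (a.left = true → a.right = false) ∧ (a.bottom = true → a.top = false)

/-! ### The pushdown pass -/

section

variable (cap : ℕ) (free : Bool)

/-- The state of the pushdown pass. -/
structure Reader where
  start : Bool
  pend : Option (Fin (cap + 1))
  right : Bool
  top : Bool
  ok : Bool
  sat : Bool

instance : Finite (Reader cap) :=
  Finite.of_injective (fun x : Reader cap => (x.start, x.pend, x.right, x.top, x.ok, x.sat)) <| by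
  rintro ⟨⟩ ⟨⟩ h
  simpa using h

/-- Truncation of a number. -/
def clip (i : ℕ) : Fin (cap + 1) := ⟨min i cap, by omega⟩

variable {cap}

/-- The truncated number given by the digits read last. -/
def Reader.value (q : Reader cap) : ℕ := q.pend.elim 0 Fin.val

/-- The number given by the digits read last, after reading another symbol. -/
def Reader.nextPend (q : Reader cap) : Symbol → Option (Fin (cap + 1))
  | .bit d => some (clip cap (2 * q.value + d.toNat))
  | _ => none

/-- The condition for the end of a block. -/
def Reader.FinishOk (q : Reader cap) (t t' : Option Bool) : Prop :=
  q.start = false ∧ q.pend = none ∧ t ≠ none ∧ t' = none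

/-- The condition for reading a symbol of the formula. -/
def Reader.SymbolOk (q : Reader cap) (a : Letter) (t t' : Option Bool) : Symbol → Prop
  -- From the right, the most significant digit comes first: it must not be zero.
  | .bit d => q.pend = none → d = true
  | .here => Allowed cap free q.value
  | .neg => q.pend = none ∧ t = some (!a.bit)
  | .and => q.pend = none ∧ ∃ x y, t = some x ∧ t' = some y ∧ a.bit = (x && y)
  | .box _ => q.pend = none ∧ t = some a.child

open Classical in
/-- A step of the pushdown pass. -/
noncomputable def Reader.step (q : Reader cap) (a : Letter) (t t' : Option Bool) : Reader cap :=
  match a.hdr, a.sym with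
  | true, some _ => q
  | true, none =>
    { q with ok := decide (q.ok = true ∧ q.FinishOk t t'), sat := decide (q.sat = true ∨ t = some true) }
  | false, none =>
    { start := false
      pend := none
      right := a.right
      top := a.top
      ok := decide (q.ok = true ∧ a.Border ∧
        -- The first letter read has to end the block of the top right corner; every later end
        -- letter judges the block to its right.
        if q.start = true then a.right = true ∧ a.top = true else q.FinishOk t t')
      sat := decide (q.sat = true ∨ t = some true) }
  | false, some s =>
    { q with
      pend := q.nextPend s
      ok := decide (q.ok = true ∧ a.Border ∧ q.start = false ∧ a.right = q.right ∧
        a.top = q.top ∧ q.SymbolOk free a t t' s) }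

/-- The number of truth values used by a letter. -/
def Letter.pops (a : Letter) : Fin 3 :=
  match a.hdr, a.sym with
  | true, some _ => 0
  -- Two pops show whether exactly one value is left.
  | _, none => 2
  | false, some (.bit _) => 0
  | false, some .here => 0
  | false, some .neg => 1
  | false, some .and => 2
  | false, some (.box _) => 1

/-- The truth value produced by a letter. -/
def Letter.pushed (a : Letter) : Option Bool :=
  match a.hdr, a.sym with
  | true, _ => none
  | _, none => none
  | false, some (.bit _) => none
  | false, some _ => some a.bit

/-! ### The passes over pairs of letters -/

/-- The state of a pass over pairs of letters. -/
structure Scanner where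
  same : Bool
  okA : Bool
  okH : Bool
  okV : Bool
  last : Option Letter

instance : Finite Scanner :=
  Finite.of_injective (fun x : Scanner => (x.same, x.okA, x.okH, x.okV, x.last)) <| by
  rintro ⟨⟩ ⟨⟩ h
  simpa using h

/-- Agreement of two sequences of digits, by the agreement of their tails. -/
def sameDigits (r : Bool) : Option Symbol → Option Symbol → Bool
  | some (.bit d), some (.bit d') => d == d' && r
  | some (.bit _), _ => false
  | _, some (.bit _) => false
  | _, _ => true

open Classical in
/-- A step of a pass over pairs of letters. -/
noncomputable def Scanner.step (r : Scanner) (a b : Letter) : Scanner where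
  same := sameDigits r.same a.sym b.sym
  okA := decide (r.okA = true ∧ (a.sym = some .here → b.sym = some .here → a.par = b.par →
    r.same = true → a.bit = b.bit))
  okH := decide (r.okH = true ∧ RelH a b)
  okV := decide (r.okV = true ∧ RelV a b)
  last := some b

/-- The condition at the end of the pass with shift `D`, where `last` is the letter at `D` and `t`
the letter before it: which relation has to hold depends on these two letters. -/
def Scanner.Ok (r : Scanner) (t : Option Letter) : Prop :=
  -- A letter of block 0 at position D: the shift is shorter than a block, and occurrences of one
  -- agent are compared.
  (∀ b ∈ r.last, b.hdr = true → r.okA = true) ∧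
  -- The delimiter just before position D: the shift is exactly one block.
  (∀ c ∈ t, c.sym = none → c.hdr = true → r.okH = true) ∧
  -- At D there begins a block marked as bottom right corner: in an honest certificate the shift is
  -- exactly one row.
  (∀ c ∈ t, ∀ b ∈ r.last, c.sym = none → b.hdr = false → b.right = true → b.bottom = true →
    r.okV = true)

variable (cap)

open Classical in
/-- The verifier for the satisfiability problem. -/
noncomputable def satVerifier : ShiftVerifier Symbol where
  Letter := Letter
  Q := Reader cap
  R := Scanner
  finLetter := Fintype.ofFinite _
  finQ := Fintype.ofFinite _
  finR := Fintype.ofFinite _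
  header s := headerLetter (some s)
  delim := headerLetter none
  code₀ := headerLetter none
  next := Letter.next
  -- No certificate can forge a letter of block 0.
  body a := { a with hdr := false }
  q₀ := ⟨true, none, true, true, true, false⟩
  pops := Letter.pops
  pdaStep := Reader.step free
  pushed := Letter.pushed
  pdaOk q := q.ok && q.sat
  r₀ := ⟨true, true, true, true, none⟩
  scanStep := Scanner.step
  scanOk r t := decide (r.Ok t)

end

theorem exists_decode_satVerifier (cap : ℕ) (free : Bool) (l : List Letter)
    (hl : ∀ a ∈ l, a.hdr = false) :
    ∃ c : List Bool, c.length ≤ Nat.card Letter * l.length ∧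
      (satVerifier cap free).decode (headerLetter none) c = l := by
  induction l with
  | nil => exact ⟨[], by simp, rfl⟩
  | cons a l ih =>
    obtain ⟨c, hc, hcl⟩ := ih fun b hb => hl b (List.mem_cons_of_mem _ hb)
    obtain ⟨m, hm, hma⟩ := Letter.exists_iterate_next (headerLetter none) a
    refine ⟨List.replicate m true ++ false :: c, ?_, ?_⟩
    · simp only [List.length_append, List.length_replicate, List.length_cons]
      rw [Nat.mul_succ]
      omega
    · have key (x : Letter) : (satVerifier cap free).decode x (List.replicate m true ++ false :: c) =
          { Letter.next^[m] x with hdr := false } :: l := by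
        clear hm hma
        induction m generalizing x with
        | zero =>
          rw [← hcl]
          rfl
        | succ m ihm => exact ihm (Letter.next x)
      rw [key, hma, ← hl a List.mem_cons_self]

/-! ### Folding over an interval -/

/-- The fold of `f` over the numbers `k, …, m - 1`, from right to left. -/
def foldFrom {R : Type} (f : ℕ → R → R) (r : R) (m k : ℕ) : R := (List.range' k (m - k)).foldr f r

theorem foldFrom_self {R : Type} (f : ℕ → R → R) (r : R) (m : ℕ) : foldFrom f r m m = r := by
  simp [foldFrom]

theorem foldFrom_step {R : Type} (f : ℕ → R → R) (r : R) {m k : ℕ} (h : k < m) :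
    foldFrom f r m k = f k (foldFrom f r m (k + 1)) := by
  unfold foldFrom
  obtain ⟨n, hn⟩ : ∃ n, m - k = n + 1 := ⟨m - k - 1, by omega⟩
  rw [hn, List.range'_succ, List.foldr_cons, show m - (k + 1) = n by omega]

theorem foldFrom_zero {R : Type} (f : ℕ → R → R) (r : R) (m : ℕ) :
    foldFrom f r m 0 = (List.range m).foldr f r := by
  simp [foldFrom, List.range_eq_range']

namespace ShiftVerifier

variable {Γ : Type} (S : ShiftVerifier Γ)

/-- Translation to positions counted from the left: in the reversed word, dropping D letters and
zipping pairs position k with k + D, and the first letter left unpaired is the one at D - 1. -/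
theorem accepts_reverse_iff (g : ℕ → S.Letter) (n : ℕ) :
    S.accepts ((List.range n).map g).reverse = true ↔
      S.pdaOk (foldFrom (fun k x => S.pda x (g k)) (S.q₀, []) n 0).1 = true ∧
      ∀ D ≤ n, S.scanOk (foldFrom (fun k r => S.scanStep r (g k) (g (k + D))) S.r₀ (n - D) 0)
        (if D = 0 then none else some (g (D - 1))) = true := by
  have h (D : ℕ) (hD : D ≤ n) : S.shiftOk ((List.range n).map g).reverse D =
      S.scanOk (foldFrom (fun k r => S.scanStep r (g k) (g (k + D))) S.r₀ (n - D) 0)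
        (if D = 0 then none else some (g (D - 1))) := by
    unfold shiftOk
    congr 1
    · rw [foldFrom_zero]
      have e : ((((List.range n).map g).reverse.drop D).zip ((List.range n).map g).reverse) =
          ((List.range (n - D)).map fun k => (g k, g (k + D))).reverse := by
        apply List.ext_getElem
        · simp
        · intro i h1 h2
          simp only [List.length_zip, List.length_drop, List.length_reverse, List.length_map,
            List.length_range] at h1
          simp only [List.getElem_zip, List.getElem_drop, List.getElem_reverse, List.getElem_map,
            List.getElem_range, List.length_map, List.length_range]
          congr 2 <;> omega
      rw [e, List.foldl_reverse, List.foldr_map]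
      rfl
    · rcases Nat.eq_zero_or_pos D with rfl | hD'
      · simp
      · rw [if_neg (by omega), List.head?_drop, List.getElem?_reverse (by simp; omega)]
        simp only [List.length_reverse, List.length_map, List.length_range, List.getElem?_map]
        rw [List.getElem?_range (by omega)]
        simp only [Option.map_some]
        congr 2
        omega
  unfold accepts
  rw [Bool.and_eq_true, List.foldl_reverse, foldFrom_zero, List.foldr_map, List.all_eq_true]
  simp only [List.mem_range, List.length_reverse, List.length_map, List.length_range,
    Nat.lt_succ_iff]
  exact and_congr Iff.rfl (forall_congr' fun D => forall_congr' fun hD => by rw [h D hD])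

end ShiftVerifier

/-! ### The pushdown pass on a formula -/

/-- The symbols at the positions from `j` on begin with a given word. -/
def Spells (σ : ℕ → Option Symbol) : ℕ → List Symbol → Prop
  | _, [] => True
  | j, s :: l => σ j = some s ∧ Spells σ (j + 1) l

theorem spells_append {σ : ℕ → Option Symbol} {j : ℕ} {l l' : List Symbol} :
    Spells σ j (l ++ l') ↔ Spells σ j l ∧ Spells σ (j + l.length) l' := by
  induction l generalizing j with
  | nil => simp [Spells]
  | cons s l ih =>
    simp only [List.cons_append, Spells, ih, List.length_cons, and_assoc]
    rw [show j + 1 + l.length = j + (l.length + 1) by omega]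

theorem spells_iff {σ : ℕ → Option Symbol} {j : ℕ} {l : List Symbol} :
    Spells σ j l ↔ ∀ t (h : t < l.length), σ (j + t) = some l[t] := by
  induction l generalizing j with
  | nil => simp [Spells]
  | cons s l ih =>
    simp only [Spells, ih]
    constructor
    · rintro ⟨h, h'⟩ t ht
      cases t with
      | zero => exact h
      | succ t => simpa [add_assoc, add_comm 1] using h' t (by simpa using ht)
    · intro h
      refine ⟨h 0 (by simp), fun t ht => ?_⟩
      rw [show j + 1 + t = j + (t + 1) by omega]
      exact h (t + 1) (by simpa using ht)

theorem Formula.word_length_pos (φ : Formula ℕ) : 0 < φ.word.length := by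
  cases φ <;> simp [word]

/-- The truth values given by the letters from `j` on obey the Boolean clauses for a formula. -/
def Annotated (g : ℕ → Letter) : Formula ℕ → ℕ → Prop
  | .here _, _ => True
  | .neg φ, j => (g j).bit = !(g (j + 1)).bit ∧ Annotated g φ (j + 1)
  | .and φ ψ, j => (g j).bit = ((g (j + 1)).bit && (g (j + 1 + φ.word.length)).bit) ∧
      Annotated g φ (j + 1) ∧ Annotated g ψ (j + 1 + φ.word.length)
  | .box _ φ, j => (g j).child = (g (j + 1)).bit ∧ Annotated g φ (j + 1)

variable {cap : ℕ} {free : Bool}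

theorem clip_val (i : ℕ) : (clip cap i : ℕ) = min i cap := rfl

/-- Truncation commutes with appending a binary digit, since doubling a number that is at least
`cap` keeps it so. Finitely many states therefore suffice to read an index. -/
theorem clip_double (i : ℕ) (d : Bool) : clip cap (2 * (clip cap i : ℕ) + d.toNat) =
    clip cap (2 * i + d.toNat) := by
  apply Fin.ext
  simp only [clip_val]
  omega

theorem allowed_clip (i : ℕ) : Allowed cap free (clip cap i) ↔ Allowed cap free i := by
  simp only [Allowed, clip_val]
  exact or_congr_right (by omega)

variable (free) in
/-- A step of the pushdown pass, with its stack. -/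
noncomputable def Reader.pda (x : Reader cap × List Bool) (a : Letter) : Reader cap × List Bool :=
  (satVerifier cap free).pda x a

section steps

variable {x : Reader cap × List Bool} {a : Letter}

theorem Reader.pda_header {s : Symbol} (h : a.hdr = true) (hs : a.sym = some s) :
    Reader.pda free x a = x := by
  simp [pda, ShiftVerifier.pda, satVerifier, Letter.pops, h, hs, ShiftVerifier.pushOnto,
    Letter.pushed, Reader.step]

theorem Reader.pda_end (hs : a.sym = none) :
    Reader.pda free x a = (x.1.step free a x.2.head? x.2.tail.head?, x.2.tail.tail) := by
  cases h : a.hdr <;>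
  simp [pda, ShiftVerifier.pda, satVerifier, Letter.pops, h, hs, ShiftVerifier.pushOnto,
    Letter.pushed]

theorem Reader.pda_bit {d : Bool} (h : a.hdr = false) (hs : a.sym = some (.bit d)) :
    Reader.pda free x a = (x.1.step free a none none, x.2) := by
  simp [pda, ShiftVerifier.pda, satVerifier, Letter.pops, h, hs, ShiftVerifier.pushOnto,
    Letter.pushed]

theorem Reader.pda_here (h : a.hdr = false) (hs : a.sym = some .here) :
    Reader.pda free x a = (x.1.step free a none none, a.bit :: x.2) := by
  simp [pda, ShiftVerifier.pda, satVerifier, Letter.pops, h, hs, ShiftVerifier.pushOnto,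
    Letter.pushed]

theorem Reader.pda_neg (h : a.hdr = false) (hs : a.sym = some .neg) :
    Reader.pda free x a = (x.1.step free a x.2.head? none, a.bit :: x.2.tail) := by
  simp [pda, ShiftVerifier.pda, satVerifier, Letter.pops, h, hs, ShiftVerifier.pushOnto,
    Letter.pushed]

theorem Reader.pda_and (h : a.hdr = false) (hs : a.sym = some .and) :
    Reader.pda free x a =
      (x.1.step free a x.2.head? x.2.tail.head?, a.bit :: x.2.tail.tail) := by
  simp [pda, ShiftVerifier.pda, satVerifier, Letter.pops, h, hs, ShiftVerifier.pushOnto,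
    Letter.pushed]

theorem Reader.pda_box {α : Program} (h : a.hdr = false) (hs : a.sym = some (.box α)) :
    Reader.pda free x a = (x.1.step free a x.2.head? none, a.bit :: x.2.tail) := by
  simp [pda, ShiftVerifier.pda, satVerifier, Letter.pops, h, hs, ShiftVerifier.pushOnto,
    Letter.pushed]

theorem Reader.step_symbol {q : Reader cap} {s : Symbol} (h : a.hdr = false)
    (hs : a.sym = some s) (t t' : Option Bool) :
    q.step free a t t' = { q with pend := q.nextPend s, ok := (q.step free a t t').ok } ∧
    ((q.step free a t t').ok = true ↔ q.ok = true ∧ a.Border ∧ q.start = false ∧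
      a.right = q.right ∧ a.top = q.top ∧ q.SymbolOk free a t t' s) := by
  simp [step, h, hs]

/-- The flag `ok` is never regained, so acceptance at the end gives it at every position. -/
theorem Reader.pda_ok (h : (Reader.pda free x a).1.ok = true) : x.1.ok = true := by
  rw [Reader.pda] at h
  unfold ShiftVerifier.pda at h
  have key : ∀ t t', (x.1.step free a t t').ok = true → x.1.ok = true := by
    intro t t' h
    unfold step at h
    split at h
    · exact h
    · exact (by simp only [decide_eq_true_eq] at h; exact h.1)
    · exact (by simp only [decide_eq_true_eq] at h; exact h.1)
    · exact (by simp only [decide_eq_true_eq] at h; exact h.1)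
  split at h <;> exact key _ _ h

end steps

/-! ### Reading the word of a formula from right to left -/

section word

variable {F : ℕ → Reader cap × List Bool} {g : ℕ → Letter}

/-- The conditions on the single letters in an interval, inside a block. -/
def BlockOk (g : ℕ → Letter) (q : Reader cap) (j e : ℕ) : Prop :=
  ∀ k, j ≤ k → k < e → (g k).Border ∧ (g k).right = q.right ∧ (g k).top = q.top

theorem blockOk_succ {q : Reader cap} {j e : ℕ} (h : j < e) : BlockOk g q j e ↔
    ((g j).Border ∧ (g j).right = q.right ∧ (g j).top = q.top) ∧ BlockOk g q (j + 1) e := by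
  constructor
  · exact fun h' => ⟨h' j le_rfl h, fun k hk hk' => h' k (by omega) hk'⟩
  · rintro ⟨h1, h2⟩ k hk hk'
    rcases hk.eq_or_lt with rfl | hk
    exacts [h1, h2 k hk hk']

theorem blockOk_append {q : Reader cap} {j m e : ℕ} (h : j ≤ m) (h' : m ≤ e) : BlockOk g q j e ↔
    BlockOk g q j m ∧ BlockOk g q m e := by
  constructor
  · exact fun H => ⟨fun k hk hk' => H k hk (by omega), fun k hk hk' => H k (by omega) hk'⟩
  · rintro ⟨h1, h2⟩ k hk hk'
    rcases lt_or_ge k m with hm | hm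
    exacts [h1 k hk hm, h2 k hm hk']

/-- Induction on the binary expansion: the digits are written with the least significant first, so
the reader has the higher part m when it meets d and passes to 2m + d. The index 0 has no digits,
whence `pend = none`. -/
theorem reads_digits (i j e : ℕ) (he : e = j + (Nat.bits i).length)
    (hF : ∀ k, j ≤ k → k < e → F k = Reader.pda free (F (k + 1)) (g k))
    (hs : Spells (fun k => (g k).sym) j ((Nat.bits i).map Symbol.bit))
    (hh : ∀ k, j ≤ k → k < e → (g k).hdr = false)
    (hst : (F e).1.start = false) (hp : (F e).1.pend = none) :
    (F j).1 = { (F e).1 with ok := (F j).1.ok, pend := if i = 0 then none else some (clip cap i) } ∧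
    (F j).2 = (F e).2 ∧
    ((F j).1.ok = true ↔ (F e).1.ok = true ∧ BlockOk g (F e).1 j e) := by
  induction i using Nat.binaryRec' generalizing j with
  | zero =>
    obtain rfl : e = j := by simpa using he
    refine ⟨?_, rfl, ?_⟩
    · rw [if_pos rfl, ← hp]
    · exact (and_iff_left fun k hk hk' => by omega).symm
  | bit d m hd ih =>
    rw [Nat.bits_append_bit m d hd] at hs he
    simp only [List.map_cons, Spells] at hs
    simp only [List.length_cons] at he
    obtain ⟨h1, h2, h3⟩ := ih (j + 1) (by omega) (fun k hk => hF k (by omega)) hs.2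
      (fun k hk => hh k (by omega))
    have hj : j < e := by omega
    have hFj := hF j le_rfl hj
    rw [Reader.pda_bit (hh j le_rfl hj) hs.1] at hFj
    obtain ⟨h4, h5⟩ := Reader.step_symbol (q := (F (j + 1)).1) (free := free)
      (hh j le_rfl hj) hs.1 none none
    have hFj1 : (F j).1 = (F (j + 1)).1.step free (g j) none none := by rw [hFj]
    have hbit : Nat.bit d m ≠ 0 := by
      intro h0
      rw [Nat.bit_eq_zero_iff] at h0
      simp [hd h0.1] at h0
    have hval : (F (j + 1)).1.value = (clip cap m : ℕ) := by
      rw [Reader.value, h1]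
      by_cases hm : m = 0
      · subst hm; simp [clip_val]
      · simp [hm]
    have hq : (F (j + 1)).1.right = (F e).1.right ∧ (F (j + 1)).1.top = (F e).1.top ∧
        (F (j + 1)).1.start = false := by
      rw [h1]
      exact ⟨rfl, rfl, hst⟩
    refine ⟨?_, ?_, ?_⟩
    · rw [hFj1, h4, if_neg hbit, h1]
      simp only [Reader.nextPend]
      rw [← h1, hval, clip_double, Nat.bit_val]
    · rw [hFj, h2]
    · rw [hFj1, h5, h3, blockOk_succ hj, hq.1, hq.2.1, hq.2.2]
      have : (F (j + 1)).1.SymbolOk free (g j) none none (.bit d) := by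
        intro hpe
        by_contra hd'
        have hm : m ≠ 0 := fun hm => hd' (hd hm)
        rw [h1, if_neg hm] at hpe
        simp at hpe
      tauto

/-- The invariant of backward evaluation of prefix notation: a formula leaves exactly one new value,
the bit at its first letter, on an otherwise unchanged stack. The flag survives exactly if the
letters fit the block, the Boolean clauses hold and all agents are allowed. -/
theorem reads_word (φ : Formula ℕ) (j e : ℕ) (he : e = j + φ.word.length)
    (hF : ∀ k, j ≤ k → k < e → F k = Reader.pda free (F (k + 1)) (g k))
    (hs : Spells (fun k => (g k).sym) j φ.word)
    (hh : ∀ k, j ≤ k → k < e → (g k).hdr = false)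
    (hst : (F e).1.start = false) (hp : (F e).1.pend = none) :
    (F j).1 = { (F e).1 with ok := (F j).1.ok } ∧ (F j).2 = (g j).bit :: (F e).2 ∧
    ((F j).1.ok = true ↔ (F e).1.ok = true ∧ BlockOk g (F e).1 j e ∧ Annotated g φ j ∧
      φ.All (Allowed cap free)) := by
  have hj : j < e := by have := φ.word_length_pos; omega
  induction φ generalizing j e with
  | here i =>
    simp only [Formula.word, Spells, List.length_cons, List.length_map] at hs he
    obtain ⟨h1, h2, h3⟩ := reads_digits i (j + 1) e (by omega) (fun k hk => hF k (by omega)) hs.2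
      (fun k hk => hh k (by omega)) hst hp
    have hFj := hF j le_rfl hj
    rw [Reader.pda_here (hh j le_rfl hj) hs.1] at hFj
    obtain ⟨h4, h5⟩ := Reader.step_symbol (q := (F (j + 1)).1) (free := free)
      (hh j le_rfl hj) hs.1 none none
    have hFj1 : (F j).1 = (F (j + 1)).1.step free (g j) none none := by rw [hFj]
    have hval : (F (j + 1)).1.value = (clip cap i : ℕ) := by
      rw [Reader.value, h1]
      by_cases hm : i = 0
      · subst hm; simp [clip_val]
      · simp [hm]
    have hq : (F (j + 1)).1.right = (F e).1.right ∧ (F (j + 1)).1.top = (F e).1.top ∧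
        (F (j + 1)).1.start = false := by
      rw [h1]
      exact ⟨rfl, rfl, hst⟩
    refine ⟨?_, ?_, ?_⟩
    · rw [hFj1, h4, h1]
      simp only [Reader.nextPend, hp]
    · rw [hFj, h2]
    · rw [hFj1, h5, h3, blockOk_succ hj, hq.1, hq.2.1, hq.2.2]
      simp only [Reader.SymbolOk, hval, allowed_clip, Annotated, Formula.All]
      tauto
  | neg φ ih =>
    simp only [Formula.word, Spells, List.length_cons] at hs he
    obtain ⟨h1, h2, h3⟩ := ih (j + 1) e (by omega) (fun k hk => hF k (by omega)) hs.2
      (fun k hk => hh k (by omega)) hst hp (by have := φ.word_length_pos; omega)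
    have hFj := hF j le_rfl hj
    rw [Reader.pda_neg (hh j le_rfl hj) hs.1, h2, List.head?_cons, List.tail_cons] at hFj
    obtain ⟨h4, h5⟩ := Reader.step_symbol (q := (F (j + 1)).1) (free := free)
      (hh j le_rfl hj) hs.1 (some (g (j + 1)).bit) none
    have hFj1 : (F j).1 = (F (j + 1)).1.step free (g j) (some (g (j + 1)).bit) none := by rw [hFj]
    have hq : (F (j + 1)).1.right = (F e).1.right ∧ (F (j + 1)).1.top = (F e).1.top ∧
        (F (j + 1)).1.start = false ∧ (F (j + 1)).1.pend = none := by
      rw [h1]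
      exact ⟨rfl, rfl, hst, hp⟩
    refine ⟨?_, ?_, ?_⟩
    · rw [hFj1, h4, h1]
      simp only [Reader.nextPend, hp]
    · rw [hFj]
    · rw [hFj1, h5, h3, blockOk_succ hj, hq.1, hq.2.1, hq.2.2.1]
      simp only [Reader.SymbolOk, hq.2.2.2, Annotated, Formula.All, Option.some.injEq]
      have : (g (j + 1)).bit = !(g j).bit ↔ (g j).bit = !(g (j + 1)).bit := by
        cases (g (j + 1)).bit <;> cases (g j).bit <;> simp
      tauto
  | and φ ψ ih ih' =>
    simp only [Formula.word, Spells, List.length_cons, List.length_append] at hs he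
    obtain ⟨hs0, hs⟩ := hs
    rw [spells_append] at hs
    have hφ := φ.word_length_pos
    have hψ := ψ.word_length_pos
    set m := j + 1 + φ.word.length with hm
    -- The second conjunct is read first, so its value lies below that of the first one.
    obtain ⟨a1, a2, a3⟩ := ih' m e (by omega) (fun k hk => hF k (by omega)) hs.2
      (fun k hk => hh k (by omega)) hst hp (by omega)
    have hqm : (F m).1.right = (F e).1.right ∧ (F m).1.top = (F e).1.top ∧
        (F m).1.start = false ∧ (F m).1.pend = none := by
      rw [a1]
      exact ⟨rfl, rfl, hst, hp⟩
    obtain ⟨h1, h2, h3⟩ := ih (j + 1) m (by omega) (fun k hk hk' => hF k (by omega) (by omega)) hs.1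
      (fun k hk hk' => hh k (by omega) (by omega)) hqm.2.2.1 hqm.2.2.2 (by omega)
    have hFj := hF j le_rfl hj
    rw [Reader.pda_and (hh j le_rfl hj) hs0, h2, a2, List.head?_cons, List.tail_cons,
      List.head?_cons, List.tail_cons] at hFj
    obtain ⟨h4, h5⟩ := Reader.step_symbol (q := (F (j + 1)).1) (free := free)
      (hh j le_rfl hj) hs0 (some (g (j + 1)).bit) (some (g m).bit)
    have hFj1 : (F j).1 = (F (j + 1)).1.step free (g j) (some (g (j + 1)).bit)
      (some (g m).bit) := by rw [hFj]
    have hq : (F (j + 1)).1.right = (F e).1.right ∧ (F (j + 1)).1.top = (F e).1.top ∧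
        (F (j + 1)).1.start = false ∧ (F (j + 1)).1.pend = none := by
      rw [h1, a1]
      exact ⟨rfl, rfl, hst, hp⟩
    refine ⟨?_, ?_, ?_⟩
    · rw [hFj1, h4, h1, a1]
      simp only [Reader.nextPend, hp]
    · rw [hFj]
    · have hB : BlockOk g (F m).1 (j + 1) m ↔ BlockOk g (F e).1 (j + 1) m := by
        unfold BlockOk
        rw [hqm.1, hqm.2.1]
      rw [hFj1, h5, h3, a3, blockOk_succ hj, hq.1, hq.2.1, hq.2.2.1, hB,
        blockOk_append (show j + 1 ≤ m by omega) (show m ≤ e by omega)]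
      simp only [Reader.SymbolOk, hq.2.2.2, Annotated, Formula.All, Option.some.injEq,
        exists_and_left, exists_eq_left', ← hm]
      tauto
  | box α φ ih =>
    simp only [Formula.word, Spells, List.length_cons] at hs he
    obtain ⟨h1, h2, h3⟩ := ih (j + 1) e (by omega) (fun k hk => hF k (by omega)) hs.2
      (fun k hk => hh k (by omega)) hst hp (by have := φ.word_length_pos; omega)
    have hFj := hF j le_rfl hj
    rw [Reader.pda_box (hh j le_rfl hj) hs.1, h2, List.head?_cons, List.tail_cons] at hFj
    obtain ⟨h4, h5⟩ := Reader.step_symbol (q := (F (j + 1)).1) (free := free)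
      (hh j le_rfl hj) hs.1 (some (g (j + 1)).bit) none
    have hFj1 : (F j).1 = (F (j + 1)).1.step free (g j) (some (g (j + 1)).bit) none := by rw [hFj]
    have hq : (F (j + 1)).1.right = (F e).1.right ∧ (F (j + 1)).1.top = (F e).1.top ∧
        (F (j + 1)).1.start = false ∧ (F (j + 1)).1.pend = none := by
      rw [h1]
      exact ⟨rfl, rfl, hst, hp⟩
    refine ⟨?_, ?_, ?_⟩
    · rw [hFj1, h4, h1]
      simp only [Reader.nextPend, hp]
    · rw [hFj]
    · rw [hFj1, h5, h3, blockOk_succ hj, hq.1, hq.2.1, hq.2.2.1]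
      simp only [Reader.SymbolOk, hq.2.2.2, Annotated, Formula.All, Option.some.injEq]
      have : (g (j + 1)).bit = (g j).child ↔ (g j).child = (g (j + 1)).bit := eq_comm
      tauto

end word

/-! ### End letters, and parsing of unknown words -/

variable {cap : ℕ} {free : Bool}

theorem Reader.finishOk_iff {q : Reader cap} {E : List Bool} :
    q.FinishOk E.head? E.tail.head? ↔ q.start = false ∧ q.pend = none ∧ ∃ b, E = [b] := by
  unfold FinishOk
  rcases E with _ | ⟨b, _ | ⟨b', E⟩⟩ <;> simp

theorem Reader.pda_end_header {x : Reader cap × List Bool} {a : Letter} (h : a.hdr = true)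
    (hs : a.sym = none) :
    ((Reader.pda free x a).1.ok = true ↔ x.1.ok = true ∧ x.1.start = false ∧ x.1.pend = none ∧
      ∃ b, x.2 = [b]) ∧
    ((Reader.pda free x a).1.sat = true ↔ x.1.sat = true ∨ x.2.head? = some true) := by
  rw [Reader.pda_end hs, ← Reader.finishOk_iff]
  simp [step, h, hs]

theorem Reader.pda_end_start {x : Reader cap × List Bool} {a : Letter} (h : a.hdr = false)
    (hs : a.sym = none) (hst : x.1.start = true) :
    (Reader.pda free x a).1.ok = true ↔ x.1.ok = true ∧ a.Border ∧ a.right = true ∧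
      a.top = true := by
  rw [Reader.pda_end hs]
  simp [step, h, hs, hst]

theorem Reader.pda_end_block {x : Reader cap × List Bool} {a : Letter} (h : a.hdr = false)
    (hs : a.sym = none) (hst : x.1.start = false) :
    (Reader.pda free x a).1.ok = true ↔ x.1.ok = true ∧ a.Border ∧ x.1.pend = none ∧
      ∃ b, x.2 = [b] := by
  have := Reader.finishOk_iff (q := x.1) (E := x.2)
  rw [Reader.pda_end hs]
  rw [hst] at this
  simp only [true_and] at this
  simp only [step, h, hs, hst, decide_eq_true_eq, Bool.false_eq_true, if_false, this]

theorem Reader.pda_end_eq {x : Reader cap × List Bool} {a : Letter} (h : a.hdr = false)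
    (hs : a.sym = none) : (Reader.pda free x a).1.start = false ∧
    (Reader.pda free x a).1.pend = none ∧ (Reader.pda free x a).1.right = a.right ∧
    (Reader.pda free x a).1.top = a.top ∧
    ((Reader.pda free x a).1.sat = true ↔ x.1.sat = true ∨ x.2.head? = some true) ∧
    (Reader.pda free x a).2 = x.2.tail.tail := by
  rw [Reader.pda_end hs]
  simp [step, h, hs]

/-- Here no formula is given in advance. What has been read without failure is a possibly unfinished
index followed by as many complete formulas as there are values on the stack; each operator finds
its arguments because its pops succeeded. -/
theorem exists_parse (u : List Letter) (x : Reader cap × List Bool)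
    (hu : ∀ a ∈ u, a.hdr = false ∧ a.sym ≠ none) (hp : x.1.pend = none) (hE : x.2 = [])
    (hok : (u.foldr (fun a x => Reader.pda free x a) x).1.ok = true) :
    ∃ (l : List (Formula ℕ)) (m : ℕ),
      u.map Letter.sym = ((Nat.bits m).map Symbol.bit ++ l.flatMap Formula.word).map some ∧
      (u.foldr (fun a x => Reader.pda free x a) x).2.length = l.length ∧
      (u.foldr (fun a x => Reader.pda free x a) x).1.pend =
        if m = 0 then none else some (clip cap m) := by
  induction u with
  | nil => exact ⟨[], 0, by simp, by simp [hE], by simp [hp]⟩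
  | cons a u ih =>
    rw [List.foldr_cons] at hok ⊢
    set y := u.foldr (fun a x => Reader.pda free x a) x with hy
    obtain ⟨l, m, h1, h2, h3⟩ := ih (fun b hb => hu b (List.mem_cons_of_mem _ hb))
      (Reader.pda_ok hok)
    obtain ⟨hh, hs⟩ := hu a List.mem_cons_self
    have hval : y.1.value = (clip cap m : ℕ) := by
      rw [Reader.value, h3]
      by_cases hm : m = 0
      · subst hm; simp [clip_val]
      · simp [hm]
    have hm0 (h : y.1.pend = none) : m = 0 := by
      by_contra hm
      rw [h3, if_neg hm] at h
      simp at h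
    rw [List.map_cons, h1]
    obtain ⟨s, hs⟩ := Option.ne_none_iff_exists'.1 hs
    rw [hs]
    cases s with
    | bit d =>
      rw [Reader.pda_bit hh hs] at hok ⊢
      obtain ⟨h4, h5⟩ := Reader.step_symbol (q := y.1) (free := free) hh hs none none
      have hd : m = 0 → d = true := by
        intro hm
        refine (h5.1 hok).2.2.2.2.2 ?_
        rw [h3, if_pos hm]
      -- With no leading zeros, a non-empty run of digits never denotes 0, so `pend = none` really
      -- means that no digit is pending.
      have hbit : Nat.bit d m ≠ 0 := by
        intro h0
        rw [Nat.bit_eq_zero_iff] at h0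
        simp [hd h0.1] at h0
      refine ⟨l, Nat.bit d m, ?_, h2, ?_⟩
      · rw [Nat.bits_append_bit m d hd]
        simp
      · rw [h4, if_neg hbit]
        simp only [Reader.nextPend]
        rw [hval, clip_double, Nat.bit_val]
    | here =>
      rw [Reader.pda_here hh hs]
      refine ⟨.here m :: l, 0, ?_, by simp [h2], ?_⟩
      · simp [Formula.word]
      · rw [(Reader.step_symbol hh hs none none).1]; rfl
    | neg =>
      rw [Reader.pda_neg hh hs] at hok ⊢
      obtain ⟨h4, h5⟩ := Reader.step_symbol (q := y.1) (free := free) hh hs y.2.head? none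
      obtain ⟨hpe, ht⟩ := (h5.1 hok).2.2.2.2.2
      obtain rfl := hm0 hpe
      cases l with
      | nil => rw [List.length_nil, List.length_eq_zero_iff] at h2; simp [h2] at ht
      | cons φ l =>
        refine ⟨.neg φ :: l, 0, ?_, by simp [h2], ?_⟩
        · simp [Formula.word]
        · rw [h4]; rfl
    | and =>
      rw [Reader.pda_and hh hs] at hok ⊢
      obtain ⟨h4, h5⟩ := Reader.step_symbol (q := y.1) (free := free) hh hs y.2.head?
        y.2.tail.head?
      obtain ⟨hpe, b, b', ht, ht', -⟩ := (h5.1 hok).2.2.2.2.2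
      obtain rfl := hm0 hpe
      match l, h2 with
      | [], h2 => rw [List.length_nil, List.length_eq_zero_iff] at h2; simp [h2] at ht
      | [_], h2 =>
        obtain ⟨c, hc⟩ := List.length_eq_one_iff.1 h2
        simp [hc] at ht'
      | φ :: ψ :: l, h2 =>
        refine ⟨.and φ ψ :: l, 0, ?_, by simp [h2], ?_⟩
        · simp [Formula.word]
        · rw [h4]; rfl
    | box α =>
      rw [Reader.pda_box hh hs] at hok ⊢
      obtain ⟨h4, h5⟩ := Reader.step_symbol (q := y.1) (free := free) hh hs y.2.head? none
      obtain ⟨hpe, ht⟩ := (h5.1 hok).2.2.2.2.2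
      obtain rfl := hm0 hpe
      cases l with
      | nil => rw [List.length_nil, List.length_eq_zero_iff] at h2; simp [h2] at ht
      | cons φ l =>
        refine ⟨.box α φ :: l, 0, ?_, by simp [h2], ?_⟩
        · simp [Formula.word]
        · rw [h4]; rfl

/-! ### The passes over pairs of letters -/

/-- The initial state of a pass over pairs. -/
def Scanner.fresh : Scanner := ⟨true, true, true, true, none⟩

/-- The state of the pass with shift `D` over a word of length `n`, after reading the pairs from
position `k` on. -/
noncomputable def scans (g : ℕ → Letter) (n D k : ℕ) : Scanner :=
  foldFrom (fun k r => r.step (g k) (g (k + D))) Scanner.fresh (n - D) k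

section scans

variable {g : ℕ → Letter} {n D : ℕ}

theorem scans_step {k : ℕ} (h : k + D < n) :
    scans g n D k = (scans g n D (k + 1)).step (g k) (g (k + D)) :=
  foldFrom_step _ _ (by omega)

theorem scans_end : scans g n D (n - D) = Scanner.fresh := foldFrom_self _ _ _

theorem scans_last (h : D < n) : (scans g n D 0).last = some (g D) := by
  rw [scans_step (by omega)]
  simp [Scanner.step]

theorem scans_okH (h : D ≤ n) : (scans g n D 0).okH = true ↔
    ∀ k, k + D < n → RelH (g k) (g (k + D)) := by
  have key (m : ℕ) (hm : m ≤ n - D) : (scans g n D (n - D - m)).okH = true ↔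
      ∀ k, n - D - m ≤ k → k + D < n → RelH (g k) (g (k + D)) := by
    induction m with
    | zero =>
      rw [Nat.sub_zero, scans_end]
      exact iff_of_true rfl fun k hk hk' => by omega
    | succ m ih =>
      rw [scans_step (by omega), show n - D - (m + 1) + 1 = n - D - m by omega]
      simp only [Scanner.step, decide_eq_true_eq, ih (by omega)]
      constructor
      · rintro ⟨h1, h2⟩ k hk hk'
        rcases hk.eq_or_lt with rfl | hk
        exacts [h2, h1 k (by omega) hk']
      · exact fun h' => ⟨fun k hk hk' => h' k (by omega) hk', h' _ le_rfl (by omega)⟩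
  have := key (n - D) le_rfl
  simpa using this

theorem scans_okV (h : D ≤ n) : (scans g n D 0).okV = true ↔
    ∀ k, k + D < n → RelV (g k) (g (k + D)) := by
  have key (m : ℕ) (hm : m ≤ n - D) : (scans g n D (n - D - m)).okV = true ↔
      ∀ k, n - D - m ≤ k → k + D < n → RelV (g k) (g (k + D)) := by
    induction m with
    | zero =>
      rw [Nat.sub_zero, scans_end]
      exact iff_of_true rfl fun k hk hk' => by omega
    | succ m ih =>
      rw [scans_step (by omega), show n - D - (m + 1) + 1 = n - D - m by omega]
      simp only [Scanner.step, decide_eq_true_eq, ih (by omega)]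
      constructor
      · rintro ⟨h1, h2⟩ k hk hk'
        rcases hk.eq_or_lt with rfl | hk
        exacts [h2, h1 k (by omega) hk']
      · exact fun h' => ⟨fun k hk hk' => h' k (by omega) hk', h' _ le_rfl (by omega)⟩
  have := key (n - D) le_rfl
  simpa using this

theorem scans_okA (h : D ≤ n) : (scans g n D 0).okA = true ↔
    ∀ k, k + D < n → (g k).sym = some .here → (g (k + D)).sym = some .here →
      (g k).par = (g (k + D)).par → (scans g n D (k + 1)).same = true →
      (g k).bit = (g (k + D)).bit := by
  have key (m : ℕ) (hm : m ≤ n - D) : (scans g n D (n - D - m)).okA = true ↔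
      ∀ k, n - D - m ≤ k → k + D < n → (g k).sym = some .here → (g (k + D)).sym = some .here →
      (g k).par = (g (k + D)).par → (scans g n D (k + 1)).same = true →
      (g k).bit = (g (k + D)).bit := by
    induction m with
    | zero =>
      rw [Nat.sub_zero, scans_end]
      exact iff_of_true rfl fun k hk hk' => by omega
    | succ m ih =>
      have e : n - D - (m + 1) + 1 = n - D - m := by omega
      rw [scans_step (by omega), e]
      simp only [Scanner.step, decide_eq_true_eq, ih (by omega)]
      constructor
      · rintro ⟨h1, h2⟩ k hk hk'
        rcases hk.eq_or_lt with rfl | hk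
        · rw [e]; exact h2
        · exact h1 k (by omega) hk'
      · refine fun h' => ⟨fun k hk hk' => h' k (by omega) hk', ?_⟩
        have := h' _ le_rfl (by omega)
        rwa [e] at this
  have := key (n - D) le_rfl
  simpa using this

/-- A symbol that is not a digit (or the end of a block). -/
def NotBit (s : Option Symbol) : Prop := ∀ d, s ≠ some (.bit d)

theorem sameDigits_of_notBit {r : Bool} {s s' : Option Symbol} (h : NotBit s) (h' : NotBit s') :
    sameDigits r s s' = true := by
  rcases s with _ | (_ | b | _ | _ | _) <;> rcases s' with _ | (_ | b' | _ | _ | _) <;>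
    first | rfl | exact absurd rfl (h _) | exact absurd rfl (h' _)

theorem sameDigits_bit_left {r : Bool} {d : Bool} {s : Option Symbol} (h : NotBit s) :
    sameDigits r (some (.bit d)) s = false := by
  rcases s with _ | (_ | b | _ | _ | _) <;> first | rfl | exact absurd rfl (h _)

theorem sameDigits_bit_right {r : Bool} {d : Bool} {s : Option Symbol} (h : NotBit s) :
    sameDigits r s (some (.bit d)) = false := by
  rcases s with _ | (_ | b | _ | _ | _) <;> first | rfl | exact absurd rfl (h _)

/-- A pair of non-digits resets the flag to true, a digit against a non-digit makes it false. At the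
start of two runs of digits it thus tells whether the runs are equal, lengths included. The strict
bound on k lets the pass read the letters that end the runs. -/
theorem scans_same (l l' : List Bool) (k : ℕ) (hk : k + D + l'.length < n)
    (h : Spells (fun k => (g k).sym) k (l.map Symbol.bit))
    (h' : Spells (fun k => (g k).sym) (k + D) (l'.map Symbol.bit))
    (hl : NotBit (g (k + l.length)).sym) (hl' : NotBit (g (k + D + l'.length)).sym) :
    (scans g n D k).same = true ↔ l = l' := by
  induction l generalizing l' k with
  | nil =>
    rw [scans_step (by omega)]
    simp only [Scanner.step]
    cases l' with
    | nil => simpa using sameDigits_of_notBit hl hl'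
    | cons d' l' =>
      simp only [List.map_cons, Spells] at h'
      rw [h'.1, sameDigits_bit_right (s := (g k).sym) hl]
      simp
  | cons d l ih =>
    simp only [List.map_cons, Spells] at h
    cases l' with
    | nil =>
      rw [List.length_nil, add_zero] at hk
      rw [scans_step (by omega)]
      simp only [Scanner.step]
      rw [h.1, sameDigits_bit_left (s := (g (k + D)).sym) hl']
      simp
    | cons d' l' =>
      rw [scans_step (by omega)]
      simp only [List.map_cons, Spells] at h'
      simp only [List.length_cons] at hk hl hl'
      simp only [Scanner.step]
      rw [h.1, h'.1]
      simp only [sameDigits, Bool.and_eq_true, beq_iff_eq, List.cons.injEq]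
      rw [ih l' (k + 1) (by omega) h.2 (by rw [show k + 1 + D = k + D + 1 by omega]; exact h'.2)
        (by rw [show k + 1 + l.length = k + (l.length + 1) by omega]; exact hl)
        (by rw [show k + 1 + D + l'.length = k + D + (l'.length + 1) by omega]; exact hl')]

end scans

/-- The state of the pushdown pass over a word of length `n`, after reading the letters from
position `k` on. -/
noncomputable def reads (cap : ℕ) (free : Bool) (g : ℕ → Letter) (n k : ℕ) :
    Reader cap × List Bool :=
  foldFrom (fun k x => Reader.pda free x (g k)) (⟨true, none, true, true, true, false⟩, []) n k

theorem reads_step {g : ℕ → Letter} {n k : ℕ} (h : k < n) :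
    reads cap free g n k = Reader.pda free (reads cap free g n (k + 1)) (g k) :=
  foldFrom_step _ _ h

theorem reads_end {g : ℕ → Letter} {n : ℕ} :
    reads cap free g n n = (⟨true, none, true, true, true, false⟩, []) :=
  foldFrom_self _ _ _

theorem satVerifier_accepts_iff (g : ℕ → Letter) (n : ℕ) :
    (satVerifier cap free).accepts ((List.range n).map g).reverse = true ↔
      ((reads cap free g n 0).1.ok = true ∧ (reads cap free g n 0).1.sat = true) ∧
      ∀ D ≤ n, (scans g n D 0).Ok (if D = 0 then none else some (g (D - 1))) := by
  refine ((satVerifier cap free).accepts_reverse_iff g n).trans ?_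
  refine and_congr (Bool.and_eq_true _ _).to_iff ?_
  exact forall_congr' fun D => forall_congr' fun _ => @decide_eq_true_iff _ (Classical.propDecidable _)

/-! ### The relations of the programs -/

theorem rel_iter_right {v v' : ℤ × ℤ} :
    (Program.iter .right).Rel v v' ↔ v.1 ≤ v'.1 ∧ v'.2 = v.2 := by
  constructor
  · intro h
    induction h with
    | refl => exact ⟨le_rfl, rfl⟩
    | tail _ h ih =>
      obtain ⟨h1, h2⟩ := h
      exact ⟨by omega, h2.trans ih.2⟩
  · obtain ⟨x, y⟩ := v
    obtain ⟨x', y'⟩ := v'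
    rintro ⟨h, rfl⟩
    induction x', h using Int.leInduction with
    | base => exact Relation.ReflTransGen.refl
    | succ x' _ ih => exact ih.tail ⟨rfl, rfl⟩

theorem rel_iter_left {v v' : ℤ × ℤ} :
    (Program.iter .left).Rel v v' ↔ v'.1 ≤ v.1 ∧ v'.2 = v.2 := by
  constructor
  · intro h
    induction h with
    | refl => exact ⟨le_rfl, rfl⟩
    | tail _ h ih =>
      obtain ⟨h1, h2⟩ := h
      exact ⟨by omega, h2.trans ih.2⟩
  · obtain ⟨x, y⟩ := v
    obtain ⟨x', y'⟩ := v'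
    rintro ⟨h, rfl⟩
    induction x', h using Int.leInductionDown with
    | base => exact Relation.ReflTransGen.refl
    | pred x' _ ih => exact ih.tail ⟨rfl, rfl⟩

theorem rel_iter_up {v v' : ℤ × ℤ} :
    (Program.iter .up).Rel v v' ↔ v'.1 = v.1 ∧ v.2 ≤ v'.2 := by
  constructor
  · intro h
    induction h with
    | refl => exact ⟨rfl, le_rfl⟩
    | tail _ h ih =>
      obtain ⟨h1, h2⟩ := h
      exact ⟨h1.trans ih.1, by omega⟩
  · obtain ⟨x, y⟩ := v
    obtain ⟨x', y'⟩ := v'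
    rintro ⟨rfl, h⟩
    induction y', h using Int.leInduction with
    | base => exact Relation.ReflTransGen.refl
    | succ x' _ ih => exact ih.tail ⟨rfl, rfl⟩

theorem rel_iter_down {v v' : ℤ × ℤ} :
    (Program.iter .down).Rel v v' ↔ v'.1 = v.1 ∧ v'.2 ≤ v.2 := by
  constructor
  · intro h
    induction h with
    | refl => exact ⟨rfl, le_rfl⟩
    | tail _ h ih =>
      obtain ⟨h1, h2⟩ := h
      exact ⟨h1.trans ih.1, by omega⟩
  · obtain ⟨x, y⟩ := v
    obtain ⟨x', y'⟩ := v'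
    rintro ⟨rfl, h⟩
    induction y', h using Int.leInductionDown with
    | base => exact Relation.ReflTransGen.refl
    | pred x' _ ih => exact ih.tail ⟨rfl, rfl⟩

theorem forall_rel_right {v : ℤ × ℤ} {p : ℤ × ℤ → Prop} :
    (∀ v', (Program.move .right).Rel v v' → p v') ↔ p (v.1 + 1, v.2) :=
  ⟨fun h => h _ ⟨rfl, rfl⟩, by rintro h ⟨x, y⟩ ⟨rfl, rfl⟩; exact h⟩

theorem forall_rel_left {v : ℤ × ℤ} {p : ℤ × ℤ → Prop} :
    (∀ v', (Program.move .left).Rel v v' → p v') ↔ p (v.1 - 1, v.2) :=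
  ⟨fun h => h _ ⟨rfl, rfl⟩, by rintro h ⟨x, y⟩ ⟨rfl, rfl⟩; exact h⟩

theorem forall_rel_up {v : ℤ × ℤ} {p : ℤ × ℤ → Prop} :
    (∀ v', (Program.move .up).Rel v v' → p v') ↔ p (v.1, v.2 + 1) :=
  ⟨fun h => h _ ⟨rfl, rfl⟩, by rintro h ⟨x, y⟩ ⟨rfl, rfl⟩; exact h⟩

theorem forall_rel_down {v : ℤ × ℤ} {p : ℤ × ℤ → Prop} :
    (∀ v', (Program.move .down).Rel v v' → p v') ↔ p (v.1, v.2 - 1) :=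
  ⟨fun h => h _ ⟨rfl, rfl⟩, by rintro h ⟨x, y⟩ ⟨rfl, rfl⟩; exact h⟩

theorem forall_rel_iter_right {v : ℤ × ℤ} {p : ℤ × ℤ → Prop} :
    (∀ v', (Program.iter .right).Rel v v' → p v') ↔ ∀ x, v.1 ≤ x → p (x, v.2) :=
  ⟨fun h x hx => h _ (rel_iter_right.2 ⟨hx, rfl⟩), by
    rintro h ⟨x, y⟩ hv
    obtain ⟨h1, rfl⟩ := rel_iter_right.1 hv
    exact h x h1⟩

theorem forall_rel_iter_left {v : ℤ × ℤ} {p : ℤ × ℤ → Prop} :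
    (∀ v', (Program.iter .left).Rel v v' → p v') ↔ ∀ x, x ≤ v.1 → p (x, v.2) :=
  ⟨fun h x hx => h _ (rel_iter_left.2 ⟨hx, rfl⟩), by
    rintro h ⟨x, y⟩ hv
    obtain ⟨h1, rfl⟩ := rel_iter_left.1 hv
    exact h x h1⟩

theorem forall_rel_iter_up {v : ℤ × ℤ} {p : ℤ × ℤ → Prop} :
    (∀ v', (Program.iter .up).Rel v v' → p v') ↔ ∀ y, v.2 ≤ y → p (v.1, y) :=
  ⟨fun h x hx => h _ (rel_iter_up.2 ⟨rfl, hx⟩), by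
    rintro h ⟨x, y⟩ hv
    obtain ⟨rfl, h1⟩ := rel_iter_up.1 hv
    exact h y h1⟩

theorem forall_rel_iter_down {v : ℤ × ℤ} {p : ℤ × ℤ → Prop} :
    (∀ v', (Program.iter .down).Rel v v' → p v') ↔ ∀ y, y ≤ v.2 → p (v.1, y) :=
  ⟨fun h x hx => h _ (rel_iter_down.2 ⟨rfl, hx⟩), by
    rintro h ⟨x, y⟩ hv
    obtain ⟨rfl, h1⟩ := rel_iter_down.1 hv
    exact h y h1⟩

/-! ### Truth from local conditions -/

theorem NotBit.of_spells_word {σ : ℕ → Option Symbol} {j : ℕ} {φ : Formula ℕ}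
    (h : Spells σ j φ.word) : NotBit (σ j) := by
  intro d
  cases φ <;> · rw [h.1]; simp

theorem annotated_add {g : ℕ → Letter} {φ : Formula ℕ} {b j : ℕ} :
    Annotated g φ (b + j) ↔ Annotated (fun k => g (b + k)) φ j := by
  induction φ generalizing j with
  | here i => rfl
  | neg φ ih => simp only [Annotated, add_assoc b, ih]
  | and φ ψ ih ih' => simp only [Annotated, add_assoc b, ih, ih']
  | box α φ ih => simp only [Annotated, add_assoc b, ih]

/-- Induction on φ, at all points at once because boxes move. Requiring a non-digit after the word
ensures that an occurrence of `here` is read with its complete index. -/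
theorem holds_iff_bit {σ : ℕ → Option Symbol} {L : ℤ × ℤ → ℕ → Letter} {P : PositionModel ℕ}
    (hbox : ∀ j α, σ j = some (.box α) → ∀ v,
      (L v j).bit = true ↔ ∀ v', α.Rel v v' → (L v' j).child = true)
    (hhere : ∀ i j, Spells σ j (Formula.here i).word →
      NotBit (σ (j + (Formula.here i).word.length)) → ∀ v, (L v j).bit = true ↔ P i = v)
    (φ : Formula ℕ) (j : ℕ) (hs : Spells σ j φ.word) (hn : NotBit (σ (j + φ.word.length)))
    (ha : ∀ v, Annotated (L v) φ j) (v : ℤ × ℤ) : (L v j).bit = true ↔ φ.Holds P v := by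
  induction φ generalizing j v with
  | here i => exact hhere i j hs hn v
  | neg φ ih =>
    have hn' : NotBit (σ (j + 1 + φ.word.length)) := by
      rw [add_assoc, add_comm 1]; exact hn
    rw [(ha v).1, Formula.Holds, ← ih (j + 1) hs.2 hn' (fun v => (ha v).2) v]
    simp
  | and φ ψ ih ih' =>
    have hn' : NotBit (σ (j + 1 + φ.word.length + ψ.word.length)) := by
      simpa [Formula.word, add_assoc, add_comm 1] using hn
    obtain ⟨hs1, hs2⟩ := spells_append.1 hs.2
    rw [(ha v).1, Formula.Holds,
      ← ih (j + 1) hs1 (NotBit.of_spells_word hs2) (fun v => (ha v).2.1) v,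
      ← ih' _ hs2 hn' (fun v => (ha v).2.2) v, Bool.and_eq_true]
  | box α φ ih =>
    have hn' : NotBit (σ (j + 1 + φ.word.length)) := by
      rw [add_assoc, add_comm 1]; exact hn
    rw [hbox j α hs.1 v, Formula.Holds]
    refine forall_congr' fun v' => imp_congr_right fun _ => ?_
    rw [(ha v').1, ih (j + 1) hs.2 hn' (fun v => (ha v).2) v']

/-! ### Extension of a chain beyond its ends -/

/-- The number in `0, …, N - 1` that is nearest to an integer. -/
def nearest (N : ℕ) (x : ℤ) : ℕ := (min x (N - 1)).toNat

section nearest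

variable {N : ℕ} (hN : 2 ≤ N)

include hN in
theorem nearest_lt (x : ℤ) : nearest N x < N := by
  unfold nearest; omega

-- Consecutive integers are either clamped to the same end or sent to consecutive indices.
include hN in
theorem nearest_cases (x : ℤ) :
    (x < 0 ∧ nearest N x = 0 ∧ nearest N (x + 1) = 0) ∨
    ((N : ℤ) - 1 ≤ x ∧ nearest N x = N - 1 ∧ nearest N (x + 1) = N - 1) ∨
    (nearest N (x + 1) = nearest N x + 1 ∧ nearest N x + 1 < N) := by
  unfold nearest; omega

/-- The recursion alone does not determine f: it could be false everywhere although c is true. The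
base condition from B on excludes this; below B one descends by induction on the distance to B. -/
theorem forall_ge_of_step {f c : ℤ → Bool} (h : ∀ x, f x = (c x && f (x + 1))) (B : ℤ)
    (hB : ∀ x, B ≤ x → f x = c x) (x : ℤ) : f x = true ↔ ∀ x', x ≤ x' → c x' = true := by
  constructor
  · intro hx x' hx'
    have : f x' = true := by
      induction x', hx' using Int.leInduction with
      | base => exact hx
      | succ y _ ih =>
        rw [h y, Bool.and_eq_true] at ih
        exact ih.2
    rw [h x', Bool.and_eq_true] at this
    exact this.1
  · intro hc
    have key : ∀ n : ℕ, ∀ x, B - x ≤ n → (∀ x', x ≤ x' → c x' = true) → f x = true := by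
      intro n
      induction n with
      | zero => intro x hx hc; rw [hB x (by omega)]; exact hc x le_rfl
      | succ n ih =>
        intro x hx hc
        rw [h x, hc x le_rfl, ih (x + 1) (by omega) fun x' hx' => hc x' (by omega)]
        rfl
    exact key (B - x).toNat x (by omega) hc

theorem forall_le_of_step {f c : ℤ → Bool} (h : ∀ x, f (x + 1) = (c (x + 1) && f x)) (B : ℤ)
    (hB : ∀ x, x ≤ B → f x = c x) (x : ℤ) : f x = true ↔ ∀ x', x' ≤ x → c x' = true := by
  have := forall_ge_of_step (f := fun x => f (-x)) (c := fun x => c (-x))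
    (fun y => by have := h (-(y + 1)); rwa [show -(y + 1) + 1 = -y by omega] at this) (-B)
    (fun y hy => hB _ (by omega)) (-x)
  simp only [neg_neg] at this
  rw [this]
  constructor
  · intro H x' hx'
    have := H (-x') (by omega)
    rwa [neg_neg] at this
  · exact fun H x' hx' => H _ (by omega)

variable {d d' : Direction} {a : ℕ → Letter} {α : Program}
  (hadj : ∀ x, x + 1 < N → Adjacent d d' (x = 0 ∨ x + 2 = N) (a x) (a (x + 1)))
  (hsym : ∀ x, x < N → (a x).sym = some (.box α))

include hN hadj

theorem chain_ends : (a 0).bit = (a 1).bit ∧ (a 0).child = (a 1).child ∧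
    (a (N - 2)).bit = (a (N - 1)).bit ∧ (a (N - 2)).child = (a (N - 1)).child := by
  have h0 := (hadj 0 (by omega)).2.2.2.2 (Or.inl rfl)
  have h1 := (hadj (N - 2) (by omega)).2.2.2.2 (Or.inr (by omega))
  rw [show N - 2 + 1 = N - 1 by omega] at h1
  exact ⟨h0.1, h0.2, h1.1, h1.2⟩

include hsym

/-- Inside the chain this is adjacency. Beyond an end both points are clamped to one entry, and
adjacency with its neighbour suffices because the two outermost entries agree in `bit` and `child`.
-/
theorem chain_move (hα : α = .move d) (x : ℤ) :
    (a (nearest N x)).bit = (a (nearest N (x + 1))).child := by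
  subst hα
  obtain ⟨e1, e2, e3, e4⟩ := chain_ends hN hadj
  have h (y : ℕ) (hy : y + 1 < N) : (a y).bit = (a (y + 1)).child :=
    (hadj y hy).1 (hsym y (by omega))
  rcases nearest_cases hN x with ⟨-, h1, h2⟩ | ⟨-, h1, h2⟩ | ⟨h1, h2⟩
  · rw [h1, h2, h 0 (by omega), e2]
  · have := h (N - 2) (by omega)
    rw [show N - 2 + 1 = N - 1 by omega] at this
    rw [h1, h2, ← e3, this]
  · rw [h1, h _ h2]

theorem chain_move' (hα : α = .move d') (x : ℤ) :
    (a (nearest N (x + 1))).bit = (a (nearest N x)).child := by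
  subst hα
  obtain ⟨e1, e2, e3, e4⟩ := chain_ends hN hadj
  have h (y : ℕ) (hy : y + 1 < N) : (a (y + 1)).bit = (a y).child :=
    (hadj y hy).2.1 (hsym y (by omega))
  rcases nearest_cases hN x with ⟨-, h1, h2⟩ | ⟨-, h1, h2⟩ | ⟨h1, h2⟩
  · rw [h1, h2, e1, h 0 (by omega)]
  · have := h (N - 2) (by omega)
    rw [show N - 2 + 1 = N - 1 by omega] at this
    rw [h1, h2, ← e4, this]
  · rw [h1, h _ h2]

theorem chain_iter (hα : α = .iter d) (hend : (a (N - 1)).bit = (a (N - 1)).child) (x : ℤ) :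
    (a (nearest N x)).bit = true ↔ ∀ x', x ≤ x' → (a (nearest N x')).child = true := by
  subst hα
  obtain ⟨e1, e2, e3, e4⟩ := chain_ends hN hadj
  have h (y : ℕ) (hy : y + 1 < N) : (a y).bit = ((a y).child && (a (y + 1)).bit) :=
    (hadj y hy).2.2.1 (hsym y (by omega))
  refine forall_ge_of_step (f := fun x => (a (nearest N x)).bit)
    (c := fun x => (a (nearest N x)).child) (fun x => ?_) (N - 1) (fun x hx => ?_) x
  · rcases nearest_cases hN x with ⟨-, h1, h2⟩ | ⟨-, h1, h2⟩ | ⟨h1, h2⟩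
    · have := h 0 (by omega)
      simp only [h1, h2]
      rw [zero_add, ← e1] at this
      exact this
    · simp only [h1, h2, hend, Bool.and_self]
    · simp only [h1]
      exact h _ h2
  · rw [show nearest N x = N - 1 by unfold nearest; omega]
    exact hend

theorem chain_iter' (hα : α = .iter d') (hend : (a 0).bit = (a 0).child) (x : ℤ) :
    (a (nearest N x)).bit = true ↔ ∀ x', x' ≤ x → (a (nearest N x')).child = true := by
  subst hα
  obtain ⟨e1, e2, e3, e4⟩ := chain_ends hN hadj
  have h (y : ℕ) (hy : y + 1 < N) : (a (y + 1)).bit = ((a (y + 1)).child && (a y).bit) :=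
    (hadj y hy).2.2.2.1 (hsym y (by omega))
  refine forall_le_of_step (f := fun x => (a (nearest N x)).bit)
    (c := fun x => (a (nearest N x)).child) (fun x => ?_) 0 (fun x hx => ?_) x
  · rcases nearest_cases hN x with ⟨-, h1, h2⟩ | ⟨-, h1, h2⟩ | ⟨h1, h2⟩
    · simp only [h1, h2, hend, Bool.and_self]
    · have := h (N - 2) (by omega)
      rw [show N - 2 + 1 = N - 1 by omega, e3] at this
      simp only [h1, h2]
      exact this
    · simp only [h1]
      exact h _ h2
  · rw [show nearest N x = 0 by unfold nearest; omega]
    exact hend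

end nearest

/-! ### Accepted words are sequences of blocks -/

variable {cap : ℕ} {free : Bool}

theorem Reader.pda_symbol {x : Reader cap × List Bool} {a : Letter} {s : Symbol}
    (h : a.hdr = false) (hs : a.sym = some s) :
    (Reader.pda free x a).1.start = x.1.start ∧ (Reader.pda free x a).1.right = x.1.right ∧
    (Reader.pda free x a).1.top = x.1.top ∧ (Reader.pda free x a).1.sat = x.1.sat ∧
    ((Reader.pda free x a).1.ok = true → a.Border ∧ x.1.start = false ∧ a.right = x.1.right ∧
      a.top = x.1.top) := by
  have key (t t' : Option Bool) :
      (x.1.step free a t t').start = x.1.start ∧ (x.1.step free a t t').right = x.1.right ∧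
      (x.1.step free a t t').top = x.1.top ∧ (x.1.step free a t t').sat = x.1.sat ∧
      ((x.1.step free a t t').ok = true → a.Border ∧ x.1.start = false ∧ a.right = x.1.right ∧
        a.top = x.1.top) := by
    obtain ⟨h1, h2⟩ := Reader.step_symbol (q := x.1) (free := free) h hs t t'
    refine ⟨?_, ?_, ?_, ?_, ?_⟩
    · rw [h1]
    · rw [h1]
    · rw [h1]
    · rw [h1]
    · rw [h2]; tauto
  cases s with
  | bit d => rw [Reader.pda_bit h hs]; exact key _ _
  | here => rw [Reader.pda_here h hs]; exact key _ _
  | neg => rw [Reader.pda_neg h hs]; exact key _ _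
  | and => rw [Reader.pda_and h hs]; exact key _ _
  | box α => rw [Reader.pda_box h hs]; exact key _ _

variable (cap free) in
/-- An accepted word, consisting of the letters of `w`, the delimiter, and further letters. -/
structure Accepted (w : List Symbol) (g : ℕ → Letter) (n : ℕ) : Prop where
  le : w.length < n
  header : ∀ k (h : k < w.length), g k = headerLetter (some w[k])
  delim : g w.length = headerLetter none
  body : ∀ k, w.length < k → k < n → (g k).hdr = false
  ok : (reads cap free g n 0).1.ok = true
  sat : (reads cap free g n 0).1.sat = true
  scan : ∀ D ≤ n, (scans g n D 0).Ok (if D = 0 then none else some (g (D - 1)))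

namespace Accepted

variable {w : List Symbol} {g : ℕ → Letter} {n : ℕ} (A : Accepted cap free w g n)

include A

theorem ok_reads (k : ℕ) (hk : k ≤ n) : (reads cap free g n k).1.ok = true := by
  induction k with
  | zero => exact A.ok
  | succ k ih =>
    have := ih (by omega)
    rw [reads_step (by omega)] at this
    exact Reader.pda_ok this

/-- In the initial state neither the delimiter nor a symbol can be read without failure; only an end
letter of the corner remains, and it must come from the certificate. -/
theorem last_letter : w.length + 1 < n ∧ (g (n - 1)).sym = none ∧ (g (n - 1)).right = true ∧
    (g (n - 1)).top = true := by
  have hle := A.le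
  have h := A.ok_reads (n - 1) (by omega)
  rw [reads_step (by omega), show n - 1 + 1 = n by omega, reads_end] at h
  have hn : w.length + 1 < n := by
    by_contra hn
    rw [show n - 1 = w.length by omega, A.delim,
      (Reader.pda_end_header (a := headerLetter none) rfl rfl).1] at h
    exact absurd h.2.1 (by simp)
  have hh := A.body (n - 1) (by omega) (by omega)
  have hs : (g (n - 1)).sym = none := by
    by_contra hs
    obtain ⟨s, hs⟩ := Option.ne_none_iff_exists'.1 hs
    exact absurd ((Reader.pda_symbol hh hs).2.2.2.2 h).2.1 (by simp)
  rw [Reader.pda_end_start hh hs rfl] at h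
  exact ⟨hn, hs, h.2.2.1, h.2.2.2⟩

theorem reads_state (k : ℕ) (hk : w.length < k) (hkn : k < n) :
    (reads cap free g n k).1.start = false ∧ (reads cap free g n k).1.right = (g k).right ∧
    (reads cap free g n k).1.top = (g k).top := by
  have hh := A.body k hk hkn
  have hok := A.ok_reads k hkn.le
  rw [reads_step hkn] at hok ⊢
  by_cases hs : (g k).sym = none
  · obtain ⟨h1, -, h2, h3, -⟩ := Reader.pda_end_eq (x := reads cap free g n (k + 1)) (free := free)
      hh hs
    exact ⟨h1, h2, h3⟩
  · obtain ⟨s, hs⟩ := Option.ne_none_iff_exists'.1 hs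
    obtain ⟨h1, h2, h3, -, h4⟩ := Reader.pda_symbol (x := reads cap free g n (k + 1))
      (free := free) hh hs
    obtain ⟨-, h5, h6, h7⟩ := h4 hok
    exact ⟨h1.trans h5, h2.trans h6.symm, h3.trans h7.symm⟩

theorem border (k : ℕ) (hk : w.length < k) (hkn : k < n) : (g k).Border := by
  have hh := A.body k hk hkn
  have hok := A.ok_reads k hkn.le
  rw [reads_step hkn] at hok
  by_cases hs : (g k).sym = none
  · by_cases hst : (reads cap free g n (k + 1)).1.start = true
    · exact ((Reader.pda_end_start hh hs hst).1 hok).2.1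
    · exact ((Reader.pda_end_block hh hs (by simpa using hst)).1 hok).2.1
  · obtain ⟨s, hs⟩ := Option.ne_none_iff_exists'.1 hs
    exact ((Reader.pda_symbol hh hs).2.2.2.2 hok).1

theorem eq_next (k : ℕ) (hk : w.length < k) (hkn : k + 1 < n) (hs : (g k).sym ≠ none) :
    (g k).right = (g (k + 1)).right ∧ (g k).top = (g (k + 1)).top := by
  have hh := A.body k hk (by omega)
  have hok := A.ok_reads k (by omega)
  rw [reads_step (by omega)] at hok
  obtain ⟨s, hs⟩ := Option.ne_none_iff_exists'.1 hs
  obtain ⟨-, -, h1, h2⟩ := (Reader.pda_symbol hh hs).2.2.2.2 hok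
  obtain ⟨-, h3, h4⟩ := A.reads_state (k + 1) (by omega) hkn
  exact ⟨h1.trans h3, h2.trans h4⟩

theorem relH (k : ℕ) (hk : k + (w.length + 1) < n) : RelH (g k) (g (k + (w.length + 1))) := by
  have h := (A.scan (w.length + 1) A.le).2.1 (g w.length) (by simp)
  rw [A.delim] at h
  exact (scans_okH A.le).1 (h rfl rfl) k hk

/-- The shift by one block copies the symbols of the instance, with its delimiter, into every block.
-/
theorem sym_block (b j : ℕ) (hj : j ≤ w.length) (hn : b * (w.length + 1) + j < n) :
    (g (b * (w.length + 1) + j)).sym = w[j]? := by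
  induction b with
  | zero =>
    rw [Nat.zero_mul, zero_add]
    rcases hj.eq_or_lt with rfl | hj
    · rw [A.delim]; simp [headerLetter]
    · rw [A.header j hj]; simp [headerLetter, hj]
  | succ b ih =>
    have e : (b + 1) * (w.length + 1) + j = b * (w.length + 1) + j + (w.length + 1) := by ring
    rw [e] at hn ⊢
    rw [← (A.relH _ hn).1]
    exact ih (by omega)

/-- The last letter is an end letter, and these occur only at the last position of a block, so the
word consists of whole blocks. -/
theorem exists_blocks : ∃ Q, 1 ≤ Q ∧ n = (Q + 1) * (w.length + 1) := by
  obtain ⟨hn, hs, -, -⟩ := A.last_letter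
  have hd := Nat.div_add_mod' (n - 1) (w.length + 1)
  have hm := Nat.mod_lt (n - 1) (Nat.succ_pos w.length)
  generalize (n - 1) / (w.length + 1) = b at hd
  generalize (n - 1) % (w.length + 1) = j at hd hm
  have hj : j ≤ w.length := by omega
  rw [← hd, A.sym_block b j hj (by omega), List.getElem?_eq_none_iff] at hs
  have hjw : j = w.length := by omega
  refine ⟨b, ?_, ?_⟩
  · by_contra hb
    have hb : b = 0 := by omega
    rw [hb] at hd
    omega
  · rw [Nat.add_mul]
    omega

theorem marks_block (b j : ℕ) (hb : 1 ≤ b) (hj : j ≤ w.length)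
    (hn : b * (w.length + 1) + w.length < n) :
    (g (b * (w.length + 1) + j)).right = (g (b * (w.length + 1) + w.length)).right ∧
    (g (b * (w.length + 1) + j)).top = (g (b * (w.length + 1) + w.length)).top := by
  have hb' : w.length + 1 ≤ b * (w.length + 1) := Nat.le_mul_of_pos_left _ hb
  induction h : w.length - j generalizing j with
  | zero =>
    obtain rfl : j = w.length := by omega
    exact ⟨rfl, rfl⟩
  | succ m ih =>
    have hs := A.sym_block b j hj (by omega)
    obtain ⟨h1, h2⟩ := A.eq_next (b * (w.length + 1) + j) (by omega) (by omega)
      (by rw [hs, Ne, List.getElem?_eq_none_iff]; omega)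
    obtain ⟨h3, h4⟩ := ih (j + 1) (by omega) (by omega)
    exact ⟨h1.trans h3, h2.trans h4⟩

theorem par_block (b j : ℕ) (hj : j ≤ w.length) (hn : b * (w.length + 1) + j < n) :
    (g (b * (w.length + 1) + j)).par = decide (b % 2 = 1) := by
  induction b with
  | zero =>
    rw [Nat.zero_mul, zero_add]
    rcases hj.eq_or_lt with rfl | hj
    · rw [A.delim]; simp [headerLetter]
    · rw [A.header j hj]; simp [headerLetter]
  | succ b ih =>
    have e : (b + 1) * (w.length + 1) + j = b * (w.length + 1) + j + (w.length + 1) := by ring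
    rw [e] at hn ⊢
    rw [(A.relH _ hn).2.1, ih (by omega), ← decide_not]
    congr 1
    apply propext
    omega

theorem header_letter (j : ℕ) (hj : j ≤ w.length) : ∃ s, g j = headerLetter s := by
  rcases hj.eq_or_lt with rfl | hj
  exacts [⟨_, A.delim⟩, ⟨_, A.header j hj⟩]

end Accepted

/-! ### The blocks form a rectangular grid -/

variable {cap : ℕ} {free : Bool}

namespace Accepted

variable {w : List Symbol} {g : ℕ → Letter} {n : ℕ} (A : Accepted cap free w g n)

/-- The position of a letter of the block of a point of a grid with rows of length `N`. -/
def cellIndex (w : List Symbol) (N x y j : ℕ) : ℕ := (1 + x + y * N) * (w.length + 1) + j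

theorem index_lt {Q b j : ℕ} (hn : n = (Q + 1) * (w.length + 1)) (hb : b ≤ Q) (hj : j ≤ w.length) :
    b * (w.length + 1) + j < n := by
  have : b * (w.length + 1) ≤ Q * (w.length + 1) := Nat.mul_le_mul_right _ hb
  rw [hn, Nat.add_mul]
  omega

theorem length_lt_index {b j : ℕ} (hb : 1 ≤ b) : w.length < b * (w.length + 1) + j := by
  have : w.length + 1 ≤ b * (w.length + 1) := Nat.le_mul_of_pos_left _ hb
  omega

include A

theorem relH_block {Q b j : ℕ} (hn : n = (Q + 1) * (w.length + 1)) (hb : b < Q)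
    (hj : j ≤ w.length) :
    RelH (g (b * (w.length + 1) + j)) (g ((b + 1) * (w.length + 1) + j)) := by
  have := index_lt hn (Nat.succ_le_of_lt hb) hj
  have e : (b + 1) * (w.length + 1) + j = b * (w.length + 1) + j + (w.length + 1) := by ring
  rw [Nat.succ_eq_add_one] at this
  rw [e] at this ⊢
  exact A.relH _ this

/-- Neither width nor height is given; both come from the marks. The first block marked as a right
end fixes N, which makes the shift by N blocks the vertical one; that shift repeats the mark with
period N, and as the last block carries it too, N divides the number of blocks. -/
theorem exists_grid : ∃ N M, 2 ≤ N ∧ 2 ≤ M ∧ n = (N * M + 1) * (w.length + 1) ∧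
    (∀ x y j, x + 1 < N → y < M → j ≤ w.length → Adjacent .right .left (x = 0 ∨ x + 2 = N)
      (g (cellIndex w N x y j)) (g (cellIndex w N (x + 1) y j))) ∧
    (∀ x y j, x < N → y + 1 < M → j ≤ w.length → Adjacent .up .down (y = 0 ∨ y + 2 = M)
      (g (cellIndex w N x y j)) (g (cellIndex w N x (y + 1) j))) ∧
    (∀ x y j, x < N → y < M → j ≤ w.length →
      (x = 0 → (g (cellIndex w N x y j)).left = true) ∧
      (x + 1 = N → (g (cellIndex w N x y j)).right = true) ∧
      (y = 0 → (g (cellIndex w N x y j)).bottom = true) ∧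
      (y + 1 = M → (g (cellIndex w N x y j)).top = true)) := by
  obtain ⟨Q, hQ, hn⟩ := A.exists_blocks
  set W := w.length + 1 with hW
  obtain ⟨-, -, hlr, hlt⟩ := A.last_letter
  have hlast : n - 1 = Q * W + w.length := by rw [hn, Nat.add_mul]; omega
  rw [hlast] at hlr hlt
  set rt : ℕ → Bool := fun b => (g (b * W + w.length)).right with hrt
  have hmark (b j : ℕ) (hb : 1 ≤ b) (hbQ : b ≤ Q) (hj : j ≤ w.length) :=
    A.marks_block b j hb hj (index_lt hn hbQ le_rfl)
  have hex : ∃ b, 1 ≤ b ∧ rt b = true := ⟨Q, hQ, hlr⟩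
  classical
  -- The row length: the first cell with a right mark.
  obtain ⟨N, ⟨hN1, hNr⟩, hmin⟩ : ∃ N, (1 ≤ N ∧ rt N = true) ∧
      ∀ b, 1 ≤ b → b < N → rt b = false := by
    refine ⟨Nat.find hex, Nat.find_spec hex, fun b hb hbN => ?_⟩
    have := Nat.find_min hex hbN
    simpa [hb] using this
  have hNQ : N ≤ Q := by
    by_contra h
    have := hmin Q hQ (by omega)
    rw [hrt] at this
    simp [hlr] at this
  have hbottom (b j : ℕ) (hb : 1 ≤ b) (hbN : b ≤ N) (hj : j ≤ w.length) :
      (g (b * W + j)).bottom = true := by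
    induction b, hb using Nat.le_induction with
    | base =>
      have h := A.relH_block hn (b := 0) (by omega) hj
      rw [zero_add] at h
      refine h.2.2.2.2.1 ?_
      obtain ⟨s, hs⟩ := A.header_letter j hj
      rw [Nat.zero_mul, zero_add, hs]
      rfl
    | succ b hb ih =>
      have h := A.relH_block hn (b := b) (by omega) hj
      rw [← (h.2.2.2.2.2 ?_).2.1]
      · exact ih (by omega)
      · rw [(hmark b j hb (by omega) hj).1]
        exact hmin b hb (by omega)
  -- Block N - 1 has just ended, and block N is marked right and bottom, so `Scanner.Ok` demands
  -- `RelV` for this shift.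
  have hrelV (b j : ℕ) (hb : b + N ≤ Q) (hj : j ≤ w.length) :
      RelV (g (b * W + j)) (g ((b + N) * W + j)) := by
    have hWN : W ≤ N * W := Nat.le_mul_of_pos_left _ hN1
    have hD : N * W < n := by have := index_lt hn hNQ (Nat.zero_le _); omega
    have h := (A.scan (N * W) hD.le).2.2
    rw [if_neg (by omega), scans_last hD] at h
    have e : N * W - 1 = (N - 1) * W + w.length := by
      rw [Nat.sub_mul]
      omega
    have hsym := A.sym_block (N - 1) w.length le_rfl (index_lt hn (by omega) le_rfl)
    have hV := h _ rfl _ rfl (by rw [e, hsym]; simp)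
      (A.body _ (by have := length_lt_index (w := w) (j := 0) hN1; simpa using this) hD)
      (by
        have := (hmark N 0 hN1 hNQ (Nat.zero_le _)).1
        rw [add_zero] at this
        rw [this]; exact hNr)
      (by have := hbottom N 0 hN1 le_rfl (Nat.zero_le _); rwa [add_zero] at this)
    have := (scans_okV hD.le).1 hV (b * W + j) (by
      have := index_lt hn hb hj
      rw [← hW, Nat.add_mul] at this
      omega)
    rwa [show (b + N) * W + j = b * W + j + N * W by ring]
  -- Periodicity from `RelV`; block 0 carries the mark by its definition.
  have hright (b : ℕ) (hb : b ≤ Q) : rt b = true ↔ N ∣ b := by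
    induction b using Nat.strong_induction_on with
    | _ b ih =>
      rcases lt_or_ge b N with hbN | hbN
      · rcases Nat.eq_zero_or_pos b with rfl | hb0
        · refine iff_of_true ?_ (dvd_zero _)
          simp only [hrt]
          rw [Nat.zero_mul, zero_add, A.delim]
          rfl
        · rw [hmin b hb0 hbN]
          simp only [Bool.false_eq_true, false_iff]
          exact Nat.not_dvd_of_pos_of_lt hb0 hbN
      · have h1 := (hrelV (b - N) w.length (by omega) le_rfl).1
        rw [Nat.sub_add_cancel hbN] at h1
        have h2 := ih (b - N) (by omega) (by omega)
        simp only [hrt] at h2 ⊢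
        rw [← h1, h2, Nat.dvd_sub_iff_left hbN dvd_rfl]
  obtain ⟨M, hM⟩ : N ∣ Q := (hright Q le_rfl).1 hlr
  have hrt' (b j : ℕ) (hb : 1 ≤ b) (hbQ : b ≤ Q) (hj : j ≤ w.length) :
      (g (b * W + j)).right = true ↔ N ∣ b := by
    rw [(hmark b j hb hbQ hj).1]
    exact hright b hbQ
  have hleft (b j : ℕ) (hb : b < Q) (hj : j ≤ w.length) (hd : N ∣ b) :
      (g ((b + 1) * W + j)).left = true := by
    refine (A.relH_block hn hb hj).2.2.2.1 ?_
    rcases Nat.eq_zero_or_pos b with rfl | hb0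
    · obtain ⟨s, hs⟩ := A.header_letter j hj
      rw [Nat.zero_mul, zero_add, hs]
      rfl
    · exact (hrt' b j hb0 hb.le hj).2 hd
  have hborder (b j : ℕ) (hb : 1 ≤ b) (hbQ : b ≤ Q) (hj : j ≤ w.length) :
      (g (b * W + j)).Border :=
    A.border _ (length_lt_index hb) (index_lt hn hbQ hj)
  have hN2 : 2 ≤ N := by
    by_contra hN
    have hN : N = 1 := by omega
    have h := hleft 0 0 (by omega) (Nat.zero_le _) (dvd_zero _)
    have h' := (hborder 1 0 le_rfl hQ (Nat.zero_le _)).2.2.2.2.2.2.1 h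
    rw [← Bool.not_eq_true, hrt' 1 0 le_rfl hQ (Nat.zero_le _), hN] at h'
    exact h' dvd_rfl
  -- Along a row the top mark is shared by neighbours, so it spreads backwards from the last block.
  have htop (b j : ℕ) (hb : Q < b + N) (hbQ : b ≤ Q) (hj : j ≤ w.length) :
      (g (b * W + j)).top = true := by
    rw [(hmark b j (by omega) hbQ hj).2]
    induction h : Q - b generalizing b with
    | zero =>
      obtain rfl : b = Q := by omega
      exact hlt
    | succ m ih =>
      have h1 := A.relH_block hn (b := b) (by omega) le_rfl
      rw [(h1.2.2.2.2.2 ?_).1]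
      · exact ih (b + 1) (by omega) (by omega) (by omega)
      · rw [← Bool.not_eq_true, hrt' b _ (by omega) hbQ le_rfl]
        intro hd
        have : N ∣ Q - b := Nat.dvd_sub ⟨M, hM⟩ hd
        exact Nat.not_dvd_of_pos_of_lt (by omega) (by omega) this
  have hM2 : 2 ≤ M := by
    by_contra hM'
    have hM' : M = 0 ∨ M = 1 := by omega
    rcases hM' with rfl | rfl
    · omega
    · have h := hbottom 1 0 le_rfl hN1 (Nat.zero_le _)
      have h' := (hborder 1 0 le_rfl hQ (Nat.zero_le _)).2.2.2.2.2.2.2 h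
      rw [htop 1 0 (by omega) hQ (Nat.zero_le _)] at h'
      simp at h'
  have hle (x y : ℕ) (hx : x < N) (hy : y < M) : 1 + x + y * N ≤ Q := by
    have : (y + 1) * N ≤ M * N := Nat.mul_le_mul_right _ hy
    rw [hM, mul_comm N M]
    rw [Nat.add_mul] at this
    omega
  have hdvd (x y : ℕ) (hx : x < N) : N ∣ 1 + x + y * N ↔ x + 1 = N := by
    rw [Nat.dvd_add_left (Dvd.intro_left _ rfl)]
    constructor
    · intro h
      have := Nat.le_of_dvd (by omega) h
      omega
    · intro h
      rw [show 1 + x = N by omega]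
  refine ⟨N, M, hN2, hM2, by rw [hn, hM], ?_, ?_, ?_⟩
  · intro x y j hx hy hj
    have hb := hle (x + 1) y hx hy
    have h := A.relH_block hn (b := 1 + x + y * N) (by omega) hj
    have e : 1 + x + y * N + 1 = 1 + (x + 1) + y * N := by ring
    have h1 := (h.2.2.2.2.2 ?_).2.2
    · refine ⟨?_, ?_, ?_, ?_, fun hxx => ?_⟩
      · rw [e] at h1; exact h1.1
      · rw [e] at h1; exact h1.2.1
      · rw [e] at h1; exact h1.2.2.1
      · rw [e] at h1; exact h1.2.2.2.1
      · have h2 := h1.2.2.2.2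
        rw [e] at h2
        refine h2 (hxx.imp (fun hx0 => ?_) fun hx2 => ?_)
        · subst hx0
          have := hleft (y * N) j (by omega) hj (Dvd.intro_left _ rfl)
          rwa [show y * N + 1 = 1 + 0 + y * N by ring] at this
        · exact (hrt' _ j (by omega) hb hj).2 ((hdvd (x + 1) y hx).2 (by omega))
    · rw [← Bool.not_eq_true, hrt' _ j (by omega) (by omega) hj, hdvd x y (by omega)]
      omega
  · intro x y j hx hy hj
    have hb := hle x (y + 1) hx hy
    have e : 1 + x + y * N + N = 1 + x + (y + 1) * N := by ring
    have h := hrelV (1 + x + y * N) j (by rw [e]; exact hb) hj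
    have h1 := h.2 (A.body _ (length_lt_index (by omega)) (index_lt hn (by omega) hj))
    rw [e] at h1
    refine ⟨h1.1, h1.2.1, h1.2.2.1, h1.2.2.2.1, fun hyy => h1.2.2.2.2 (hyy.imp ?_ ?_)⟩
    · rintro rfl
      exact hbottom _ j (by omega) (by omega) hj
    · intro hy2
      refine htop _ j ?_ hb hj
      have : M * N = (y + 1) * N + N := by rw [← hy2]; ring
      rw [hM, mul_comm N M]
      omega
  · intro x y j hx hy hj
    have hb := hle x y hx hy
    refine ⟨?_, ?_, ?_, ?_⟩
    · rintro rfl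
      have := hleft (y * N) j (by omega) hj (Dvd.intro_left _ rfl)
      rwa [show y * N + 1 = 1 + 0 + y * N by ring] at this
    · intro hx1
      exact (hrt' _ j (by omega) hb hj).2 ((hdvd x y hx).2 hx1)
    · rintro rfl
      exact hbottom _ j (by omega) (by omega) hj
    · intro hy1
      refine htop _ j ?_ hb hj
      have : M * N = y * N + N := by rw [← hy1]; ring
      rw [hM, mul_comm N M]
      omega

end Accepted

/-! ### The formula, its value and its agents in an accepted word -/

theorem foldFrom_eq_foldr {R : Type} (f : ℕ → R → R) (r : R) {k e n : ℕ} (hk : k ≤ e) (he : e ≤ n) :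
    foldFrom f r n k = (List.range' k (e - k)).foldr f (foldFrom f r n e) := by
  unfold foldFrom
  rw [← List.foldr_append]
  congr 1
  have := @List.range'_append k (e - k) (n - e) 1
  rw [one_mul, show k + (e - k) = e by omega, show e - k + (n - e) = n - k by omega] at this
  exact this.symm

variable {cap : ℕ} {free : Bool}

namespace Accepted

variable {w : List Symbol} {g : ℕ → Letter} {n : ℕ} (A : Accepted cap free w g n)

include A

theorem reads_block_end {Q b : ℕ} (hn : n = (Q + 1) * (w.length + 1)) (hb : 1 ≤ b) (hbQ : b ≤ Q) :
    (reads cap free g n (b * (w.length + 1) + w.length)).1.start = false ∧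
    (reads cap free g n (b * (w.length + 1) + w.length)).1.pend = none ∧
    (reads cap free g n (b * (w.length + 1) + w.length)).2 = [] := by
  set e := b * (w.length + 1) + w.length with he
  have hen : e < n := index_lt hn hbQ le_rfl
  have hwe : w.length < e := length_lt_index hb
  have hs : (g e).sym = none := by rw [he, A.sym_block b _ le_rfl hen]; simp
  have hh := A.body e hwe hen
  obtain ⟨h1, h2, -, -, -, h3⟩ := Reader.pda_end_eq (x := reads cap free g n (e + 1))
    (free := free) hh hs
  have hok := A.ok_reads e hen.le
  rw [reads_step hen] at hok ⊢
  refine ⟨h1, h2, h3.trans ?_⟩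
  rcases Nat.lt_or_ge (e + 1) n with hlt | hge
  · have hst := (A.reads_state (e + 1) (by omega) hlt).1
    obtain ⟨-, -, -, b', hb'⟩ := (Reader.pda_end_block hh hs hst).1 hok
    rw [hb']; rfl
  · rw [show e + 1 = n by omega, reads_end]; rfl

/-- A block is judged by the letter to its left: the end of the previous block or, for block 1, the
delimiter. -/
theorem reads_block_start {Q b : ℕ} (hn : n = (Q + 1) * (w.length + 1)) (hb : 1 ≤ b)
    (hbQ : b ≤ Q) : (reads cap free g n (b * (w.length + 1))).1.pend = none ∧
      ∃ c, (reads cap free g n (b * (w.length + 1))).2 = [c] := by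
  obtain ⟨b, rfl⟩ : ∃ b', b = b' + 1 := ⟨b - 1, by omega⟩
  have hlt := index_lt hn hbQ (Nat.zero_le _)
  have e : (b + 1) * (w.length + 1) = b * (w.length + 1) + w.length + 1 := by ring
  have hlt' := index_lt (b := b) hn (by omega) (le_refl w.length)
  have hs := A.sym_block b w.length le_rfl hlt'
  rw [List.getElem?_eq_none le_rfl] at hs
  have hok := A.ok_reads _ hlt'.le
  rw [reads_step hlt'] at hok
  rw [e]
  rcases Nat.eq_zero_or_pos b with rfl | hb0
  · have hh : (g (0 * (w.length + 1) + w.length)).hdr = true := by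
      rw [Nat.zero_mul, zero_add, A.delim]; rfl
    exact ((Reader.pda_end_header hh hs).1.1 hok).2.2
  · have hh := A.body _ (length_lt_index hb0) hlt'
    have hst := (A.reads_state (b * (w.length + 1) + w.length + 1)
      (by omega) (by omega)).1
    exact ((Reader.pda_end_block hh hs hst).1 hok).2.2

theorem spells_block {Q b j : ℕ} (hn : n = (Q + 1) * (w.length + 1)) (hbQ : b ≤ Q)
    {l : List Symbol} (h : Spells (fun j => w[j]?) j l) :
    Spells (fun k => (g k).sym) (b * (w.length + 1) + j) l := by
  rw [spells_iff] at h ⊢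
  intro t ht
  have h1 := h t ht
  have hj : j + t < w.length := (List.getElem?_eq_some_iff.1 h1).1
  rw [add_assoc, A.sym_block b (j + t) hj.le (index_lt hn hbQ hj.le), h1]

/-- Parsing block 1 produces φ with word w. All blocks spell the same word, so `reads_word` applies
to each of them with this φ. -/
theorem exists_formula {Q : ℕ} (hQ : 1 ≤ Q) (hn : n = (Q + 1) * (w.length + 1)) :
    ∃ φ : Formula ℕ, φ.word = w ∧ φ.All (Allowed cap free) ∧
      (∀ b, 1 ≤ b → b ≤ Q → Annotated g φ (b * (w.length + 1)) ∧
        (reads cap free g n (b * (w.length + 1))).2 = [(g (b * (w.length + 1))).bit]) := by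
  have hφ : ∃ φ : Formula ℕ, φ.word = w := by
    obtain ⟨h1, h2, h3⟩ := A.reads_block_end hn le_rfl hQ
    obtain ⟨h4, c, h5⟩ := A.reads_block_start hn le_rfl hQ
    rw [one_mul] at *
    have hlt := index_lt hn hQ (le_refl w.length)
    rw [one_mul] at hlt
    have hf : reads cap free g n (w.length + 1) =
        ((List.range' (w.length + 1) w.length).map g).foldr (fun a x => Reader.pda free x a)
          (reads cap free g n (w.length + 1 + w.length)) := by
      rw [List.foldr_map]
      have := foldFrom_eq_foldr (fun k x => Reader.pda free x (g k))
        ((⟨true, none, true, true, true, false⟩ : Reader cap), []) (Nat.le_add_right (w.length + 1) w.length)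
        hlt.le
      rw [Nat.add_sub_cancel_left] at this
      exact this
    have hsym (k : ℕ) (hk : k < w.length) : (g (w.length + 1 + k)).sym = some w[k] := by
      have := A.sym_block 1 k hk.le (by omega)
      rw [one_mul] at this
      rw [this, List.getElem?_eq_getElem hk]
    have hok := A.ok_reads (w.length + 1) (by omega)
    rw [hf] at hok h4 h5
    obtain ⟨l, m, e1, e2, e3⟩ := exists_parse _ _ (by
      intro a ha
      obtain ⟨k, hk, rfl⟩ := List.mem_map.1 ha
      rw [List.mem_range'_1] at hk
      refine ⟨A.body k (by omega) (by omega), ?_⟩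
      have := hsym (k - (w.length + 1)) (by omega)
      rw [show w.length + 1 + (k - (w.length + 1)) = k by omega] at this
      simp [this]) h2 h3 hok
    rw [h5] at e2
    rw [h4] at e3
    have hm : m = 0 := by
      by_contra hm
      rw [if_neg hm] at e3
      simp at e3
    obtain ⟨φ, rfl⟩ := List.length_eq_one_iff.1 e2.symm
    refine ⟨φ, ?_⟩
    have e4 : ((List.range' (w.length + 1) w.length).map g).map Letter.sym = w.map some := by
      apply List.ext_getElem
      · simp
      · intro k hk hk'
        simp only [List.getElem_map, List.getElem_range', one_mul]
        exact hsym k (by simpa using hk)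
    rw [e4, hm] at e1
    have := List.map_injective_iff.2 (Option.some_injective _) e1
    simpa using this.symm
  obtain ⟨φ, hφ⟩ := hφ
  have key (b : ℕ) (hb : 1 ≤ b) (hbQ : b ≤ Q) : (Annotated g φ (b * (w.length + 1)) ∧
      φ.All (Allowed cap free)) ∧
      (reads cap free g n (b * (w.length + 1))).2 = [(g (b * (w.length + 1))).bit] := by
    obtain ⟨h1, h2, h3⟩ := A.reads_block_end hn hb hbQ
    have hlt := index_lt hn hbQ (le_refl w.length)
    have hle := length_lt_index (w := w) (j := 0) hb
    obtain ⟨-, h4, h5⟩ := reads_word (free := free) (F := reads cap free g n) (g := g) φ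
      (b * (w.length + 1)) (b * (w.length + 1) + w.length) (by rw [hφ])
      (fun k hk hk' => reads_step (by omega))
      (by
        rw [hφ]
        refine A.spells_block (j := 0) hn hbQ (spells_iff.2 fun t ht => ?_)
        rw [zero_add]
        exact List.getElem?_eq_getElem ht)
      (fun k hk hk' => A.body k (by omega) (by omega)) h1 h2
    rw [h3] at h4
    exact ⟨(h5.1 (A.ok_reads _ (by omega))).2.2, h4⟩
  exact ⟨φ, hφ, (key 1 le_rfl hQ).1.2, fun b hb hbQ => ⟨(key b hb hbQ).1.1, (key b hb hbQ).2⟩⟩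

/-- The flag `sat` can only be raised at an end letter that finds true on top of the stack, which is
the bit at the first letter of the block to the right. -/
theorem exists_bit {Q : ℕ} (hQ : 1 ≤ Q) (hn : n = (Q + 1) * (w.length + 1)) :
    ∃ b, 1 ≤ b ∧ b ≤ Q ∧ (g (b * (w.length + 1))).bit = true := by
  obtain ⟨φ, -, -, hφ⟩ := A.exists_formula hQ hn
  have key (m : ℕ) (hm : m ≤ n) : (reads cap free g n (n - m)).1.sat = true →
      ∃ b, 1 ≤ b ∧ b ≤ Q ∧ (g (b * (w.length + 1))).bit = true := by
    induction m with
    | zero =>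
      rw [Nat.sub_zero, reads_end]
      intro h
      simp at h
    | succ m ih =>
      intro h
      have hk : n - (m + 1) < n := by omega
      rw [reads_step hk] at h
      set k := n - (m + 1) with hkdef
      have hk1 : k + 1 = n - m := by omega
      by_cases hs : (g k).sym = none
      · have h' : (reads cap free g n (k + 1)).1.sat = true ∨
            (reads cap free g n (k + 1)).2.head? = some true := by
          by_cases hh : (g k).hdr = true
          · exact (Reader.pda_end_header hh hs).2.1 h
          · exact (Reader.pda_end_eq (by simpa using hh) hs).2.2.2.2.1.1 h
        rcases h' with h' | h'
        · exact ih (by omega) (by rwa [← hk1])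
        · have hd := Nat.div_add_mod' k (w.length + 1)
          have hm' := Nat.mod_lt k (Nat.succ_pos w.length)
          generalize k / (w.length + 1) = b at hd
          generalize k % (w.length + 1) = j at hd hm'
          have hs' := A.sym_block b j (by omega) (by omega)
          rw [hd, hs, eq_comm, List.getElem?_eq_none_iff] at hs'
          have hkb : k + 1 = (b + 1) * (w.length + 1) := by rw [Nat.add_mul]; omega
          rcases Nat.lt_or_ge (k + 1) n with hlt | hge
          · have hbQ : b + 1 ≤ Q := by
              by_contra hbQ
              have : (Q + 1) * (w.length + 1) ≤ (b + 1) * (w.length + 1) :=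
                Nat.mul_le_mul_right _ (by omega)
              omega
            rw [hkb, (hφ (b + 1) (by omega) hbQ).2] at h'
            exact ⟨b + 1, by omega, hbQ, by simpa using h'⟩
          · rw [show k + 1 = n by omega, reads_end] at h'
            simp at h'
      · obtain ⟨s, hs⟩ := Option.ne_none_iff_exists'.1 hs
        refine ih (by omega) ?_
        rw [← hk1]
        by_cases hh : (g k).hdr = true
        · rwa [Reader.pda_header hh hs] at h
        · rwa [(Reader.pda_symbol (by simpa using hh) hs).2.2.2.1] at h
  exact key n le_rfl (by rw [Nat.sub_self]; exact A.sat)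

theorem bit_eq_of_same_agent {Q b i j j' : ℕ} (hn : n = (Q + 1) * (w.length + 1)) (hbQ : b ≤ Q)
    (h : Spells (fun j => w[j]?) j (Formula.here i).word)
    (hn1 : NotBit w[j + (Formula.here i).word.length]?)
    (h' : Spells (fun j => w[j]?) j' (Formula.here i).word)
    (hn1' : NotBit w[j' + (Formula.here i).word.length]?) :
    (g (b * (w.length + 1) + j)).bit = (g (b * (w.length + 1) + j')).bit := by
  wlog hjj : j < j' generalizing j j'
  · rcases Nat.lt_or_ge j' j with hlt | hge
    · exact (this h' hn1' h hn1 hlt).symm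
    · rw [show j = j' by omega]
  have hlen (j : ℕ) (h : Spells (fun j => w[j]?) j (Formula.here i).word) :
      j + (Formula.here i).word.length ≤ w.length := by
    have hpos := (Formula.here i).word_length_pos
    have h1 := spells_iff.1 h ((Formula.here i).word.length - 1) (by omega)
    have := (List.getElem?_eq_some_iff.1 h1).1
    omega
  have h1 := hlen j h
  have h2 := hlen j' h'
  have hpos := (Formula.here i).word_length_pos
  have hle := index_lt hn hbQ h2
  have hle1 := index_lt hn hbQ h1
  set B := b * (w.length + 1)
  have hwn := A.le
  have hD : j' - j < n := by omega
  -- The distance of two occurrences in a word is at most its length, so the letter at position D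
  -- belongs to block 0 and the agent test is in force.
  have hA := (A.scan (j' - j) hD.le).1 (g (j' - j)) (scans_last hD) (by
    obtain ⟨s, hs⟩ := A.header_letter (j' - j) (by omega)
    rw [hs]; rfl)
  have hg := A.spells_block hn hbQ h
  have hg' := A.spells_block hn hbQ h'
  have hs := A.sym_block b _ h1 hle1
  have hs' := A.sym_block b _ h2 hle
  simp only [Formula.word, Spells, List.length_cons, List.length_map] at hg hg' hn1 hn1' hs hs' hle
  have := (scans_okA hD.le).1 hA (B + j) (by omega) hg.1
    (by rw [show B + j + (j' - j) = B + j' by omega]; exact hg'.1)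
    (by
      rw [show B + j + (j' - j) = B + j' by omega, A.par_block b j (by omega) (by omega),
        A.par_block b j' (by omega) (by omega)])
    ((scans_same (Nat.bits i) (Nat.bits i) (B + j + 1) (by omega) hg.2
      (by rw [show B + j + 1 + (j' - j) = B + j' + 1 by omega]; exact hg'.2)
      (by
        rw [show B + j + 1 + (Nat.bits i).length = B + (j + ((Nat.bits i).length + 1)) by omega, hs]
        exact hn1)
      (by
        rw [show B + j + 1 + (j' - j) + (Nat.bits i).length =
          B + (j' + ((Nat.bits i).length + 1)) by omega, hs']
        exact hn1')).2 rfl)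
  rwa [show B + j + (j' - j) = B + j' by omega] at this

/-- By induction `seen` says that an earlier cell was true. Uniqueness holds because `seen` and a
true bit exclude each other, existence because the corner must have seen one. -/
theorem existsUnique_here {Q j : ℕ} (hn : n = (Q + 1) * (w.length + 1))
    (hj : w[j]? = some .here) (hQ : 1 ≤ Q) (hr : (g (Q * (w.length + 1) + j)).right = true)
    (ht : (g (Q * (w.length + 1) + j)).top = true) :
    ∃ b, 1 ≤ b ∧ b ≤ Q ∧ ∀ b', 1 ≤ b' → b' ≤ Q →
      ((g (b' * (w.length + 1) + j)).bit = true ↔ b' = b) := by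
  have hjw : j < w.length := (List.getElem?_eq_some_iff.1 hj).1
  have hsym (b : ℕ) (hb : b ≤ Q) : (g (b * (w.length + 1) + j)).sym = some .here := by
    rw [A.sym_block b j hjw.le (index_lt hn hb hjw.le), hj]
  have hR (b : ℕ) (hb : b < Q) := (A.relH_block hn hb hjw.le).2.2.1 (hsym b hb.le)
  obtain ⟨s, hs⟩ := A.header_letter j hjw.le
  have hseen (b : ℕ) (hb : b ≤ Q) : (g (b * (w.length + 1) + j)).seen = true ↔
      ∃ b', 1 ≤ b' ∧ b' < b ∧ (g (b' * (w.length + 1) + j)).bit = true := by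
    induction b with
    | zero =>
      rw [Nat.zero_mul, zero_add, hs]
      simp [headerLetter]
    | succ b ih =>
      rw [(hR b hb).1, Bool.or_eq_true, ih (by omega)]
      constructor
      · rintro (⟨b', h1, h2, h3⟩ | h)
        · exact ⟨b', h1, by omega, h3⟩
        · refine ⟨b, ?_, by omega, h⟩
          by_contra hb0
          obtain rfl : b = 0 := by omega
          rw [Nat.zero_mul, zero_add, hs] at h
          simp [headerLetter] at h
      · rintro ⟨b', h1, h2, h3⟩
        rcases (show b' < b ∨ b' = b by omega) with h | rfl
        exacts [Or.inl ⟨b', h1, h, h3⟩, Or.inr h3]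
  have hlt (b b' : ℕ) (h1 : 1 ≤ b) (h2 : b < b') (h3 : b' ≤ Q)
      (hb : (g (b * (w.length + 1) + j)).bit = true) :
      (g (b' * (w.length + 1) + j)).bit = false := by
    have h4 := (hseen b' h3).2 ⟨b, h1, h2, hb⟩
    have h5 := (hR (b' - 1) (by omega)).2
    rw [show b' - 1 + 1 = b' by omega, h4, Bool.true_and] at h5
    exact h5
  have hB := A.border _ (length_lt_index hQ) (index_lt hn le_rfl hjw.le)
  obtain ⟨b, h1, h2, h3⟩ := (hseen Q le_rfl).1 (hB.2.2.2.2.2.1 hr ht (hsym Q le_rfl))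
  refine ⟨b, h1, h2.le, fun b' h1' h2' => ⟨fun h => ?_, fun h => h ▸ h3⟩⟩
  by_contra hne
  rcases Nat.lt_or_gt_of_ne hne with h4 | h4
  · rw [hlt b' b h1' h4 h2.le h] at h3
    simp at h3
  · rw [hlt b b' h1 h4 h2' h3] at h
    simp at h

end Accepted

/-! ### Soundness of the verifier -/

variable {cap : ℕ} {free : Bool}

namespace Accepted

variable {w : List Symbol} {g : ℕ → Letter} {n : ℕ} (A : Accepted cap free w g n)

include A

/-- Every point of the plane takes the block of the nearest cell, and each agent stands where its
`here` is true. The chain lemmas turn adjacency and the border conditions into the clauses for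
boxes. -/
theorem mem_satWords : w ∈ satWords cap free := by
  obtain ⟨N, M, hN, hM, hn, hH, hV, hE⟩ := A.exists_grid
  have hQ : 1 ≤ N * M := by nlinarith
  obtain ⟨φ, hφw, hφA, hφ⟩ := A.exists_formula hQ hn
  obtain ⟨b₀, hb1, hb2, hb3⟩ := A.exists_bit hQ hn
  have hblock (x y : ℕ) (hx : x < N) (hy : y < M) :
      1 ≤ 1 + x + y * N ∧ 1 + x + y * N ≤ N * M := by
    have : (y + 1) * N ≤ M * N := Nat.mul_le_mul_right _ hy
    rw [mul_comm N M]
    rw [Nat.add_mul] at this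
    omega
  have hcell (b : ℕ) (h1 : 1 ≤ b) (h2 : b ≤ N * M) :
      ∃ x y, x < N ∧ y < M ∧ b = 1 + x + y * N := by
    refine ⟨(b - 1) % N, (b - 1) / N, Nat.mod_lt _ (by omega), ?_, ?_⟩
    · rw [Nat.div_lt_iff_lt_mul (by omega), mul_comm M N]
      omega
    · have := Nat.div_add_mod' (b - 1) N
      omega
  have hnear (x : ℕ) {K : ℕ} (hx : x < K) : nearest K (x : ℤ) = x := by
    unfold nearest; omega
  let L : ℤ × ℤ → ℕ → Letter := fun v j =>
    g (cellIndex w N (nearest N v.1) (nearest M v.2) j)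
  have hLb (v : ℤ × ℤ) := hblock _ _ (nearest_lt hN v.1) (nearest_lt hM v.2)
  have hLsym (x y j : ℕ) (hx : x < N) (hy : y < M) (hj : j ≤ w.length) :
      (g (cellIndex w N x y j)).sym = w[j]? :=
    A.sym_block _ j hj (index_lt hn (hblock x y hx hy).2 hj)
  have hLborder (x y j : ℕ) (hx : x < N) (hy : y < M) (hj : j ≤ w.length) :
      (g (cellIndex w N x y j)).Border :=
    A.border _ (length_lt_index (hblock x y hx hy).1) (index_lt hn (hblock x y hx hy).2 hj)
  have hhere (j : ℕ) (hj : w[j]? = some .here) : ∃ p, ∀ v, (L v j).bit = true ↔ v = p := by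
    have hjw : j < w.length := (List.getElem?_eq_some_iff.1 hj).1
    have hc := hE (N - 1) (M - 1) j (by omega) (by omega) hjw.le
    have hlast : 1 + (N - 1) + (M - 1) * N = N * M := by
      obtain ⟨M, rfl⟩ : ∃ M', M = M' + 1 := ⟨M - 1, by omega⟩
      rw [Nat.mul_add, Nat.add_sub_cancel, mul_comm M N]
      omega
    unfold cellIndex at hc
    rw [hlast] at hc
    obtain ⟨b, h1, h2, h3⟩ := A.existsUnique_here hn hj hQ (hc.2.1 (by omega)) (hc.2.2.2 (by omega))
    obtain ⟨x, y, hx, hy, rfl⟩ := hcell b h1 h2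
    refine ⟨(x, y), fun v => ?_⟩
    have h4 := h3 _ (hLb v).1 (hLb v).2
    constructor
    · intro hv
      have h5 := h4.1 hv
      have hx' := nearest_lt hN v.1
      have hy' := nearest_lt hM v.2
      have h6 : nearest N v.1 = x ∧ nearest M v.2 = y := by
        have e1 : nearest N v.1 + nearest M v.2 * N = x + y * N := by omega
        have e2 := congrArg (· % N) e1
        have e3 := congrArg (· / N) e1
        simp only [Nat.add_mul_mod_self_right, Nat.mod_eq_of_lt hx, Nat.mod_eq_of_lt hx'] at e2
        simp only [Nat.add_mul_div_right _ _ (show 0 < N by omega), Nat.div_eq_of_lt hx,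
          Nat.div_eq_of_lt hx'] at e3
        omega
      have h7 := (hLborder _ _ j hx' hy' hjw.le).1
      have h8 := hE _ _ j hx' hy' hjw.le
      -- Border cells have false bits at `here`, so the true cell is interior; the only point
      -- clamped to an interior cell is the cell itself.
      have h9 : ¬ (nearest N v.1 = 0 ∨ nearest N v.1 + 1 = N ∨ nearest M v.2 = 0 ∨
          nearest M v.2 + 1 = M) := by
        intro h
        have h10 := h7 (by
          rcases h with h | h | h | h
          · exact Or.inr (Or.inl (h8.1 h))
          · exact Or.inl (h8.2.1 h)
          · exact Or.inr (Or.inr (Or.inr (h8.2.2.1 h)))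
          · exact Or.inr (Or.inr (Or.inl (h8.2.2.2 h)))) (by rw [hLsym _ _ j hx' hy' hjw.le, hj])
        rw [show (L v j).bit = false from h10] at hv
        simp at hv
      unfold nearest at h6 h9
      ext <;> simp only <;> omega
    · rintro rfl
      refine h4.2 ?_
      simp only [hnear x hx, hnear y hy]
  have hsame (i j j' : ℕ) (h : Spells (fun j => w[j]?) j (Formula.here i).word)
      (h1 : NotBit w[j + (Formula.here i).word.length]?)
      (h' : Spells (fun j => w[j]?) j' (Formula.here i).word)
      (h1' : NotBit w[j' + (Formula.here i).word.length]?) (v : ℤ × ℤ) :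
      (L v j).bit = (L v j').bit :=
    A.bit_eq_of_same_agent hn (hLb v).2 h h1 h' h1'
  classical
  let occurs : ℕ → ℕ → Prop := fun i j => Spells (fun j => w[j]?) j (Formula.here i).word ∧
    NotBit w[j + (Formula.here i).word.length]?
  have hP (i : ℕ) : ∃ p, ∀ j, occurs i j → ∀ v, (L v j).bit = true ↔ p = v := by
    by_cases hi : ∃ j, occurs i j
    · obtain ⟨j, hj⟩ := hi
      obtain ⟨p, hp⟩ := hhere j hj.1.1
      refine ⟨p, fun j' hj' v => ?_⟩
      rw [hsame i j' j hj'.1 hj'.2 hj.1 hj.2 v, hp v, eq_comm]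
    -- Agents that do not occur may stand anywhere.
    · exact ⟨0, fun j hj => absurd ⟨j, hj⟩ hi⟩
  choose P hP using hP
  have hbox (j : ℕ) (α : Program) (hj : w[j]? = some (.box α)) (v : ℤ × ℤ) :
      (L v j).bit = true ↔ ∀ v', α.Rel v v' → (L v' j).child = true := by
    have hjw : j ≤ w.length := (List.getElem?_eq_some_iff.1 hj).1.le
    have hx' := nearest_lt hN v.1
    have hy' := nearest_lt hM v.2
    have cH := fun x hx => hH x (nearest M v.2) j hx hy' hjw
    have cV := fun y hy => hV (nearest N v.1) y j hx' hy hjw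
    have sH : ∀ x, x < N → (g (cellIndex w N x (nearest M v.2) j)).sym = some (.box α) :=
      fun x hx => (hLsym x _ j hx hy' hjw).trans hj
    have sV : ∀ y, y < M → (g (cellIndex w N (nearest N v.1) y j)).sym = some (.box α) :=
      fun y hy => (hLsym _ y j hx' hy hjw).trans hj
    cases α with
    | move d =>
      cases d with
      | right =>
        rw [forall_rel_right]
        exact Eq.congr_left (chain_move hN cH sH rfl v.1)
      | left =>
        rw [forall_rel_left]
        have := chain_move' hN cH sH rfl (v.1 - 1)
        rw [Int.sub_add_cancel] at this
        exact Eq.congr_left this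
      | up =>
        rw [forall_rel_up]
        exact Eq.congr_left (chain_move hM cV sV rfl v.2)
      | down =>
        rw [forall_rel_down]
        have := chain_move' hM cV sV rfl (v.2 - 1)
        rw [Int.sub_add_cancel] at this
        exact Eq.congr_left this
    | iter d =>
      cases d with
      | right =>
        rw [forall_rel_iter_right]
        refine chain_iter hN cH sH rfl ?_ v.1
        exact (hLborder _ _ j (by omega) hy' hjw).2.1
          ((hE _ _ j (by omega) hy' hjw).2.1 (by omega)) (sH _ (by omega))
      | left =>
        rw [forall_rel_iter_left]
        refine chain_iter' hN cH sH rfl ?_ v.1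
        exact (hLborder _ _ j (by omega) hy' hjw).2.2.1
          ((hE _ _ j (by omega) hy' hjw).1 rfl) (sH _ (by omega))
      | up =>
        rw [forall_rel_iter_up]
        refine chain_iter hM cV sV rfl ?_ v.2
        exact (hLborder _ _ j hx' (by omega) hjw).2.2.2.1
          ((hE _ _ j hx' (by omega) hjw).2.2.2 (by omega)) (sV _ (by omega))
      | down =>
        rw [forall_rel_iter_down]
        refine chain_iter' hM cV sV rfl ?_ v.2
        exact (hLborder _ _ j hx' (by omega) hjw).2.2.2.2.1
          ((hE _ _ j hx' (by omega) hjw).2.2.1 rfl) (sV _ (by omega))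
  have hspell : Spells (fun j => w[j]?) 0 φ.word := by
    rw [hφw, spells_iff]
    intro t ht
    rw [zero_add]
    exact List.getElem?_eq_getElem ht
  obtain ⟨x₀, y₀, hx₀, hy₀, rfl⟩ := hcell b₀ hb1 hb2
  refine ⟨φ, hφA, hφw, P, (x₀, y₀), ?_⟩
  refine (holds_iff_bit (σ := fun j => w[j]?) (L := L) hbox
    (fun i j h h' v => hP i j ⟨h, h'⟩ v) φ 0 hspell ?_ (fun v => ?_) (x₀, y₀)).1 ?_
  · rw [zero_add, hφw]
    simp [NotBit]
  · exact annotated_add.1 (hφ _ (hLb v).1 (hLb v).2).1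
  · simp only [L, hnear x₀ hx₀, hnear y₀ hy₀]
    exact hb3

end Accepted

theorem satVerifier_decode_hdr (a : Letter) (l : List Bool) :
    ∀ b ∈ ((satVerifier cap free).decode a l : List Letter), Letter.hdr b = false := by
  induction l generalizing a with
  | nil => intro b hb; simp [ShiftVerifier.decode] at hb
  | cons x l ih =>
    cases x
    · intro b hb
      rcases List.mem_cons.1 hb with rfl | hb
      exacts [rfl, ih _ b hb]
    · exact ih _

/-- The verifier accepts only satisfiable formulas. -/
theorem mem_satWords_of_verify {w : List Symbol} {c : List Bool}
    (h : (satVerifier cap free).verify (w, c) = true) : w ∈ satWords cap free := by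
  obtain ⟨t, ht⟩ : ∃ t : List Letter, (satVerifier cap free).decode (headerLetter none) c = t :=
    ⟨_, rfl⟩
  have hdec : ∀ b ∈ t, b.hdr = false := by
    rw [← ht]
    exact satVerifier_decode_hdr _ _
  set s : List Letter := (w.map fun x => headerLetter (some x)) ++ headerLetter none :: t with hs
  have hword : (satVerifier cap free).word w c = s := by
    rw [hs, ← ht]; rfl
  set g : ℕ → Letter := fun k => s.getD k (headerLetter none) with hg
  have hsg : s = (List.range s.length).map g := by
    apply List.ext_getElem
    · simp
    · intro k h1 h2
      simp [hg, h1]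
  have hacc : (satVerifier cap free).accepts ((List.range s.length).map g).reverse = true := by
    rw [← hsg, ← hword]; exact h
  rw [satVerifier_accepts_iff] at hacc
  refine Accepted.mem_satWords (g := g) (n := s.length) (cap := cap) (free := free)
    { le := ?_, header := ?_, delim := ?_, body := ?_, ok := hacc.1.1, sat := hacc.1.2,
      scan := hacc.2 }
  · simp [hs]
  · intro k hk
    simp only [hg, hs, List.getD_eq_getElem?_getD]
    rw [List.getElem?_append_left (by simpa using hk)]
    simp [hk]
  · simp only [hg, hs, List.getD_eq_getElem?_getD]
    rw [List.getElem?_append_right (by simp)]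
    simp
  · intro k hk hkn
    obtain ⟨m, rfl⟩ : ∃ m, k = w.length + 1 + m := ⟨k - (w.length + 1), by omega⟩
    have hm : m < t.length := by
      simp [hs] at hkn
      omega
    have : g (w.length + 1 + m) = t[m] := by
      simp only [hg, hs, List.getD_eq_getElem?_getD]
      rw [List.getElem?_append_right (by simp; omega)]
      simp only [List.length_map, show w.length + 1 + m - w.length = m + 1 by omega,
        List.getElem?_cons_succ]
      rw [List.getElem?_eq_getElem hm]
      rfl
    rw [this]
    exact hdec _ (List.getElem_mem hm)

/-! ### Models of polynomial size -/

/-- Truncation of an integer to an interval around zero. -/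
def truncate (k z : ℤ) : ℤ := max (-k) (min k z)

/-- Two integers have the same position, up to the precision `k`, relative to two families of
integers. -/
def SamePlace (s : Finset ℕ) (a a' : ℕ → ℤ) (k x x' : ℤ) : Prop :=
  ∀ i ∈ s, truncate k (x - a i) = truncate k (x' - a' i)

/-- Two families of integers have the same gaps, up to the precision `2 * k + 2`. -/
def SameGaps (s : Finset ℕ) (a a' : ℕ → ℤ) (k : ℤ) : Prop :=
  ∀ i ∈ s, SamePlace s a a' (2 * k + 2) (a i) (a' i)

section places

variable {s : Finset ℕ} {a a' : ℕ → ℤ} {k x x' : ℤ}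

theorem SamePlace.symm (h : SamePlace s a a' k x x') : SamePlace s a' a k x' x :=
  fun i hi => (h i hi).symm

theorem SamePlace.neg (h : SamePlace s a a' k x x') : SamePlace s (-a) (-a') k (-x) (-x') := by
  intro i hi
  have := h i hi
  simp only [truncate, Pi.neg_apply] at this ⊢
  omega

theorem SameGaps.symm (h : SameGaps s a a' k) : SameGaps s a' a k :=
  fun i hi => (h i hi).symm

theorem SameGaps.neg (h : SameGaps s a a' k) : SameGaps s (-a) (-a') k :=
  fun i hi => (h i hi).neg

theorem SamePlace.mono {m : ℤ} (hm : m ≤ k) (h : SamePlace s a a' k x x') :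
    SamePlace s a a' m x x' := by
  intro i hi
  have := h i hi
  simp only [truncate] at this ⊢
  omega

theorem SameGaps.mono {m : ℤ} (hm : m ≤ k) (h : SameGaps s a a' k) : SameGaps s a a' m :=
  fun i hi => (h i hi).mono (by omega)

theorem SamePlace.add_one (h : SamePlace s a a' (k + 1) x x') :
    SamePlace s a a' k (x + 1) (x' + 1) := by
  intro i hi
  have := h i hi
  simp only [truncate] at this ⊢
  omega

theorem SamePlace.sub_one (h : SamePlace s a a' (k + 1) x x') :
    SamePlace s a a' k (x - 1) (x' - 1) := by
  intro i hi
  have := h i hi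
  simp only [truncate] at this ⊢
  omega

/-- The maximum of x and the selected values, in a form that records where it is attained. -/
theorem exists_max_of_finset (s : Finset ℕ) (c : ℕ → ℤ) (p : ℕ → Prop) (x : ℤ) :
    ∃ z, x ≤ z ∧ (∀ i ∈ s, p i → c i ≤ z) ∧ (z = x ∨ ∃ i ∈ s, p i ∧ z = c i) := by
  induction s using Finset.induction_on with
  | empty => exact ⟨x, le_rfl, by simp, Or.inl rfl⟩
  | insert j s _ ih =>
    obtain ⟨z, h1, h2, h3⟩ := ih
    by_cases hj : p j ∧ z < c j
    · refine ⟨c j, by omega, ?_, Or.inr ⟨j, Finset.mem_insert_self _ _, hj.1, rfl⟩⟩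
      intro i hi hp
      rcases Finset.mem_insert.1 hi with rfl | hi
      · exact le_rfl
      · exact (h2 i hi hp).trans hj.2.le
    · refine ⟨z, h1, ?_, h3.imp_right fun ⟨i, hi, h⟩ => ⟨i, Finset.mem_insert_of_mem hi, h⟩⟩
      intro i hi hp
      rcases Finset.mem_insert.1 hi with rfl | hi
      · exact not_lt.1 fun h => hj ⟨hp, h⟩
      · exact h2 i hi hp

/-- If z is within k of an agent, it moves along with that agent. Otherwise the answer is the least
point that is at least x' and beyond distance k to the right of all agents left of z. An agent on
the left and one on the right of z are at least 2k + 2 apart, which the precision of `SameGaps`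
preserves, so this point is also far from the agents on the right. The extra unit of precision for x
keeps the answer on the correct side of x'. -/
theorem SamePlace.exists_ge (hk : 0 ≤ k) (hg : SameGaps s a a' k)
    (h : SamePlace s a a' (k + 1) x x') {z : ℤ} (hz : x ≤ z) :
    ∃ z', x' ≤ z' ∧ SamePlace s a a' k z z' := by
  by_cases hn : ∃ i ∈ s, -k ≤ z - a i ∧ z - a i ≤ k
  · obtain ⟨i, hi, h1, h2⟩ := hn
    refine ⟨a' i + (z - a i), ?_, fun j hj => ?_⟩
    · have := h i hi
      simp only [truncate] at this
      omega
    · have := hg i hi j hj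
      simp only [truncate] at this ⊢
      omega
  · push Not at hn
    obtain ⟨z', h1, h2, h3⟩ := exists_max_of_finset s (fun i => a' i + k + 1) (fun i => a i < z) x'
    refine ⟨z', h1, fun j hj => ?_⟩
    have hj1 := hn j hj
    have hj2 := h2 j hj
    rcases lt_or_ge (a j) z with hjz | hjz
    · have := hj2 hjz
      simp only [truncate]
      omega
    · have hj3 := h j hj
      rcases h3 with rfl | ⟨i, hi, hiz, rfl⟩
      · simp only [truncate] at hj3 ⊢
        omega
      · have hi1 := hn i hi
        have hi2 := hg i hi j hj
        simp only [truncate] at hj3 hi2 ⊢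
        omega

theorem SamePlace.exists_le (hk : 0 ≤ k) (hg : SameGaps s a a' k)
    (h : SamePlace s a a' (k + 1) x x') {z : ℤ} (hz : z ≤ x) :
    ∃ z', z' ≤ x' ∧ SamePlace s a a' k z z' := by
  obtain ⟨z', h1, h2⟩ := h.neg.exists_ge hk hg.neg (neg_le_neg hz)
  refine ⟨-z', by omega, ?_⟩
  simpa using h2.neg

end places

/-- Back and forth: each box uses up one unit of precision and one symbol of the word, and at `here`
at least one unit is left, enough to tell whether the distance is zero. -/
theorem Formula.holds_iff_of_samePlace {s : Finset ℕ} {P P' : PositionModel ℕ} (φ : Formula ℕ)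
    (hs : φ.All (· ∈ s)) {k : ℤ} (hφ : (φ.word.length : ℤ) ≤ k)
    (hg : SameGaps s (fun i => (P i).1) (fun i => (P' i).1) k)
    (hg' : SameGaps s (fun i => (P i).2) (fun i => (P' i).2) k) {v v' : ℤ × ℤ}
    (h : SamePlace s (fun i => (P i).1) (fun i => (P' i).1) k v.1 v'.1)
    (h' : SamePlace s (fun i => (P i).2) (fun i => (P' i).2) k v.2 v'.2) :
    φ.Holds P v ↔ φ.Holds P' v' := by
  induction φ generalizing k v v' with
  | here i =>
    have h1 := h i hs
    have h2 := h' i hs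
    simp only [word, List.length_cons, List.length_map] at hφ
    simp only [Holds, Prod.ext_iff]
    simp only [truncate] at h1 h2
    omega
  | neg φ ih =>
    simp only [word, List.length_cons] at hφ
    exact not_congr (ih hs (by omega) hg hg' h h')
  | and φ ψ ih ih' =>
    simp only [word, List.length_cons, List.length_append] at hφ
    exact and_congr (ih hs.1 (by omega) hg hg' h h') (ih' hs.2 (by omega) hg hg' h h')
  | box α φ ih =>
    obtain ⟨k, rfl⟩ : ∃ m, k = m + 1 := ⟨k - 1, by omega⟩
    simp only [word, List.length_cons] at hφ
    have hk : 0 ≤ k := by omega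
    have ih {v v' : ℤ × ℤ} (h1 : SamePlace s _ _ k v.1 v'.1) (h2 : SamePlace s _ _ k v.2 v'.2) :
        φ.Holds P v ↔ φ.Holds P' v' :=
      ih hs (k := k) (by omega) (hg.mono (by omega)) (hg'.mono (by omega)) h1 h2
    replace hg := hg.mono (m := k) (by omega)
    replace hg' := hg'.mono (m := k) (by omega)
    have hm := h.mono (m := k) (by omega)
    have hm' := h'.mono (m := k) (by omega)
    rcases α with (_ | _ | _ | _) | (_ | _ | _ | _)
    · simp only [Holds, forall_rel_up]
      exact ih hm h'.add_one
    · simp only [Holds, forall_rel_down]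
      exact ih hm h'.sub_one
    · simp only [Holds, forall_rel_right]
      exact ih h.add_one hm'
    · simp only [Holds, forall_rel_left]
      exact ih h.sub_one hm'
    · simp only [Holds, forall_rel_iter_up]
      constructor
      · intro H z hz
        obtain ⟨z', h1, h2⟩ := h'.symm.exists_ge hk hg'.symm hz
        exact (ih (v := (v.1, z')) (v' := (v'.1, z)) hm h2.symm).1 (H z' h1)
      · intro H z hz
        obtain ⟨z', h1, h2⟩ := h'.exists_ge hk hg' hz
        exact (ih (v := (v.1, z)) (v' := (v'.1, z')) hm h2).2 (H z' h1)
    · simp only [Holds, forall_rel_iter_down]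
      constructor
      · intro H z hz
        obtain ⟨z', h1, h2⟩ := h'.symm.exists_le hk hg'.symm hz
        exact (ih (v := (v.1, z')) (v' := (v'.1, z)) hm h2.symm).1 (H z' h1)
      · intro H z hz
        obtain ⟨z', h1, h2⟩ := h'.exists_le hk hg' hz
        exact (ih (v := (v.1, z)) (v' := (v'.1, z')) hm h2).2 (H z' h1)
    · simp only [Holds, forall_rel_iter_right]
      constructor
      · intro H z hz
        obtain ⟨z', h1, h2⟩ := h.symm.exists_ge hk hg.symm hz
        exact (ih (v := (z', v.2)) (v' := (z, v'.2)) h2.symm hm').1 (H z' h1)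
      · intro H z hz
        obtain ⟨z', h1, h2⟩ := h.exists_ge hk hg hz
        exact (ih (v := (z, v.2)) (v' := (z', v'.2)) h2 hm').2 (H z' h1)
    · simp only [Holds, forall_rel_iter_left]
      constructor
      · intro H z hz
        obtain ⟨z', h1, h2⟩ := h.symm.exists_le hk hg.symm hz
        exact (ih (v := (z', v.2)) (v' := (z, v'.2)) h2.symm hm').1 (H z' h1)
      · intro H z hz
        obtain ⟨z', h1, h2⟩ := h.exists_le hk hg hz
        exact (ih (v := (z, v.2)) (v' := (z', v'.2)) h2 hm').2 (H z' h1)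

/-- The integers close to a family of integers. -/
noncomputable def nearby (s : Finset ℕ) (a : ℕ → ℤ) (k : ℤ) : Finset ℤ :=
  s.biUnion fun i => Finset.Ico (a i - k) (a i + k)

/-- The compression of the integers which keeps only the integers close to a given family. -/
noncomputable def compress (s : Finset ℕ) (a : ℕ → ℤ) (k x : ℤ) : ℤ := ((nearby s a k).filter (· < x)).card

/-! ### Compression of an axis -/

section compress

variable {s : Finset ℕ} {a : ℕ → ℤ} {k : ℤ}

theorem card_nearby_le (hk : 0 ≤ k) : ((nearby s a k).card : ℤ) ≤ s.card * (2 * k) := by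
  have h : (nearby s a k).card ≤ s.card * (2 * k).toNat := by
    refine Finset.card_biUnion_le_card_mul _ _ _ fun i _ => ?_
    rw [Int.card_Ico]
    omega
  calc ((nearby s a k).card : ℤ) ≤ (s.card * (2 * k).toNat : ℕ) := by exact_mod_cast h
    _ = s.card * (2 * k) := by rw [Nat.cast_mul, Int.toNat_of_nonneg (by omega)]

theorem compress_sub {x y : ℤ} (h : x ≤ y) : compress s a k y - compress s a k x =
    ((nearby s a k).filter fun t => x ≤ t ∧ t < y).card := by
  have : ((nearby s a k).filter (· < y)).card = ((nearby s a k).filter (· < x)).card +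
      ((nearby s a k).filter fun t => x ≤ t ∧ t < y).card := by
    rw [← Finset.card_union_of_disjoint]
    · congr 1
      ext t
      simp only [Finset.mem_filter, Finset.mem_union]
      constructor
      · rintro ⟨h1, h2⟩
        rcases lt_or_ge t x with h3 | h3
        exacts [Or.inl ⟨h1, h3⟩, Or.inr ⟨h1, h3, h2⟩]
      · rintro (⟨h1, h2⟩ | ⟨h1, h2⟩)
        exacts [⟨h1, by omega⟩, ⟨h1, h2.2⟩]
    · rw [Finset.disjoint_left]
      intro t h1 h2
      have := (Finset.mem_filter.1 h1).2
      have := (Finset.mem_filter.1 h2).2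
      omega
  unfold compress
  rw [this]
  push_cast
  ring

theorem compress_mono {x y : ℤ} (h : x ≤ y) : compress s a k x ≤ compress s a k y := by
  have := compress_sub (s := s) (a := a) (k := k) h
  omega

theorem compress_sub_eq {x y : ℤ} (h : x ≤ y) (hn : ∀ t, x ≤ t → t < y → t ∈ nearby s a k) :
    compress s a k y - compress s a k x = y - x := by
  rw [compress_sub h]
  have : (nearby s a k).filter (fun t => x ≤ t ∧ t < y) = Finset.Ico x y := by
    ext t
    rw [Finset.mem_filter, Finset.mem_Ico]
    exact ⟨fun ht => ht.2, fun ht => ⟨hn t ht.1 ht.2, ht⟩⟩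
  rw [this, Int.card_Ico]
  omega

theorem mem_nearby {i : ℕ} (hi : i ∈ s) {t : ℤ} (h : a i - k ≤ t) (h' : t < a i + k) :
    t ∈ nearby s a k :=
  Finset.mem_biUnion.2 ⟨i, hi, Finset.mem_Ico.2 ⟨h, h'⟩⟩

/-- Next to an agent all integers are kept, so short distances are exact; long ones still contain a
full run of k kept integers. -/
theorem samePlace_compress (hk : 0 ≤ k) (x : ℤ) :
    SamePlace s a (fun i => compress s a k (a i)) k x (compress s a k x) := by
  intro i hi
  simp only [truncate]
  rcases le_total (a i) x with h | h
  · rcases le_total x (a i + k) with h' | h'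
    · have := compress_sub_eq (s := s) (a := a) (k := k) h fun t h1 h2 =>
        mem_nearby hi (by omega) (by omega)
      omega
    · have := compress_sub_eq (s := s) (a := a) (k := k) (x := a i) (y := a i + k) (by omega)
        fun t h1 h2 => mem_nearby hi (by omega) (by omega)
      have := compress_mono (s := s) (a := a) (k := k) h'
      omega
  · rcases le_total (a i - k) x with h' | h'
    · have := compress_sub_eq (s := s) (a := a) (k := k) h fun t h1 h2 =>
        mem_nearby hi (by omega) (by omega)
      omega
    · have := compress_sub_eq (s := s) (a := a) (k := k) (x := a i - k) (y := a i) (by omega)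
        fun t h1 h2 => mem_nearby hi (by omega) (by omega)
      have := compress_mono (s := s) (a := a) (k := k) h'
      omega

/-- With radius k + 1, the intervals around two agents at distance at most 2k + 2 cover the whole
gap; a longer gap keeps k + 1 integers from each side. -/
theorem sameGaps_compress (hk : 0 ≤ k) :
    SameGaps s a (fun i => compress s a (k + 1) (a i)) k := by
  have key (i j : ℕ) (hi : i ∈ s) (hj : j ∈ s) (h : a j ≤ a i) :
      (a i - a j ≤ 2 * k + 2 →
        compress s a (k + 1) (a i) - compress s a (k + 1) (a j) = a i - a j) ∧
      (2 * k + 2 ≤ a i - a j →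
        2 * k + 2 ≤ compress s a (k + 1) (a i) - compress s a (k + 1) (a j)) := by
    constructor
    · intro h'
      refine compress_sub_eq h fun t h1 h2 => ?_
      rcases lt_or_ge t (a j + (k + 1)) with h3 | h3
      exacts [mem_nearby hj (by omega) h3, mem_nearby hi (by omega) (by omega)]
    · intro h'
      have h1 := compress_sub_eq (s := s) (a := a) (k := k + 1) (x := a j) (y := a j + (k + 1))
        (by omega) fun t h1 h2 => mem_nearby hj (by omega) h2
      have h2 := compress_sub_eq (s := s) (a := a) (k := k + 1) (x := a i - (k + 1)) (y := a i)
        (by omega) fun t h1 h2 => mem_nearby hi h1 (by omega)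
      have h3 := compress_mono (s := s) (a := a) (k := k + 1) (x := a j + (k + 1))
        (y := a i - (k + 1)) (by omega)
      omega
  intro i hi j hj
  simp only [truncate]
  rcases le_total (a j) (a i) with h | h
  · have := key i j hi hj h
    omega
  · have := key j i hj hi h
    omega

theorem compress_nonneg (x : ℤ) : 0 ≤ compress s a k x := Int.natCast_nonneg _

theorem compress_le (hk : 0 ≤ k) (x : ℤ) : compress s a k x ≤ s.card * (2 * k) :=
  (Int.ofNat_le.2 (Finset.card_filter_le _ _)).trans (card_nearby_le hk)

/-- The k integers kept to the left of an agent become the margin between the border and its new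
position. -/
theorem le_compress {i : ℕ} (hk : 0 ≤ k) (hi : i ∈ s) : k ≤ compress s a k (a i) := by
  have := compress_sub_eq (s := s) (a := a) (k := k) (x := a i - k) (y := a i) (by omega)
    fun t h1 h2 => mem_nearby hi (by omega) (by omega)
  have := compress_nonneg (s := s) (a := a) (k := k) (a i - k)
  omega

theorem compress_le_sub {i : ℕ} (hk : 0 ≤ k) (hi : i ∈ s) :
    compress s a k (a i) ≤ s.card * (2 * k) - k := by
  have := compress_sub_eq (s := s) (a := a) (k := k) (x := a i) (y := a i + k) (by omega)
    fun t h1 h2 => mem_nearby hi (by omega) (by omega)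
  have := compress_le (s := s) (a := a) hk (a i + k)
  omega

end compress

/-- The agents of a formula. -/
def Formula.agents : Formula ℕ → Finset ℕ
  | .here i => {i}
  | .neg φ => φ.agents
  | .and φ ψ => φ.agents ∪ ψ.agents
  | .box _ φ => φ.agents

theorem Formula.all_agents (φ : Formula ℕ) : φ.All (· ∈ φ.agents) := by
  induction φ with
  | here i => exact Finset.mem_singleton_self i
  | neg φ ih => exact ih
  | and φ ψ ih ih' =>
    exact ⟨ih.mono fun i hi => Finset.mem_union_left _ hi,
      ih'.mono fun i hi => Finset.mem_union_right _ hi⟩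
  | box α φ ih => exact ih

theorem Formula.card_agents_le (φ : Formula ℕ) : φ.agents.card ≤ φ.word.length := by
  induction φ with
  | here i => simp [agents, word]
  | neg φ ih => exact ih.trans (Nat.le_succ _)
  | and φ ψ ih ih' =>
    refine (Finset.card_union_le _ _).trans ?_
    simp only [word, List.length_cons, List.length_append]
    omega
  | box α φ ih => exact ih.trans (Nat.le_succ _)

theorem Formula.agents_nonempty (φ : Formula ℕ) : φ.agents.Nonempty := by
  induction φ with
  | here i => exact Finset.singleton_nonempty i
  | neg φ ih => exact ih
  | and φ ψ ih ih' => exact ih.mono Finset.subset_union_left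
  | box α φ ih => exact ih

/-- The side of a square that contains a small model of a formula whose word has length `m`. -/
def side (m : ℕ) : ℕ := m * (2 * (m + 1)) + 2

/-- All agents are well inside a square with the side `N`. -/
def Inside (P : PositionModel ℕ) (m N : ℕ) : Prop :=
  ∀ i, ((m : ℤ) + 1 ≤ (P i).1 ∧ (P i).1 + m + 2 ≤ N) ∧
    ((m : ℤ) + 1 ≤ (P i).2 ∧ (P i).2 + m + 2 ≤ N)

theorem Formula.exists_small_model {φ : Formula ℕ} {P : PositionModel ℕ} {v : ℤ × ℤ}
    (h : φ.Holds P v) : ∃ (P' : PositionModel ℕ) (v' : ℤ × ℤ), φ.Holds P' v' ∧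
      (0 ≤ v'.1 ∧ v'.1 + 2 ≤ side φ.word.length) ∧ (0 ≤ v'.2 ∧ v'.2 + 2 ≤ side φ.word.length) ∧
      Inside P' φ.word.length (side φ.word.length) := by
  classical
  obtain ⟨i₀, hi₀⟩ := φ.agents_nonempty
  have hall := φ.all_agents
  have hcard := φ.card_agents_le
  generalize φ.agents = s at *
  obtain ⟨m, hm⟩ : ∃ m : ℤ, m = φ.word.length := ⟨_, rfl⟩
  have hm0 : 0 ≤ m := by omega
  -- At most m agents occur, and each keeps 2(m + 1) integers.
  have hside : (s.card : ℤ) * (2 * (m + 1)) + 2 ≤ side φ.word.length := by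
    have : (s.card : ℤ) * (2 * (m + 1)) ≤ m * (2 * (m + 1)) :=
      mul_le_mul_of_nonneg_right (by omega) (by omega)
    simp only [side]
    push_cast
    rw [← hm]
    omega
  -- Agents outside the formula join the agent `i₀`, since `Inside` speaks of all agents.
  let r : ℕ → ℕ := fun i => if i ∈ s then i else i₀
  have hr (i : ℕ) : r i ∈ s := by
    by_cases hi : i ∈ s <;> simp only [r, hi, if_true, if_false, hi₀]
  have hrs (i : ℕ) (hi : i ∈ s) : r i = i := if_pos hi
  let P' : PositionModel ℕ := fun i => (compress s (fun i => (P i).1) (m + 1) (P (r i)).1,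
    compress s (fun i => (P i).2) (m + 1) (P (r i)).2)
  have cong (a : ℕ → ℤ) (g : ℤ → ℤ) (k x x' : ℤ) (H : SamePlace s a (fun i => g (a i)) k x x') :
      SamePlace s a (fun i => g (a (r i))) k x x' := by
    intro i hi
    simpa only [hrs i hi] using H i hi
  refine ⟨P', (compress s (fun i => (P i).1) (m + 1) v.1,
    compress s (fun i => (P i).2) (m + 1) v.2), ?_, ⟨compress_nonneg _, ?_⟩, ⟨compress_nonneg _, ?_⟩, fun i =>
    ⟨⟨?_, ?_⟩, ?_, ?_⟩⟩
  · refine (φ.holds_iff_of_samePlace (s := s) hall (k := m) hm.ge ?_ ?_ ?_ ?_).1 h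
    · intro i hi
      have := cong _ _ _ _ _ (sameGaps_compress (s := s) (a := fun i => (P i).1) hm0 i hi)
      simpa only [P', hrs i hi] using this
    · intro i hi
      have := cong _ _ _ _ _ (sameGaps_compress (s := s) (a := fun i => (P i).2) hm0 i hi)
      simpa only [P', hrs i hi] using this
    · exact cong _ _ _ _ _ ((samePlace_compress (k := m + 1) (by omega) v.1).mono (by omega))
    · exact cong _ _ _ _ _ ((samePlace_compress (k := m + 1) (by omega) v.2).mono (by omega))
  · have := compress_le (s := s) (a := fun i => (P i).1) (k := m + 1) (by omega) v.1
    simp only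
    omega
  · have := compress_le (s := s) (a := fun i => (P i).2) (k := m + 1) (by omega) v.2
    simp only
    omega
  · rw [← hm]
    exact le_compress (a := fun i => (P i).1) (by omega) (hr i)
  · have := compress_le_sub (a := fun i => (P i).1) (k := m + 1) (by omega) (hr i)
    simp only [P']
    omega
  · rw [← hm]
    exact le_compress (a := fun i => (P i).2) (by omega) (hr i)
  · have := compress_le_sub (a := fun i => (P i).2) (k := m + 1) (by omega) (hr i)
    simp only [P']
    omega

/-- Points with coordinate at most 1 are at distance at least m from every agent, on the same side,
and so are those with coordinate at least N - 2. Truncation at m does not distinguish them. -/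
theorem Formula.holds_iff_of_inside {P : PositionModel ℕ} {m N : ℕ} (hP : Inside P m N)
    {φ : Formula ℕ} (hφ : φ.word.length ≤ m) {v v' : ℤ × ℤ}
    (h : v.1 = v'.1 ∨ v.1 ≤ 1 ∧ v'.1 ≤ 1 ∨ (N : ℤ) ≤ v.1 + 2 ∧ (N : ℤ) ≤ v'.1 + 2)
    (h' : v.2 = v'.2 ∨ v.2 ≤ 1 ∧ v'.2 ≤ 1 ∨ (N : ℤ) ≤ v.2 + 2 ∧ (N : ℤ) ≤ v'.2 + 2) :
    φ.Holds P v ↔ φ.Holds P v' := by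
  refine φ.holds_iff_of_samePlace (s := φ.agents) φ.all_agents (k := m) (by exact_mod_cast hφ)
    (fun _ _ _ _ => rfl) (fun _ _ _ _ => rfl) (fun i _ => ?_) (fun i _ => ?_)
  · have := hP i
    simp only [truncate]
    omega
  · have := hP i
    simp only [truncate]
    omega

/-! ### Subformulas by position -/

/-- The subformula that starts at a position of the word of a formula. -/
def Formula.sub : Formula ℕ → ℕ → Option (Formula ℕ)
  | φ, 0 => some φ
  | .here _, _ + 1 => none
  | .neg φ, j + 1 => φ.sub j
  | .and φ ψ, j + 1 => if j < φ.word.length then φ.sub j else ψ.sub (j - φ.word.length)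
  | .box _ φ, j + 1 => φ.sub j

theorem Formula.sub_zero (φ : Formula ℕ) : φ.sub 0 = some φ := by
  cases φ <;> simp [sub]

theorem Formula.word_length_le_of_sub {φ ψ : Formula ℕ} {j : ℕ} (h : φ.sub j = some ψ) :
    ψ.word.length ≤ φ.word.length := by
  induction φ generalizing j with
  | here i =>
    cases j with
    | zero => rw [sub_zero] at h; cases h; rfl
    | succ j => simp [sub] at h
  | neg φ ih =>
    cases j with
    | zero => rw [sub_zero] at h; cases h; rfl
    | succ j => exact (ih (by simpa [sub] using h)).trans (Nat.le_succ _)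
  | and φ φ' ih ih' =>
    cases j with
    | zero => rw [sub_zero] at h; cases h; rfl
    | succ j =>
      simp only [sub] at h
      simp only [word, List.length_cons, List.length_append]
      split at h
      · have := ih h
        omega
      · have := ih' h
        omega
  | box α φ ih =>
    cases j with
    | zero => rw [sub_zero] at h; cases h; rfl
    | succ j => exact (ih (by simpa [sub] using h)).trans (Nat.le_succ _)

/-- At every position of the word of a formula that does not hold a digit, a subformula starts. -/
theorem Formula.exists_sub {σ : ℕ → Option Symbol} (φ : Formula ℕ) (j : ℕ)
    (hs : Spells σ j φ.word) (hn : NotBit (σ (j + φ.word.length))) (t : ℕ)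
    (ht : t < φ.word.length) (hb : NotBit (σ (j + t))) :
    ∃ ψ : Formula ℕ, Spells σ (j + t) ψ.word ∧ NotBit (σ (j + t + ψ.word.length)) ∧
      t + ψ.word.length ≤ φ.word.length ∧ ∀ r < ψ.word.length, φ.sub (t + r) = ψ.sub r := by
  induction φ generalizing j t with
  | here i =>
    cases t with
    | zero => exact ⟨_, hs, hn, by rw [zero_add], fun r _ => by rw [zero_add]⟩
    | succ t =>
      simp only [word, List.length_cons] at ht
      have := spells_iff.1 hs.2 t (by omega)
      rw [show j + 1 + t = j + (t + 1) by omega] at this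
      exact absurd (this.trans (by rw [List.getElem_map])) (hb _)
  | neg φ ih =>
    cases t with
    | zero => exact ⟨_, hs, hn, by rw [zero_add], fun r _ => by rw [zero_add]⟩
    | succ t =>
      simp only [word, List.length_cons] at ht hn
      have e : j + (t + 1) = j + 1 + t := by omega
      rw [e] at hb ⊢
      obtain ⟨ψ, h1, h2, hl, h3⟩ := ih (j + 1) hs.2
        (by rwa [show j + 1 + φ.word.length = j + (φ.word.length + 1) by omega]) t (by omega) hb
      refine ⟨ψ, h1, h2, by simp only [word, List.length_cons]; omega, fun r hr => ?_⟩
      rw [← h3 r hr, show t + 1 + r = t + r + 1 by omega, sub]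
  | box α φ ih =>
    cases t with
    | zero => exact ⟨_, hs, hn, by rw [zero_add], fun r _ => by rw [zero_add]⟩
    | succ t =>
      simp only [word, List.length_cons] at ht hn
      have e : j + (t + 1) = j + 1 + t := by omega
      rw [e] at hb ⊢
      obtain ⟨ψ, h1, h2, hl, h3⟩ := ih (j + 1) hs.2
        (by rwa [show j + 1 + φ.word.length = j + (φ.word.length + 1) by omega]) t (by omega) hb
      refine ⟨ψ, h1, h2, by simp only [word, List.length_cons]; omega, fun r hr => ?_⟩
      rw [← h3 r hr, show t + 1 + r = t + r + 1 by omega, sub]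
  | and φ φ' ih ih' =>
    cases t with
    | zero => exact ⟨_, hs, hn, by rw [zero_add], fun r _ => by rw [zero_add]⟩
    | succ t =>
      simp only [word, List.length_cons, List.length_append] at ht hn
      obtain ⟨hs1, hs2⟩ := spells_append.1 hs.2
      rcases lt_or_ge t φ.word.length with htl | htl
      · have e : j + (t + 1) = j + 1 + t := by omega
        rw [e] at hb ⊢
        obtain ⟨ψ, h1, h2, hl, h3⟩ := ih (j + 1) hs1 (NotBit.of_spells_word hs2) t htl hb
        refine ⟨ψ, h1, h2, by simp only [word, List.length_cons, List.length_append]; omega,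
          fun r hr => ?_⟩
        rw [← h3 r hr, show t + 1 + r = t + r + 1 by omega, sub, if_pos (by omega)]
      · obtain ⟨t, rfl⟩ := Nat.exists_eq_add_of_le htl
        have e : j + (φ.word.length + t + 1) = j + 1 + φ.word.length + t := by omega
        rw [e] at hb ⊢
        obtain ⟨ψ, h1, h2, hl, h3⟩ := ih' (j + 1 + φ.word.length) hs2 (by
          rwa [show j + 1 + φ.word.length + φ'.word.length =
            j + (φ.word.length + φ'.word.length + 1) by omega]) t (by omega) hb
        refine ⟨ψ, h1, h2, by simp only [word, List.length_cons, List.length_append]; omega,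
          fun r hr => ?_⟩
        rw [← h3 r hr, show φ.word.length + t + 1 + r = φ.word.length + (t + r) + 1 by omega, sub,
          if_neg (by omega), Nat.add_sub_cancel_left]

open Classical in
/-- The truth value of the subformula at a position. -/
noncomputable def Formula.truth (φ : Formula ℕ) (P : PositionModel ℕ) (v : ℤ × ℤ) (j : ℕ) : Bool :=
  (φ.sub j).elim false fun ψ => decide (ψ.Holds P v)

section truth

variable {φ : Formula ℕ} {P : PositionModel ℕ} {v : ℤ × ℤ} {j : ℕ}

theorem Formula.truth_eq_true_iff {ψ : Formula ℕ} (h : φ.sub j = some ψ) :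
    φ.truth P v j = true ↔ ψ.Holds P v := by
  simp [truth, h]

theorem Formula.truth_congr {ψ : Formula ℕ} {r : ℕ} (h : φ.sub j = ψ.sub r) :
    φ.truth P v j = ψ.truth P v r := by
  rw [truth, h, truth]

theorem Formula.truth_zero : φ.truth P v 0 = true ↔ φ.Holds P v :=
  truth_eq_true_iff φ.sub_zero

theorem spells_getElem? (l : List Symbol) : Spells (fun j => l[j]?) 0 l :=
  spells_iff.2 fun t ht => by simp [ht]

theorem Formula.exists_sub_word (h : j < φ.word.length) (hb : NotBit φ.word[j]?) :
    ∃ ψ : Formula ℕ, Spells (fun j => φ.word[j]?) j ψ.word ∧ NotBit φ.word[j + ψ.word.length]? ∧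
      j + ψ.word.length ≤ φ.word.length ∧ ∀ r < ψ.word.length, φ.sub (j + r) = ψ.sub r := by
  have := φ.exists_sub (σ := fun j => φ.word[j]?) 0 (spells_getElem? _)
    (fun d => by simp) j h (by simpa using hb)
  simpa using this

theorem Formula.truth_box {α : Program} (h : φ.word[j]? = some (.box α)) :
    φ.truth P v j = true ↔ ∀ v', α.Rel v v' → φ.truth P v' (j + 1) = true := by
  obtain ⟨hj, -⟩ := List.getElem?_eq_some_iff.1 h
  obtain ⟨ψ, h1, -, h2, h3⟩ := φ.exists_sub_word hj (by rw [h]; intro d; simp)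
  cases ψ with
  | box β ψ =>
    have e : β = α := by
      have := h.symm.trans h1.1
      simpa using this.symm
    subst e
    rw [truth_congr (j := j) (r := 0) (h3 0 (word_length_pos _)), truth_zero, Holds]
    refine forall_congr' fun v' => imp_congr_right fun _ => ?_
    rw [truth_congr (ψ := ψ) (r := 0) (h3 1 (by simp [word, ψ.word_length_pos])), truth_zero]
  | _ => exact absurd (h.symm.trans h1.1) (by simp)

/-- The index i is fixed before P and v are chosen, as it depends only on the word. -/
theorem Formula.truth_here (h : φ.word[j]? = some .here) :
    ∃ i : ℕ, Spells (fun j => φ.word[j]?) (j + 1) ((Nat.bits i).map Symbol.bit) ∧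
      NotBit φ.word[j + 1 + (Nat.bits i).length]? ∧ j + 1 + (Nat.bits i).length ≤ φ.word.length ∧
      ∀ P v, φ.truth P v j = true ↔ P i = v := by
  obtain ⟨hj, -⟩ := List.getElem?_eq_some_iff.1 h
  obtain ⟨ψ, h1, h4, h2, h3⟩ := φ.exists_sub_word hj (by rw [h]; intro d; simp)
  cases ψ with
  | here i =>
    simp only [word, List.length_cons, List.length_map] at h2 h4
    refine ⟨i, h1.2, ?_, by omega, fun P v => ?_⟩
    · rwa [show j + 1 + (Nat.bits i).length = j + ((Nat.bits i).length + 1) by omega]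
    · rw [truth_congr (j := j) (r := 0) (h3 0 (word_length_pos _)), truth_zero, Holds]
  | _ => exact absurd (h.symm.trans h1.1) (by simp)

theorem Formula.truth_eq_of_inside {m N : ℕ} (hP : Inside P m N) (hφ : φ.word.length ≤ m)
    {v' : ℤ × ℤ}
    (h : v.1 = v'.1 ∨ v.1 ≤ 1 ∧ v'.1 ≤ 1 ∨ (N : ℤ) ≤ v.1 + 2 ∧ (N : ℤ) ≤ v'.1 + 2)
    (h' : v.2 = v'.2 ∨ v.2 ≤ 1 ∧ v'.2 ≤ 1 ∨ (N : ℤ) ≤ v.2 + 2 ∧ (N : ℤ) ≤ v'.2 + 2) :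
    φ.truth P v j = φ.truth P v' j := by
  unfold truth
  rcases hs : φ.sub j with _ | ψ
  · rfl
  · simp only [Option.elim_some, decide_eq_decide]
    exact Formula.holds_iff_of_inside hP ((word_length_le_of_sub hs).trans hφ) h h'

theorem Formula.annotated_of_truth {g : ℕ → Letter} (φ : Formula ℕ) (j : ℕ)
    (h : ∀ t < φ.word.length, (g (j + t)).bit = φ.truth P v t)
    (h' : ∀ t < φ.word.length, (g (j + t)).child = (g (j + t + 1)).bit) : Annotated g φ j := by
  induction φ generalizing j with
  | here i => trivial
  | neg φ ih =>
    simp only [word, List.length_cons] at h h'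
    have h0 := φ.word_length_pos
    have H (t : ℕ) (ht : t < φ.word.length) : (g (j + 1 + t)).bit = φ.truth P v t := by
      rw [add_assoc, add_comm 1, h (t + 1) (by omega)]
      exact truth_congr (by rw [sub])
    refine ⟨?_, ih (j + 1) H fun t ht => ?_⟩
    · have e := h 0 (by omega)
      have e' := H 0 h0
      rw [add_zero] at e e'
      rw [e, e', Bool.eq_iff_iff, truth_zero, Holds, ← truth_zero]
      simp
    · rw [add_assoc j, add_comm 1]
      exact h' (t + 1) (by omega)
  | and φ ψ ih ih' =>
    simp only [word, List.length_cons, List.length_append] at h h'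
    have h0 := φ.word_length_pos
    have h1 := ψ.word_length_pos
    have H (t : ℕ) (ht : t < φ.word.length) : (g (j + 1 + t)).bit = φ.truth P v t := by
      rw [add_assoc, add_comm 1, h (t + 1) (by omega)]
      exact truth_congr (by rw [sub, if_pos ht])
    have H' (t : ℕ) (ht : t < ψ.word.length) :
        (g (j + 1 + φ.word.length + t)).bit = ψ.truth P v t := by
      rw [show j + 1 + φ.word.length + t = j + (φ.word.length + t + 1) by omega, h _ (by omega)]
      exact truth_congr (by rw [sub, if_neg (by omega), Nat.add_sub_cancel_left])
    refine ⟨?_, ih (j + 1) H fun t ht => ?_, ih' _ H' fun t ht => ?_⟩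
    · have e := h 0 (by omega)
      have e1 := H 0 h0
      have e2 := H' 0 h1
      rw [add_zero] at e e1 e2
      rw [e, e1, e2, Bool.eq_iff_iff, Bool.and_eq_true, truth_zero, truth_zero, truth_zero, Holds]
    · rw [add_assoc j, add_comm 1]
      exact h' (t + 1) (by omega)
    · rw [show j + 1 + φ.word.length + t = j + (φ.word.length + t + 1) by omega]
      exact h' _ (by omega)
  | box α φ ih =>
    simp only [word, List.length_cons] at h h'
    have h0 := φ.word_length_pos
    have H (t : ℕ) (ht : t < φ.word.length) : (g (j + 1 + t)).bit = φ.truth P v t := by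
      rw [add_assoc, add_comm 1, h (t + 1) (by omega)]
      exact truth_congr (by rw [sub])
    refine ⟨h' 0 (by omega), ih (j + 1) H fun t ht => ?_⟩
    rw [add_assoc j, add_comm 1]
    exact h' (t + 1) (by omega)

end truth

/-! ### The certificate of a small model -/

/-- The point of the cell with the number `b`; the cells of the square with side `N` are numbered
by `1, …, N ^ 2`. -/
def cellPoint (N b : ℕ) : ℤ × ℤ := (((b - 1) % N : ℕ), ((b - 1) / N : ℕ))

open Classical in
/-- The letter at the position `j` of the cell with the number `b`. -/
noncomputable def cellLetter (φ : Formula ℕ) (P : PositionModel ℕ) (N b j : ℕ) : Letter where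
  hdr := false
  sym := φ.word[j]?
  bit := φ.truth P (cellPoint N b) j
  child := φ.truth P (cellPoint N b) (j + 1)
  seen := decide (∃ b', 1 ≤ b' ∧ b' < b ∧ φ.truth P (cellPoint N b') j = true)
  par := decide (b % 2 = 1)
  right := decide (N ∣ b)
  left := decide (N ∣ b - 1)
  top := decide ((N - 1) * N < b)
  bottom := decide (b ≤ N)

/-- The letters of the instance and of the certificate. -/
noncomputable def modelLetter (φ : Formula ℕ) (P : PositionModel ℕ) (N k : ℕ) : Letter :=
  if k < φ.word.length + 1 then headerLetter φ.word[k]?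
  else cellLetter φ P N (k / (φ.word.length + 1)) (k % (φ.word.length + 1))

section cells

variable {φ : Formula ℕ} {P : PositionModel ℕ} {N m b j : ℕ}

theorem cellPoint_add (hN : 0 < N) (hb : 1 ≤ b) (y : ℕ) :
    cellPoint N (b + y * N) = ((cellPoint N b).1, (cellPoint N b).2 + y) := by
  unfold cellPoint
  rw [show b + y * N - 1 = b - 1 + y * N by omega, Nat.add_mul_mod_self_right,
    Nat.add_mul_div_right _ _ hN]
  push_cast
  rfl

theorem not_dvd_iff (hN : 0 < N) (hb : 1 ≤ b) : ¬ N ∣ b ↔ (b - 1) % N + 1 < N := by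
  have h := Nat.mod_lt (b - 1) hN
  rw [Nat.dvd_iff_mod_eq_zero]
  have e : b % N = ((b - 1) % N + 1) % N := by
    rw [Nat.mod_add_mod, Nat.sub_add_cancel hb]
  rw [e]
  rcases (Nat.succ_le_of_lt h).eq_or_lt with h' | h'
  · rw [← Nat.succ_eq_add_one, h', Nat.mod_self]
    simp
  · rw [Nat.mod_eq_of_lt h']
    omega

theorem cellPoint_succ (hN : 0 < N) (hb : 1 ≤ b) (h : ¬ N ∣ b) :
    cellPoint N (b + 1) = ((cellPoint N b).1 + 1, (cellPoint N b).2) := by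
  rw [not_dvd_iff hN hb] at h
  unfold cellPoint
  have e : b + 1 - 1 = (b - 1) % N + 1 + N * ((b - 1) / N) := by
    have := Nat.mod_add_div (b - 1) N
    omega
  rw [e, Nat.add_mul_mod_self_left, Nat.add_mul_div_left _ _ hN, Nat.mod_eq_of_lt h,
    Nat.div_eq_of_lt h]
  push_cast
  rw [zero_add]

theorem cellPoint_fst_of_dvd (hN : 0 < N) (hb : 1 ≤ b) (h : N ∣ b) :
    (cellPoint N b).1 + 1 = N := by
  have h1 := mt (not_dvd_iff hN hb).2 (not_not.2 h)
  have h2 := Nat.mod_lt (b - 1) hN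
  simp only [cellPoint]
  omega

theorem cellPoint_fst_of_dvd_sub (h : N ∣ b - 1) : (cellPoint N b).1 = 0 := by
  simp [cellPoint, Nat.mod_eq_zero_of_dvd h]

theorem cellPoint_snd_of_le (hN : 0 < N) (h : b ≤ N) : (cellPoint N b).2 = 0 := by
  simp only [cellPoint]
  rw [Nat.div_eq_of_lt (by omega), Nat.cast_zero]

theorem cellPoint_snd_of_lt (h : (N - 1) * N < b) : (N : ℤ) ≤ (cellPoint N b).2 + 1 := by
  have hN : 0 < N ∨ N = 0 := by omega
  rcases hN with hN | rfl
  · have := (Nat.le_div_iff_mul_le hN).2 (show (N - 1) * N ≤ b - 1 by omega)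
    simp only [cellPoint]
    omega
  · simp only [cellPoint]
    omega

/-- The number of the cell of a point. -/
theorem exists_cellPoint {v : ℤ × ℤ} (h : 0 ≤ v.1 ∧ v.1 < N) (h' : 0 ≤ v.2 ∧ v.2 < N) :
    ∃ b, 1 ≤ b ∧ b ≤ N * N ∧ (v.2 + 2 ≤ N → b ≤ (N - 1) * N) ∧ cellPoint N b = v := by
  obtain ⟨x, y⟩ := v
  obtain ⟨x, rfl⟩ := Int.eq_ofNat_of_zero_le h.1
  obtain ⟨y, rfl⟩ := Int.eq_ofNat_of_zero_le h'.1
  simp only at h h'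
  have hx : x < N := by omega
  have hy : y + 1 ≤ N := by omega
  have key (z : ℕ) (hz : y + 1 ≤ z) : x + 1 + y * N ≤ z * N :=
    calc x + 1 + y * N ≤ (y + 1) * N := by rw [Nat.succ_mul]; omega
      _ ≤ z * N := Nat.mul_le_mul_right _ hz
  refine ⟨x + 1 + y * N, by omega, key N hy, fun hy' => key _ (by simp only at hy'; omega), ?_⟩
  rw [cellPoint_add (by omega) (by omega), cellPoint, Nat.add_sub_cancel, Nat.mod_eq_of_lt hx,
    Nat.div_eq_of_lt hx]
  simp

theorem cellPoint_injOn {b' : ℕ} (hb : 1 ≤ b) (hb' : 1 ≤ b')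
    (h : cellPoint N b = cellPoint N b') : b = b' := by
  simp only [cellPoint, Prod.mk.injEq, Nat.cast_inj] at h
  have h1 := Nat.mod_add_div (b - 1) N
  have h2 := Nat.mod_add_div (b' - 1) N
  rw [h.1, h.2] at h1
  omega

theorem truth_iter_right {v : ℤ × ℤ} (h : φ.word[j]? = some (.box (.iter .right))) :
    φ.truth P v j = (φ.truth P v (j + 1) && φ.truth P (v.1 + 1, v.2) j) := by
  rw [Bool.eq_iff_iff, Bool.and_eq_true, Formula.truth_box h, Formula.truth_box h,
    forall_rel_iter_right, forall_rel_iter_right]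
  constructor
  · exact fun H => ⟨H v.1 le_rfl, fun x hx => H x (by simp only at hx; omega)⟩
  · rintro ⟨h1, h2⟩ x hx
    rcases hx.eq_or_lt with rfl | hx
    exacts [h1, h2 x hx]

theorem truth_iter_left {v : ℤ × ℤ} (h : φ.word[j]? = some (.box (.iter .left))) :
    φ.truth P v j = (φ.truth P v (j + 1) && φ.truth P (v.1 - 1, v.2) j) := by
  rw [Bool.eq_iff_iff, Bool.and_eq_true, Formula.truth_box h, Formula.truth_box h,
    forall_rel_iter_left, forall_rel_iter_left]
  constructor
  · exact fun H => ⟨H v.1 le_rfl, fun x hx => H x (by simp only at hx; omega)⟩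
  · rintro ⟨h1, h2⟩ x hx
    rcases hx.eq_or_lt with rfl | hx
    exacts [h1, h2 x (by simp only; omega)]

theorem truth_iter_up {v : ℤ × ℤ} (h : φ.word[j]? = some (.box (.iter .up))) :
    φ.truth P v j = (φ.truth P v (j + 1) && φ.truth P (v.1, v.2 + 1) j) := by
  rw [Bool.eq_iff_iff, Bool.and_eq_true, Formula.truth_box h, Formula.truth_box h,
    forall_rel_iter_up, forall_rel_iter_up]
  constructor
  · exact fun H => ⟨H v.2 le_rfl, fun x hx => H x (by simp only at hx; omega)⟩
  · rintro ⟨h1, h2⟩ x hx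
    rcases hx.eq_or_lt with rfl | hx
    exacts [h1, h2 x hx]

theorem truth_iter_down {v : ℤ × ℤ} (h : φ.word[j]? = some (.box (.iter .down))) :
    φ.truth P v j = (φ.truth P v (j + 1) && φ.truth P (v.1, v.2 - 1) j) := by
  rw [Bool.eq_iff_iff, Bool.and_eq_true, Formula.truth_box h, Formula.truth_box h,
    forall_rel_iter_down, forall_rel_iter_down]
  constructor
  · exact fun H => ⟨H v.2 le_rfl, fun x hx => H x (by simp only at hx; omega)⟩
  · rintro ⟨h1, h2⟩ x hx
    rcases hx.eq_or_lt with rfl | hx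
    exacts [h1, h2 x (by simp only; omega)]

variable (hP : Inside P m N) (hφ : φ.word.length ≤ m)

include hP in
theorem Inside.two_le : 2 ≤ N := by
  have := hP 0
  omega

-- The clauses for boxes are the semantics and its one-step unfolding. The edge clause compares the
-- two outermost columns, which look alike by `Formula.truth_eq_of_inside`.
include hP hφ in
theorem cellLetter_adjacent_right (hb : 1 ≤ b) (h : ¬ N ∣ b) :
    Adjacent .right .left
      ((cellLetter φ P N b j).left = true ∨ (cellLetter φ P N (b + 1) j).right = true)
      (cellLetter φ P N b j) (cellLetter φ P N (b + 1) j) := by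
  have hN := hP.two_le
  have hs := cellPoint_succ (by omega) hb h
  simp only [Adjacent, cellLetter, hs, decide_eq_true_eq]
  refine ⟨fun e => ?_, fun e => ?_, fun e => truth_iter_right e, fun e => ?_, fun e => ?_⟩
  · rw [Bool.eq_iff_iff, Formula.truth_box e, forall_rel_right]
  · rw [Bool.eq_iff_iff, Formula.truth_box e, forall_rel_left, add_sub_cancel_right]
  · rw [truth_iter_left e, add_sub_cancel_right]
  · have h2 := fun h => cellPoint_fst_of_dvd (N := N) (b := b + 1) (by omega) (by omega) h
    rw [hs] at h2
    have hx : (cellPoint N b).1 = (cellPoint N b).1 + 1 ∨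
        (cellPoint N b).1 ≤ 1 ∧ (cellPoint N b).1 + 1 ≤ 1 ∨
        (N : ℤ) ≤ (cellPoint N b).1 + 2 ∧ (N : ℤ) ≤ (cellPoint N b).1 + 1 + 2 := by
      rcases e with e | e
      · have := cellPoint_fst_of_dvd_sub e
        omega
      · have := h2 e
        simp only at this
        omega
    exact ⟨Formula.truth_eq_of_inside hP hφ hx (Or.inl rfl),
      Formula.truth_eq_of_inside hP hφ hx (Or.inl rfl)⟩

include hP hφ in
theorem cellLetter_adjacent_up (hb : 1 ≤ b) :
    Adjacent .up .down
      ((cellLetter φ P N b j).bottom = true ∨ (cellLetter φ P N (b + N) j).top = true)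
      (cellLetter φ P N b j) (cellLetter φ P N (b + N) j) := by
  have hN := hP.two_le
  have hs := cellPoint_add (N := N) (by omega) hb 1
  rw [one_mul, Nat.cast_one] at hs
  simp only [Adjacent, cellLetter, hs, decide_eq_true_eq]
  refine ⟨fun e => ?_, fun e => ?_, fun e => truth_iter_up e, fun e => ?_, fun e => ?_⟩
  · rw [Bool.eq_iff_iff, Formula.truth_box e, forall_rel_up]
  · rw [Bool.eq_iff_iff, Formula.truth_box e, forall_rel_down, add_sub_cancel_right]
  · rw [truth_iter_down e, add_sub_cancel_right]
  · have hx : (cellPoint N b).2 = (cellPoint N b).2 + 1 ∨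
        (cellPoint N b).2 ≤ 1 ∧ (cellPoint N b).2 + 1 ≤ 1 ∨
        (N : ℤ) ≤ (cellPoint N b).2 + 2 ∧ (N : ℤ) ≤ (cellPoint N b).2 + 1 + 2 := by
      rcases e with e | e
      · have := cellPoint_snd_of_le (by omega) e
        omega
      · have := cellPoint_snd_of_lt e
        rw [hs] at this
        simp only at this
        omega
    exact ⟨Formula.truth_eq_of_inside hP hφ (Or.inl rfl) hx,
      Formula.truth_eq_of_inside hP hφ (Or.inl rfl) hx⟩

-- No agent stands on the border, and from a border cell outwards all points look alike, so an
-- iterated box has the value of its body there.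
include hP hφ in
theorem cellLetter_border (hb : 1 ≤ b) : (cellLetter φ P N b j).Border := by
  have hN := hP.two_le
  have hR := fun h => cellPoint_fst_of_dvd (N := N) (b := b) (by omega) hb h
  have hL := fun h => cellPoint_fst_of_dvd_sub (N := N) (b := b) h
  have hB := fun h => cellPoint_snd_of_le (N := N) (b := b) (by omega) h
  have hT := fun h => cellPoint_snd_of_lt (N := N) (b := b) h
  simp only [Letter.Border, cellLetter, decide_eq_true_eq, decide_eq_false_iff_not]
  refine ⟨fun h e => ?_, fun h e => ?_, fun h e => ?_, fun h e => ?_, fun h e => ?_,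
    fun h h' e => ?_, fun h h' => ?_, fun h h' => ?_⟩
  · obtain ⟨i, -, -, -, hi⟩ := Formula.truth_here e
    rw [Bool.eq_false_iff, Ne, hi]
    intro hv
    have := hP i
    rw [hv] at this
    rcases h with h | h | h | h
    · have := hR h
      omega
    · have := hL h
      omega
    · have := hT h
      omega
    · have := hB h
      omega
  · have := hR h
    rw [Bool.eq_iff_iff, Formula.truth_box e, forall_rel_iter_right]
    refine ⟨fun H => H _ le_rfl, fun H x hx => ?_⟩
    rwa [Formula.truth_eq_of_inside hP hφ (v := (x, _)) (v' := cellPoint N b) (Or.inr (Or.inr ?_)) (Or.inl rfl)]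
    simp only
    omega
  · have := hL h
    rw [Bool.eq_iff_iff, Formula.truth_box e, forall_rel_iter_left]
    refine ⟨fun H => H _ le_rfl, fun H x hx => ?_⟩
    rwa [Formula.truth_eq_of_inside hP hφ (v := (x, _)) (v' := cellPoint N b) (Or.inr (Or.inl ?_)) (Or.inl rfl)]
    simp only
    omega
  · have := hT h
    rw [Bool.eq_iff_iff, Formula.truth_box e, forall_rel_iter_up]
    refine ⟨fun H => H _ le_rfl, fun H x hx => ?_⟩
    rwa [Formula.truth_eq_of_inside hP hφ (v := (_, x)) (v' := cellPoint N b) (Or.inl rfl) (Or.inr (Or.inr ?_))]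
    simp only
    omega
  · have := hB h
    rw [Bool.eq_iff_iff, Formula.truth_box e, forall_rel_iter_down]
    refine ⟨fun H => H _ le_rfl, fun H x hx => ?_⟩
    rwa [Formula.truth_eq_of_inside hP hφ (v := (_, x)) (v' := cellPoint N b) (Or.inl rfl) (Or.inr (Or.inl ?_))]
    simp only
    omega
  · obtain ⟨i, -, -, -, hi⟩ := Formula.truth_here e
    have := hP i
    -- The agent stands below the top row, so its cell precedes every cell of that row.
    obtain ⟨b', h1, -, h3, h4⟩ := exists_cellPoint (N := N) (v := P i) (by omega) (by omega)
    exact ⟨b', h1, (h3 (by omega)).trans_lt h', (hi _ _).2 h4.symm⟩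
  · have := hR h'
    have := hL h
    omega
  · have := hT h'
    have := hB h
    omega

include hP in
theorem relH_header {s : Option Symbol} (hs : φ.word[j]? = s) :
    RelH (headerLetter s) (cellLetter φ P N 1 j) := by
  have hN := hP.two_le
  simp only [RelH, headerLetter, cellLetter, hs, decide_eq_true_eq, Bool.not_false]
  refine ⟨trivial, by simp, fun _ => ⟨?_, ?_⟩, by simp, fun _ => by omega, by simp⟩
  · rw [Bool.or_false, decide_eq_false_iff_not]
    rintro ⟨b', h1, h2, -⟩
    omega
  · rw [Bool.and_eq_false_iff]
    left
    rw [decide_eq_false_iff_not]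
    rintro ⟨b', h1, h2, -⟩
    omega

include hP hφ in
theorem relH_cell (hb : 1 ≤ b) : RelH (cellLetter φ P N b j) (cellLetter φ P N (b + 1) j) := by
  have hN := hP.two_le
  refine ⟨rfl, ?_, fun e => ⟨?_, ?_⟩, fun h => ?_, fun h => absurd h (by simp [cellLetter]),
    fun h => ⟨?_, ?_, ?_⟩⟩
  · simp only [cellLetter]
    rw [Bool.eq_iff_iff, Bool.not_eq_true', decide_eq_true_iff, decide_eq_false_iff_not]
    omega
  · simp only [cellLetter]
    rw [Bool.eq_iff_iff, Bool.or_eq_true]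
    simp only [decide_eq_true_iff]
    constructor
    · rintro ⟨b', h1, h2, h3⟩
      rcases (Nat.le_of_lt_succ h2).eq_or_lt with rfl | h2
      exacts [Or.inr h3, Or.inl ⟨b', h1, h2, h3⟩]
    · rintro (⟨b', h1, h2, h3⟩ | h)
      exacts [⟨b', h1, h2.trans b.lt_succ_self, h3⟩, ⟨b, hb, b.lt_succ_self, h⟩]
  · obtain ⟨i, -, -, -, hi⟩ := Formula.truth_here e
    rw [Bool.and_eq_false_iff, or_iff_not_imp_left, Bool.not_eq_false]
    intro h
    simp only [cellLetter, decide_eq_true_iff] at h ⊢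
    obtain ⟨b', h1, h2, h3⟩ := h
    rw [Bool.eq_false_iff]
    intro h4
    have := cellPoint_injOn h1 (by omega) (((hi _ _).1 h3).symm.trans ((hi _ _).1 h4))
    omega
  · simpa [cellLetter] using h
  · simp only [cellLetter, decide_eq_false_iff_not, decide_eq_decide] at h ⊢
    constructor
    · intro h'
      omega
    · intro h'
      rcases (Nat.le_of_lt_succ h').eq_or_lt with e | h'
      · exact absurd ⟨N - 1, by rw [← e, mul_comm]⟩ h
      · exact h'
  · simp only [cellLetter, decide_eq_false_iff_not, decide_eq_decide] at h ⊢
    constructor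
    · intro h'
      rcases h'.eq_or_lt with rfl | h'
      · exact absurd dvd_rfl h
      · exact h'
    · intro h'
      omega
  · refine cellLetter_adjacent_right hP hφ hb ?_
    simpa [cellLetter] using h

include hP hφ in
theorem relV_cell (hb : 1 ≤ b) : RelV (cellLetter φ P N b j) (cellLetter φ P N (b + N) j) :=
  ⟨by simp [cellLetter], fun _ => cellLetter_adjacent_up hP hφ hb⟩

theorem relV_header (s : Option Symbol) : RelV (headerLetter s) (cellLetter φ P N N j) :=
  ⟨by simp [cellLetter, headerLetter], fun h => absurd h (by simp [headerLetter])⟩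

end cells

section certificate

variable {φ : Formula ℕ} {P : PositionModel ℕ} {N m b j k D : ℕ} {cap : ℕ} {free : Bool}

theorem modelLetter_header (h : k < φ.word.length + 1) :
    modelLetter φ P N k = headerLetter φ.word[k]? := if_pos h

theorem modelLetter_cell (hb : 1 ≤ b) (hj : j < φ.word.length + 1) :
    modelLetter φ P N (b * (φ.word.length + 1) + j) = cellLetter φ P N b j := by
  have h0 : 0 < φ.word.length + 1 := by omega
  rw [modelLetter, if_neg, add_comm, Nat.add_mul_div_right _ _ h0, Nat.add_mul_mod_self_right,
    Nat.mod_eq_of_lt hj, Nat.div_eq_of_lt hj, zero_add]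
  have := Nat.le_mul_of_pos_left (φ.word.length + 1) hb
  omega

theorem modelLetter_sym (hj : j < φ.word.length + 1) :
    (modelLetter φ P N (b * (φ.word.length + 1) + j)).sym = φ.word[j]? := by
  rcases Nat.eq_zero_or_pos b with rfl | hb
  · rw [zero_mul, zero_add, modelLetter_header hj]
    rfl
  · rw [modelLetter_cell hb hj]
    rfl

theorem modelLetter_hdr : (modelLetter φ P N k).hdr = true ↔ k < φ.word.length + 1 := by
  unfold modelLetter
  split <;> simp [headerLetter, cellLetter, *]

/-- Every position lies in a block. -/
theorem exists_block (L k : ℕ) : ∃ b j, j < L + 1 ∧ k = b * (L + 1) + j :=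
  ⟨k / (L + 1), k % (L + 1), Nat.mod_lt _ (by omega), by rw [mul_comm, Nat.div_add_mod]⟩

/-! ### The pushdown pass accepts the certificate -/

theorem reads_cell (hP : Inside P m N) (hφ : φ.word.length ≤ m) (hA : φ.All (Allowed cap free))
    (hb : 1 ≤ b) {R : ℕ → Reader cap × List Bool}
    (hR : ∀ k, b * (φ.word.length + 1) ≤ k → k < (b + 1) * (φ.word.length + 1) →
      R k = Reader.pda free (R (k + 1)) (modelLetter φ P N k))
    (hok : (R (b * (φ.word.length + 1) + φ.word.length)).1.ok = true) :
    (R (b * (φ.word.length + 1))).1.ok = true ∧ (R (b * (φ.word.length + 1))).1.start = false ∧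
    (R (b * (φ.word.length + 1))).1.pend = none ∧
    ((R (b * (φ.word.length + 1))).1.sat = true ↔
      (R ((b + 1) * (φ.word.length + 1))).1.sat = true ∨
        (R ((b + 1) * (φ.word.length + 1))).2.head? = some true) ∧
    (R (b * (φ.word.length + 1))).2 = φ.truth P (cellPoint N b) 0 ::
      (R ((b + 1) * (φ.word.length + 1))).2.tail.tail := by
  obtain ⟨L, hL⟩ : ∃ L, φ.word.length = L := ⟨_, rfl⟩
  rw [hL] at hR hok ⊢
  have hn : (b + 1) * (L + 1) = b * (L + 1) + L + 1 := by ring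
  have hG (t : ℕ) (ht : t ≤ L) : modelLetter φ P N (b * (L + 1) + t) = cellLetter φ P N b t := by
    rw [← hL]
    exact modelLetter_cell hb (by omega)
  have he := hR (b * (L + 1) + L) (by omega) (by omega)
  rw [← hn, hG L le_rfl] at he
  have hnone : (cellLetter φ P N b L).sym = none := by simp [cellLetter, hL]
  obtain ⟨h1, h2, h3, h4, h5, h6⟩ := Reader.pda_end_eq (free := free)
    (x := R ((b + 1) * (L + 1))) (a := cellLetter φ P N b L) rfl hnone
  rw [← he] at h1 h2 h3 h4 h5 h6
  have hw := reads_word (cap := cap) (free := free) (F := R) (g := modelLetter φ P N) φ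
    (b * (L + 1)) (b * (L + 1) + L) (by rw [hL]) (fun k hk hk' => hR k hk (by omega))
    (spells_iff.2 fun t ht => by rw [hG t (by omega)]; simp [cellLetter, ht])
    (fun k hk hk' => by
      obtain ⟨t, rfl⟩ := Nat.exists_eq_add_of_le hk
      rw [hG t (by omega)]
      rfl) h1 h2
  obtain ⟨w1, w2, w3⟩ := hw
  refine ⟨w3.2 ⟨hok, fun k hk hk' => ?_, ?_, hA⟩, by rw [w1]; exact h1, by rw [w1]; exact h2,
    by rw [w1]; exact h5, ?_⟩
  · obtain ⟨t, rfl⟩ := Nat.exists_eq_add_of_le hk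
    rw [hG t (by omega), h3, h4]
    exact ⟨cellLetter_border hP hφ hb, rfl, rfl⟩
  · refine φ.annotated_of_truth _ (v := cellPoint N b) (P := P) (fun t ht => ?_) fun t ht => ?_
    · rw [hG t (by omega)]
      rfl
    · rw [hG t (by omega), add_assoc, hG (t + 1) (by omega)]
      rfl
  · rw [w2, h6, ← add_zero (b * (L + 1)), hG 0 (by omega)]
    rfl

/-- Induction from the last block down. Only blocks after b contribute to `sat`, since the value of
block b is inspected later, by the letter to its left. -/
theorem reads_model (hP : Inside P m N) (hφ : φ.word.length ≤ m) (hA : φ.All (Allowed cap free))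
    (hb : 1 ≤ b) (hbN : b ≤ N * N) {x : Reader cap × List Bool}
    (hx : reads cap free (modelLetter φ P N) ((N * N + 1) * (φ.word.length + 1))
      (b * (φ.word.length + 1)) = x) :
    x.1.ok = true ∧ x.1.start = false ∧ x.1.pend = none ∧ x.2 = [φ.truth P (cellPoint N b) 0] ∧
      ∀ b', b < b' → b' ≤ N * N → φ.truth P (cellPoint N b') 0 = true → x.1.sat = true := by
  subst hx
  have hN := hP.two_le
  have hR (b : ℕ) (h : b ≤ N * N) (k : ℕ) (hk : k < (b + 1) * (φ.word.length + 1)) :=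
    reads_step (cap := cap) (free := free) (g := modelLetter φ P N)
      (n := (N * N + 1) * (φ.word.length + 1)) (k := k)
      (hk.trans_le (Nat.mul_le_mul_right _ (by omega)))
  have hend (b : ℕ) : (b + 1) * (φ.word.length + 1) =
    b * (φ.word.length + 1) + φ.word.length + 1 := by ring
  induction hbN using Nat.decreasingInduction with
  | self =>
    have hlast := hR (N * N) le_rfl (N * N * (φ.word.length + 1) + φ.word.length)
      (by rw [hend]; omega)
    rw [← hend, reads_end, modelLetter_cell hb (by omega)] at hlast
    obtain ⟨h1, h2, h3, h4, h5⟩ := reads_cell hP hφ hA hb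
      (fun k _ hk => hR _ le_rfl k hk) (by
        rw [hlast, Reader.pda_end_start rfl (by simp [cellLetter]) rfl]
        refine ⟨rfl, cellLetter_border hP hφ hb, by simp [cellLetter], ?_⟩
        simp only [cellLetter, decide_eq_true_eq]
        exact Nat.mul_lt_mul_of_pos_right (by omega) (by omega))
    refine ⟨h1, h2, h3, ?_, fun b' h h' => by omega⟩
    rw [h5, reads_end]
    rfl
  | of_succ b hbN ih =>
    obtain ⟨i1, i2, i3, i4, i5⟩ := ih (by omega)
    have hlast := hR b (by omega) (b * (φ.word.length + 1) + φ.word.length) (by rw [hend]; omega)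
    rw [← hend, modelLetter_cell hb (by omega)] at hlast
    obtain ⟨h1, h2, h3, h4, h5⟩ := reads_cell hP hφ hA hb
      (fun k _ hk => hR b (by omega) k hk) (by
        rw [hlast, Reader.pda_end_block rfl (by simp [cellLetter]) i2]
        exact ⟨i1, cellLetter_border hP hφ hb, i3, _, i4⟩)
    refine ⟨h1, h2, h3, by rw [h5, i4]; rfl, fun b' hb' hb'N ht => h4.2 ?_⟩
    rcases (Nat.succ_le_of_lt hb').eq_or_lt with rfl | hb'
    · right
      rw [i4, ← ht]
      rfl
    · exact Or.inl (i5 b' hb' hb'N ht)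

theorem reads_model_zero (hP : Inside P m N) (hφ : φ.word.length ≤ m)
    (hA : φ.All (Allowed cap free)) (hb : 1 ≤ b) (hbN : b ≤ N * N)
    (hv : φ.Holds P (cellPoint N b)) {x : Reader cap × List Bool}
    (hx : reads cap free (modelLetter φ P N) ((N * N + 1) * (φ.word.length + 1)) 0 = x) :
    x.1.ok = true ∧ x.1.sat = true := by
  obtain ⟨h1, h2, h3, h4, h5⟩ := reads_model hP hφ hA le_rfl (hb.trans hbN) rfl
  have hle : 1 * (φ.word.length + 1) ≤ (N * N + 1) * (φ.word.length + 1) :=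
    Nat.mul_le_mul_right _ (by omega)
  rw [one_mul] at h1 h2 h3 h4 h5 hle
  rw [← Formula.truth_zero] at hv
  have hd := Reader.pda_end_header (free := free)
    (x := reads cap free (modelLetter φ P N) ((N * N + 1) * (φ.word.length + 1))
      (φ.word.length + 1)) (a := headerLetter φ.word[φ.word.length]?) rfl (by simp [headerLetter])
  have hs := reads_step (cap := cap) (free := free) (g := modelLetter φ P N)
    (n := (N * N + 1) * (φ.word.length + 1)) (k := φ.word.length) (by omega)
  rw [modelLetter_header (by omega)] at hs
  rw [← hs] at hd
  have key (j : ℕ) (hj : j ≤ φ.word.length) :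
      reads cap free (modelLetter φ P N) ((N * N + 1) * (φ.word.length + 1)) j =
      reads cap free (modelLetter φ P N) ((N * N + 1) * (φ.word.length + 1)) φ.word.length := by
    induction hj using Nat.decreasingInduction with
    | self => rfl
    | of_succ j hj ih =>
      rw [reads_step (by omega), ih, modelLetter_header (by omega)]
      exact Reader.pda_header rfl (List.getElem?_eq_getElem hj)
  rw [key 0 (Nat.zero_le _)] at hx
  subst hx
  refine ⟨hd.1.2 ⟨h1, h2, h3, _, h4⟩, hd.2.2 ?_⟩
  rcases hb.eq_or_lt with rfl | hb
  · right
    rw [h4, hv]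
    rfl
  · exact Or.inl (h5 b hb hbN hv)

/-! ### The passes over pairs of letters accept the certificate -/

theorem relH_model (hP : Inside P m N) (hφ : φ.word.length ≤ m) (k : ℕ) :
    RelH (modelLetter φ P N k) (modelLetter φ P N (k + (φ.word.length + 1))) := by
  obtain ⟨b, j, hj, rfl⟩ := exists_block φ.word.length k
  rw [show b * (φ.word.length + 1) + j + (φ.word.length + 1) =
    (b + 1) * (φ.word.length + 1) + j by ring, modelLetter_cell (b := b + 1) (by omega) hj]
  rcases Nat.eq_zero_or_pos b with rfl | hb
  · rw [zero_mul, zero_add, modelLetter_header hj]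
    exact relH_header hP rfl
  · rw [modelLetter_cell hb hj]
    exact relH_cell hP hφ hb

theorem relV_model (hP : Inside P m N) (hφ : φ.word.length ≤ m) (k : ℕ) :
    RelV (modelLetter φ P N k) (modelLetter φ P N (k + N * (φ.word.length + 1))) := by
  have hN := hP.two_le
  obtain ⟨b, j, hj, rfl⟩ := exists_block φ.word.length k
  rw [show b * (φ.word.length + 1) + j + N * (φ.word.length + 1) =
    (b + N) * (φ.word.length + 1) + j by ring, modelLetter_cell (b := b + N) (by omega) hj]
  rcases Nat.eq_zero_or_pos b with rfl | hb
  · rw [zero_mul, zero_add, modelLetter_header hj, zero_add]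
    exact relV_header _
  · rw [modelLetter_cell hb hj]
    exact relV_cell hP hφ hb

theorem bits_injective : Function.Injective Nat.bits := by
  intro i
  induction i using Nat.binaryRec' with
  | zero =>
    intro i' h
    cases i' using Nat.binaryRec' with
    | zero => rfl
    | bit d n hd => rw [Nat.zero_bits, Nat.bits_append_bit _ _ hd] at h; cases h
  | bit d n hd ih =>
    intro i' h
    rw [Nat.bits_append_bit _ _ hd] at h
    cases i' using Nat.binaryRec' with
    | zero => rw [Nat.zero_bits] at h; cases h
    | bit d' n' hd' =>
      rw [Nat.bits_append_bit _ _ hd'] at h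
      rw [List.cons.injEq] at h
      rw [h.1, ih h.2]

/-- For a shift shorter than a block, two letters lie in the same block or in consecutive ones. In
the same block, equal digits mean the same agent and hence equal truth values. -/
theorem bit_eq_of_same (hD : D < φ.word.length + 1) {M : ℕ}
    (hk : k + D < M * (φ.word.length + 1)) (h : (modelLetter φ P N k).sym = some .here)
    (h' : (modelLetter φ P N (k + D)).sym = some .here)
    (hp : (modelLetter φ P N k).par = (modelLetter φ P N (k + D)).par)
    (hs : (scans (modelLetter φ P N) (M * (φ.word.length + 1)) D (k + 1)).same = true) :
    (modelLetter φ P N k).bit = (modelLetter φ P N (k + D)).bit := by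
  obtain ⟨b, j, hj, rfl⟩ := exists_block φ.word.length k
  obtain ⟨b', j', hj', e⟩ := exists_block φ.word.length (b * (φ.word.length + 1) + j + D)
  rw [e] at hp h' ⊢
  have hbb : b' = b ∨ b' = b + 1 := by
    have h1 : b < b' + 1 := by
      by_contra hc
      have := Nat.mul_le_mul_right (φ.word.length + 1) (not_lt.1 hc)
      rw [add_mul, one_mul] at this
      omega
    have h2 : b' < b + 2 := by
      by_contra hc
      have := Nat.mul_le_mul_right (φ.word.length + 1) (not_lt.1 hc)
      rw [add_mul] at this
      omega
    omega
  rw [modelLetter_sym hj] at h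
  rw [modelLetter_sym hj'] at h'
  rcases hbb with rfl | rfl
  · obtain ⟨i, s1, n1, l1, t1⟩ := Formula.truth_here h
    obtain ⟨i', s2, n2, l2, t2⟩ := Formula.truth_here h'
    have hsym (t : ℕ) (ht : t < φ.word.length + 1) :
        (modelLetter φ P N (b' * (φ.word.length + 1) + t)).sym = φ.word[t]? := modelLetter_sym ht
    have hb1 : b' + 1 ≤ M := by
      by_contra hc
      have := Nat.mul_le_mul_right (φ.word.length + 1) (Nat.le_of_lt_succ (not_le.1 hc))
      omega
    have hM := Nat.mul_le_mul_right (φ.word.length + 1) hb1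
    rw [add_mul, one_mul] at hM
    rw [scans_same (Nat.bits i) (Nat.bits i') _ (by omega) ?_ ?_ ?_ ?_] at hs
    · obtain rfl : i = i' := bits_injective hs
      rcases Nat.eq_zero_or_pos b' with rfl | hb
      · rw [zero_mul, zero_add, zero_add, modelLetter_header hj, modelLetter_header hj']
        rfl
      · rw [modelLetter_cell hb hj, modelLetter_cell hb hj', Bool.eq_iff_iff]
        exact (t1 _ _).trans (t2 _ _).symm
    · refine spells_iff.2 fun t ht => ?_
      rw [List.length_map] at ht
      rw [add_assoc, add_assoc, hsym _ (by omega), ← add_assoc]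
      exact spells_iff.1 s1 t (by rwa [List.length_map])
    · refine spells_iff.2 fun t ht => ?_
      rw [List.length_map] at ht
      rw [show b' * (φ.word.length + 1) + j + 1 + D + t =
        b' * (φ.word.length + 1) + (j' + 1 + t) by omega, hsym _ (by omega)]
      exact spells_iff.1 s2 t (by rwa [List.length_map])
    · rw [add_assoc, add_assoc, hsym _ (by omega), ← add_assoc]
      exact n1
    · rw [show b' * (φ.word.length + 1) + j + 1 + D + (Nat.bits i').length =
        b' * (φ.word.length + 1) + (j' + 1 + (Nat.bits i').length) by omega, hsym _ (by omega)]
      exact n2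
  -- Consecutive blocks differ in parity, so the test is not applied across them, where bits may
  -- legitimately differ.
  · exfalso
    rw [modelLetter_cell (by omega) hj'] at hp
    rcases Nat.eq_zero_or_pos b with rfl | hb
    · rw [zero_mul, zero_add, modelLetter_header hj] at hp
      simp [headerLetter, cellLetter] at hp
    · rw [modelLetter_cell hb hj] at hp
      simp only [cellLetter, decide_eq_decide] at hp
      omega

theorem scans_model_ok (hP : Inside P m N) (hφ : φ.word.length ≤ m) {M : ℕ}
    (hD : D ≤ M * (φ.word.length + 1)) :
    (scans (modelLetter φ P N) (M * (φ.word.length + 1)) D 0).Ok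
      (if D = 0 then none else some (modelLetter φ P N (D - 1))) := by
  have hN := hP.two_le
  have hlast : ∀ a ∈ (scans (modelLetter φ P N) (M * (φ.word.length + 1)) D 0).last,
      a = modelLetter φ P N D := by
    rcases hD.eq_or_lt with h | h
    · subst h
      have := scans_end (g := modelLetter φ P N) (n := M * (φ.word.length + 1))
        (D := M * (φ.word.length + 1))
      rw [Nat.sub_self] at this
      rw [this]
      simp [Scanner.fresh]
    · rw [scans_last h]
      intro a ha
      exact (Option.some.inj ha).symm
  have hprev : ∀ a ∈ (if D = 0 then none else some (modelLetter φ P N (D - 1))), a.sym = none →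
      a = modelLetter φ P N (D - 1) ∧ ∃ b, D = (b + 1) * (φ.word.length + 1) := by
    intro a ha has
    split at ha
    · simp at ha
    · obtain rfl := Option.some.inj ha
      refine ⟨rfl, ?_⟩
      obtain ⟨b, j, hj, e⟩ := exists_block φ.word.length (D - 1)
      rw [e, modelLetter_sym hj, List.getElem?_eq_none_iff] at has
      refine ⟨b, ?_⟩
      rw [add_mul, one_mul]
      omega
  refine ⟨fun a ha hh => ?_, fun a ha has hh => ?_, fun a ha c hc has hch hcr hcb => ?_⟩
  · rw [hlast a ha, modelLetter_hdr] at hh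
    rw [scans_okA hD]
    exact fun k hk h1 h2 h3 h4 => bit_eq_of_same hh hk h1 h2 h3 h4
  · obtain ⟨rfl, b, e⟩ := hprev a ha has
    rw [modelLetter_hdr] at hh
    have hb : b = 0 := by
      by_contra hc
      have := Nat.mul_le_mul_right (φ.word.length + 1) (show 2 ≤ b + 1 by omega)
      omega
    subst hb
    rw [scans_okH hD]
    intro k _
    rw [e, zero_add, one_mul]
    exact relH_model hP hφ k
  · obtain ⟨-, b, e⟩ := hprev a ha has
    obtain rfl := hlast c hc
    have hg : modelLetter φ P N D = cellLetter φ P N (b + 1) 0 := by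
      rw [e, ← add_zero ((b + 1) * _), modelLetter_cell (by omega) (by omega)]
    rw [hg] at hcr hcb
    simp only [cellLetter, decide_eq_true_eq] at hcr hcb
    -- A cell in the bottom row at the right end is cell N, so no other shift triggers the vertical
    -- test.
    have hb : b + 1 = N := le_antisymm hcb (Nat.le_of_dvd (by omega) hcr)
    rw [hb] at e
    rw [scans_okV hD]
    intro k _
    rw [e]
    exact relV_model hP hφ k

/-- The verifier accepts a certificate of polynomial length for every satisfiable formula. -/
theorem exists_certificate {w : List Symbol} (hw : w ∈ satWords cap free) :
    ∃ c : List Bool, c.length ≤ Nat.card Letter * (side w.length ^ 2 * (w.length + 1)) ∧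
      (satVerifier cap free).verify (w, c) = true := by
  obtain ⟨φ, hA, rfl, P₀, v₀, h₀⟩ := hw
  obtain ⟨P, v, hv, hv1, hv2, hP⟩ := φ.exists_small_model h₀
  obtain ⟨N, hN⟩ : ∃ N, side φ.word.length = N := ⟨_, rfl⟩
  rw [hN] at hv1 hv2 hP ⊢
  obtain ⟨b, hb, hbN, -, rfl⟩ := exists_cellPoint (N := N) (v := v) (by omega) (by omega)
  obtain ⟨l, hl⟩ : ∃ l, l = (List.range (N * N * (φ.word.length + 1))).map fun k =>
      modelLetter φ P N (φ.word.length + 1 + k) := ⟨_, rfl⟩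
  obtain ⟨c, hc, hcl⟩ := exists_decode_satVerifier cap free l fun a ha => by
    rw [hl] at ha
    obtain ⟨k, -, rfl⟩ := List.mem_map.1 ha
    rw [Bool.eq_false_iff, Ne, modelLetter_hdr]
    omega
  refine ⟨c, ?_, ?_⟩
  · rwa [hl, List.length_map, List.length_range, ← pow_two] at hc
  · have hword : (satVerifier cap free).word φ.word c =
        (List.range ((N * N + 1) * (φ.word.length + 1))).map (modelLetter φ P N) := by
      have e : (satVerifier cap free).word φ.word c =
          (φ.word.map fun x => headerLetter (some x)) ++ headerLetter none :: l := by
        rw [← hcl]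
        rfl
      rw [e, show (N * N + 1) * (φ.word.length + 1) =
        φ.word.length + 1 + N * N * (φ.word.length + 1) by ring, List.range_add, List.map_append,
        List.map_map, hl, List.range_succ, List.map_append, List.append_assoc]
      congr 1
      · apply List.ext_getElem
        · simp
        · intro k h1 h2
          have hk : k < φ.word.length := by simpa using h1
          simp [modelLetter_header (Nat.lt_succ_of_lt hk), hk]
      · simp [modelLetter_header]
    unfold ShiftVerifier.verify
    rw [hword]
    exact (satVerifier_accepts_iff _ _).2 ⟨reads_model_zero hP le_rfl hA hb hbN hv rfl,
      fun D hD => scans_model_ok hP le_rfl hD⟩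

end certificate

open Polynomial in
theorem inNP_satWords (cap : ℕ) (free : Bool) : InNP (satWords cap free) := by
  have : Fintype Symbol := Fintype.ofFinite _
  refine ⟨(satVerifier cap free).verify,
    -- One block per cell of the square, with the word and its end letter in each block, and at most
    -- `Nat.card Letter` binary digits per letter in the unary code.
    C (Nat.card Letter) * ((X * (2 * (X + 1)) + 2) ^ 2 * (X + 1)),
    (satVerifier cap free).polyTime, fun w => ⟨fun hw => ?_, ?_⟩⟩
  · obtain ⟨c, hc, h⟩ := exists_certificate hw
    exact ⟨c, by simpa [side] using hc, h⟩
  · rintro ⟨c, -, h⟩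
    exact mem_satWords_of_verify h

end CompassLogic

theorem mainTheorem8 :
    (∀ n : ℕ, CompassLogic.InNP (CompassLogic.satProblem n)) ∧
      CompassLogic.InNP CompassLogic.satProblemUniform := by
  constructor
  · intro n
    rw [CompassLogic.satProblem_eq]
    exact CompassLogic.inNP_satWords n false
  · rw [CompassLogic.satProblemUniform_eq]
    exact CompassLogic.inNP_satWords 0 true
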